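/- **Setting.** Let $(X,Y)$ take values in $\mathcal X\times\mathbb R$, let $\Pi$ be the law of $X$, and let $(x_i,y_i)_{i\ge1}$ be i.i.d. copies of $(X,Y)$. Let $\mathcal H_1,\dots,\mathcal H_M$ ($M$ fixed) be reproducing kernel Hilbert spaces of measurable functions on $\mathcal X$ with kernels $k_m(x,x')=\sum_j\mu_{j,m}\phi_{j,m}(x)\phi_{j,m}(x')$, where $\mu_{j,m}\ge 0$ and the $\phi_{j,m}$ with $\mu_{j,m}>0$ are orthonormal in $L_2(\Pi)$. Let $\mathcal H=\mathcal H_1\oplus\dots\oplus\mathcal H_M$ with $\|f\|_{\mathcal H}^2=\sum_m\|f_m\|_{\mathcal H_m}^2$ and write $f(x)=\sum_m f_m(x)$. The covariance operators $\Sigma_{l,m}:\mathcal H_m\to\mathcal H_l$ are given by $\langle f,\Sigma_{l,m}g\rangle_{\mathcal H_l}=\mathbb E[f(X)g(X)]$. For sets of indices, $\Sigma_{I,J}=(\Sigma_{l,m})_{l\in I,m\in J}$ is the corresponding block operator. **Assumptions.** Let $f^*\in\mathcal H$, $I_0=\{m:\|f^*_m\|_{\mathcal H_m}>0\}$, $J=I_0^c$.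 - (A1) $\mathbb E[Y\mid X]=f^*(X)$; with $\epsilon=Y-f^*(X)$, there are $\sigma>0$ and $L$ with $\mathbb E[\epsilon^2\mid X]>\sigma^2$ and $|\epsilon|\le L$ almost surely. - (A2) Each $\mathcal H_m$ is separable and $\sup_x|k_m(x,x)|<1$. - (A3) For each $m$ there is $g^*_m\in\mathcal H_m$ with $f^*_m(x)=\int k_m^{(1/2)}(x,x')g^*_m(x')\,d\Pi(x')$ for all $x$, where $k_m^{(1/2)}(x,\cdot)=\sum_j\mu_{j,m}^{1/2}\phi_{j,m}(x)\phi_{j,m}$ in $L_2(\Pi)$. - (A10) The cross-correlation operators $V_{l,m}:\mathcal H_m\to\mathcal H_l$, given by $\Sigma_{l,l}^{1/2}V_{l,m}\Sigma_{m,m}^{1/2}=\Sigma_{l,m}$, are compact for $l\ne m$, and the joint operator $V=(V_{l,m})_{l,m}$ on $\mathcal H$ is invertible. **Estimator.** Let $\lambda_1=\lambda_1^{(n)}\ge0$ and $\lambda_2=\lambda_2^{(n)}>0$ be deterministic sequences, let $\hat f=\hat f^{(n)}\in\mathcal H$ be the minimizer of $$\frac1n\sum_{i=1}^n\bigl(y_i-f(x_i)\bigr)^2+\lambda_1\sum_{m=1}^M\|f_m\|_{\mathcal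 H_m}+\lambda_2\sum_{m=1}^M\|f_m\|_{\mathcal H_m}^2,$$ and let $\hat I=\{m:\|\hat f_m\|_{\mathcal H_m}>0\}$. **Theorem.** Assume (A1), (A2), (A3) and (A10), and suppose that, as $n\to\infty$, $\|\hat f-f^*\|_{\mathcal H}\to0$ in probability and $P(\hat I=I_0)\to1$. Then: 1. if $I_0\neq\emptyset$, then $\lambda_1\to0$ and $\lambda_2\to0$; 2. for every $m\in J$, $$\limsup_{n\to\infty}\Bigl\|\Sigma_{m,I_0}(\Sigma_{I_0,I_0}+\lambda_2)^{-1}\Bigl(D+2\tfrac{\lambda_2}{\lambda_1}\Bigr)f^*_{I_0}\Bigr\|_{\mathcal H_m}\le1,\qquad D=\mathrm{Diag}\bigl(\|f^*_l\|_{\mathcal H_l}^{-1}\bigr)_{l\in I_0};$$ 3. if $\mathcal H_m\ne\{0\}$ for some $m\in J$, then $\lambda_1\sqrt n\to\infty$. (In 2, if $\mathcal H_m\neq\{0\}$ then $\lambda_1>0$ for all large $n$ by 3; if $\mathcal H_m=\{0\}$ the norm is $0$.) -/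

import Mathlib

open MeasureTheory ProbabilityTheory Filter Topology
open scoped ENNReal InnerProductSpace

noncomputable section

namespace ElasticMKL

/-! ### Operators on finite Hilbert sums -/

section Blocks

variable {ι κ : Type*} [Fintype ι] [Fintype κ]
  {E : ι → Type*} {F : κ → Type*}
  [∀ i, NormedAddCommGroup (E i)] [∀ i, InnerProductSpace ℝ (E i)]
  [∀ j, NormedAddCommGroup (F j)] [∀ j, InnerProductSpace ℝ (F j)]

/-- The row operator `h ↦ ∑ j, A j (h j)` on the Hilbert sum of the spaces `F j`. -/
def rowOp {G : Type*} [NormedAddCommGroup G] [InnerProductSpace ℝ G]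
    (A : ∀ j, F j →L[ℝ] G) : PiLp 2 F →L[ℝ] G :=
  ∑ j, A j ∘L PiLp.proj 2 F j

/-- The block operator `(h j)_j ↦ (∑ j, A i j (h j))_i` between Hilbert sums. -/
def blockOp (A : ∀ i j, F j →L[ℝ] E i) : PiLp 2 F →L[ℝ] PiLp 2 E :=
  (PiLp.continuousLinearEquiv 2 ℝ E).symm.toContinuousLinearMap ∘L
    ContinuousLinearMap.pi (fun i => rowOp (A i))

/-- The block-diagonal operator `(h i)_i ↦ (c i • h i)_i`. -/
def diagOp (c : ι → ℝ) : PiLp 2 E →L[ℝ] PiLp 2 E :=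
  (PiLp.continuousLinearEquiv 2 ℝ E).symm.toContinuousLinearMap ∘L
    ContinuousLinearMap.pi (fun i => c i • PiLp.proj 2 E i)

set_option linter.unusedSectionVars false

theorem rowOp_apply {G : Type*} [NormedAddCommGroup G] [InnerProductSpace ℝ G]
    (A : ∀ j, F j →L[ℝ] G) (h : PiLp 2 F) : rowOp A h = ∑ j, A j (h j) := by
  simp [rowOp]

theorem blockOp_apply (A : ∀ i j, F j →L[ℝ] E i) (h : PiLp 2 F) (i : ι) :
    blockOp A h i = ∑ j, A i j (h j) := by
  simp [blockOp, rowOp]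

theorem diagOp_apply (c : ι → ℝ) (h : PiLp 2 E) (i : ι) :
    diagOp c h i = c i • h i := by
  simp [diagOp]

end Blocks

open Classical in
/-- The positive square root of a bounded operator `T` on a real Hilbert space: the
positive operator `R` with `R ∘ R = T` (it exists and is unique when `T` is positive). -/
def posSqrt {G : Type*} [NormedAddCommGroup G] [InnerProductSpace ℝ G]
    (T : G →L[ℝ] G) : G →L[ℝ] G :=
  if h : ∃ R : G →L[ℝ] G, R.IsPositive ∧ R ∘L R = T then h.choose else 0

/-! ### Covariance operators -/

section Covariance

variable {𝒳 : Type*} [MeasurableSpace 𝒳]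

open Classical in
/-- The (non-centered) cross-covariance operator `G₂ → G₁` of two reproducing kernel Hilbert
spaces: the bounded operator `T` with `⟪f, T g⟫ = E[f(X) g(X)]`, where `X` has law `ν`. -/
def crossCov (ν : Measure 𝒳) (G₁ G₂ : Type*)
    [NormedAddCommGroup G₁] [InnerProductSpace ℝ G₁] [RKHS ℝ G₁ 𝒳 ℝ]
    [NormedAddCommGroup G₂] [InnerProductSpace ℝ G₂] [RKHS ℝ G₂ 𝒳 ℝ] : G₂ →L[ℝ] G₁ :=
  if h : ∃ T : G₂ →L[ℝ] G₁, ∀ (f : G₁) (g : G₂), ⟪f, T g⟫_ℝ = ∫ x, f x * g x ∂ν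
  then h.choose else 0

variable {M : ℕ} (H : Fin M → Type*)
  [∀ m, NormedAddCommGroup (H m)] [∀ m, InnerProductSpace ℝ (H m)]
  [∀ m, RKHS ℝ (H m) 𝒳 ℝ]

/-- The covariance operator `Σ_{I,I}` on the Hilbert sum of the `H m`, `m ∈ I`. -/
def covII (ν : Measure 𝒳) (I : Finset (Fin M)) :
    PiLp 2 (fun m : I => H m) →L[ℝ] PiLp 2 (fun m : I => H m) :=
  blockOp (fun l m : I => crossCov ν (H l) (H m))

/-- The cross-covariance operator `Σ_{m,I}` from the Hilbert sum of the `H l`, `l ∈ I`,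
to `H m`. -/
def covRow (ν : Measure 𝒳) (m : Fin M) (I : Finset (Fin M)) :
    PiLp 2 (fun l : I => H l) →L[ℝ] H m :=
  rowOp (fun l : I => crossCov ν (H m) (H l))

variable {H}

/-- The set of active kernels `{m | ‖f m‖ > 0}`. -/
def activeSet (f : PiLp 2 H) : Finset (Fin M) :=
  open Classical in Finset.univ.filter (fun m => 0 < ‖f m‖)

/-- The restriction `f_I = (f m)_{m ∈ I}`. -/
def restrict (f : PiLp 2 H) (I : Finset (Fin M)) : PiLp 2 (fun m : I => H m) :=
  WithLp.toLp 2 (fun m : I => f m)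

/-- The vector `Σ_{m,I} (Σ_{I,I} + b)⁻¹ (D + 2 b / a) f_I ∈ H m`, where `I` is the set of active
kernels of `f` and `D = Diag(‖f l‖⁻¹)` on the Hilbert sum over `I`. -/
def irrepVec (ν : Measure 𝒳) (f : PiLp 2 H) (a b : ℝ) (m : Fin M) : H m :=
  covRow H ν m (activeSet f)
    (Ring.inverse (covII H ν (activeSet f) + b • 1)
      (diagOp (fun l : activeSet f => ‖f l‖⁻¹) (restrict f (activeSet f))
        + (2 * (b / a)) • restrict f (activeSet f)))

/-! ### The estimator -/

/-- The function `x ↦ ∑ m, f m x` on the input space. -/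
def evalSum (f : PiLp 2 H) (x : 𝒳) : ℝ := ∑ m, f m x

/-- The elastic-net multiple kernel learning objective on the first `n` sample points. -/
def objective (z : ℕ → 𝒳 × ℝ) (n : ℕ) (a b : ℝ) (f : PiLp 2 H) : ℝ :=
  (1 / (n : ℝ)) * ∑ i ∈ Finset.range n, ((z i).2 - evalSum f (z i).1) ^ 2
    + a * ∑ m, ‖f m‖ + b * ∑ m, ‖f m‖ ^ 2

/-! ### Assumptions -/

/-- The σ-algebra generated by the input coordinate `X` on `𝒳 × ℝ`. -/
abbrev inputSigma (𝒳 : Type*) [MeasurableSpace 𝒳] : MeasurableSpace (𝒳 × ℝ) :=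
  MeasurableSpace.comap Prod.fst inferInstance

/-- The model is well specified by `f`: `E[Y | X] = ∑ m, f m (X)`, and the noise
`ε = Y - ∑ m, f m (X)` is bounded with conditional variance bounded away from zero. -/
structure ModelAssumption (ρ : Measure (𝒳 × ℝ)) (f : PiLp 2 H) : Prop where
  regression : ρ[fun z => z.2 | inputSigma 𝒳] =ᵐ[ρ] fun z => evalSum f z.1
  noise_var : ∃ σ : ℝ, 0 < σ ∧
    ∀ᵐ z ∂ρ, σ ^ 2 < (ρ[fun z => (z.2 - evalSum f z.1) ^ 2 | inputSigma 𝒳]) z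
  noise_bdd : ∃ L : ℝ, ∀ᵐ z ∂ρ, |z.2 - evalSum f z.1| ≤ L

/-- The real-valued reproducing kernel `k(x, x')` of a reproducing kernel Hilbert space. -/
def ker (G : Type*) [NormedAddCommGroup G] [InnerProductSpace ℝ G] [CompleteSpace G]
    [RKHS ℝ G 𝒳 ℝ] (x x' : 𝒳) : ℝ := RKHS.kernel G x x' 1

/-- A separable space of measurable functions whose kernel satisfies
`sup_x |k(x, x)| < 1`. -/
structure KernelAssumption (G : Type*) [NormedAddCommGroup G] [InnerProductSpace ℝ G]
    [CompleteSpace G] [RKHS ℝ G 𝒳 ℝ] : Prop where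
  measurable : ∀ f : G, Measurable (fun x => f x)
  separable : TopologicalSpace.SeparableSpace G
  bounded : ∃ c : ℝ, c < 1 ∧ ∀ x : 𝒳, |ker G x x| ≤ c

/-- The sup norm is bounded by the norm of the space. -/
theorem norm_apply_le_norm {G : Type*} [NormedAddCommGroup G] [InnerProductSpace ℝ G]
    [CompleteSpace G] [RKHS ℝ G 𝒳 ℝ] (h : KernelAssumption G) (f : G) (x : 𝒳) :
    ‖f x‖ ≤ ‖f‖ := by
  obtain ⟨c, hc, hb⟩ := h.bounded
  have h1 : ‖RKHS.kernel G x x‖ ≤ 1 := by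
    refine ContinuousLinearMap.opNorm_le_bound _ zero_le_one fun v => ?_
    have : RKHS.kernel G x x v = v * RKHS.kernel G x x 1 := by
      rw [← smul_eq_mul, ← map_smul]; simp
    rw [this, norm_mul, mul_comm]
    gcongr
    exact (hb x).trans hc.le
  calc ‖f x‖ ≤ ‖f‖ * √‖RKHS.kernel G x x‖ := RKHS.norm_apply_le f x
    _ ≤ ‖f‖ * 1 := by
      gcongr
      exact Real.sqrt_le_one.mpr h1
    _ = ‖f‖ := mul_one _

/-- Under these conditions the operator in the definition of `crossCov` exists. -/
theorem inner_crossCov {ν : Measure 𝒳} [IsProbabilityMeasure ν] {G₁ G₂ : Type*}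
    [NormedAddCommGroup G₁] [InnerProductSpace ℝ G₁] [CompleteSpace G₁] [RKHS ℝ G₁ 𝒳 ℝ]
    [NormedAddCommGroup G₂] [InnerProductSpace ℝ G₂] [CompleteSpace G₂] [RKHS ℝ G₂ 𝒳 ℝ]
    (h₁ : KernelAssumption G₁) (h₂ : KernelAssumption G₂) (f : G₁) (g : G₂) :
    ⟪f, crossCov ν G₁ G₂ g⟫_ℝ = ∫ x, f x * g x ∂ν := by
  have key : ∀ (f : G₁) (g : G₂) x, ‖f x * g x‖ ≤ ‖f‖ * ‖g‖ := fun f g x => by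
    rw [norm_mul]
    exact mul_le_mul (norm_apply_le_norm h₁ f x) (norm_apply_le_norm h₂ g x)
      (norm_nonneg _) (norm_nonneg _)
  have hint : ∀ (f : G₁) (g : G₂), Integrable (fun x => f x * g x) ν := fun f g =>
    Integrable.of_bound ((h₁.measurable f).mul (h₂.measurable g)).aestronglyMeasurable
      (‖f‖ * ‖g‖) (Eventually.of_forall (key f g))
  let B : G₂ →ₗ[ℝ] G₁ →ₗ[ℝ] ℝ := LinearMap.mk₂ ℝ (fun g f => ∫ x, f x * g x ∂ν)
    (fun g g' f => by
      simp only [RKHS.coe_add, Pi.add_apply, mul_add]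
      exact integral_add (hint f g) (hint f g'))
    (fun c g f => by
      simp only [RKHS.coe_smul, Pi.smul_apply, smul_eq_mul]
      rw [← integral_const_mul]; congr 1; ext x; ring)
    (fun g f f' => by
      simp only [RKHS.coe_add, Pi.add_apply, add_mul]
      exact integral_add (hint f g) (hint f' g))
    (fun c g f => by
      simp only [RKHS.coe_smul, Pi.smul_apply, smul_eq_mul]
      rw [← integral_const_mul]; congr 1; ext x; ring)
  let L : G₂ →L[ℝ] G₁ →L[ℝ] ℝ := LinearMap.mkContinuous₂ B 1 fun g f => by
    refine (norm_integral_le_of_norm_le_const (Eventually.of_forall (key f g))).trans ?_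
    simp [mul_comm]
  have hex : ∃ T : G₂ →L[ℝ] G₁, ∀ (f : G₁) (g : G₂), ⟪f, T g⟫_ℝ = ∫ x, f x * g x ∂ν := by
    refine ⟨(InnerProductSpace.toDual ℝ G₁).symm.toContinuousLinearEquiv.toContinuousLinearMap
      ∘L L, fun f g => ?_⟩
    rw [real_inner_comm]
    simp only [ContinuousLinearMap.comp_apply]
    exact InnerProductSpace.toDual_symm_apply
  rw [crossCov, dif_pos hex]
  exact hex.choose_spec f g

/-- The spectral representation `k(x, x') = ∑ j, μ j * φ j x * φ j x'`, with `μ j ≥ 0` and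
`φ` orthonormal in `L²(ν)`. Indices with `μ j = 0` are padding (so that kernels of finite rank are
covered) and carry no orthonormality requirement. -/
structure SpectralRep (ν : Measure 𝒳) (k : 𝒳 → 𝒳 → ℝ) (μ : ℕ → ℝ) (φ : ℕ → 𝒳 → ℝ) : Prop where
  nonneg : ∀ j, 0 ≤ μ j
  memLp : ∀ j, MemLp (φ j) 2 ν
  orthonormal : ∀ i j, 0 < μ i → 0 < μ j → ∫ x, φ i x * φ j x ∂ν = if i = j then 1 else 0
  hasSum : ∀ x x', HasSum (fun j => μ j * φ j x * φ j x') (k x x')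

/-- The kernel square root `k^{1/2}(x, ·) = ∑ j, √(μ j) * φ j x * φ j` as an element of `L²(ν)`. -/
def halfKernel {ν : Measure 𝒳} {k : 𝒳 → 𝒳 → ℝ} {μ : ℕ → ℝ} {φ : ℕ → 𝒳 → ℝ}
    (h : SpectralRep ν k μ φ) (x : 𝒳) : Lp ℝ 2 ν :=
  ∑' j, (√(μ j) * φ j x) • (h.memLp j).toLp (φ j)

/-- The source condition: `f(x) = ∫ k^{1/2}(x, x') g(x') dν(x')` for some `g` in the space. -/
def SourceCondition {G : Type*} [NormedAddCommGroup G] [InnerProductSpace ℝ G]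
    [RKHS ℝ G 𝒳 ℝ] {ν : Measure 𝒳} {k : 𝒳 → 𝒳 → ℝ} {μ : ℕ → ℝ} {φ : ℕ → 𝒳 → ℝ}
    (h : SpectralRep ν k μ φ) (f : G) : Prop :=
  ∃ g : G, ∀ x, f x = ∫ x', halfKernel h x x' * g x' ∂ν

variable (H) in
/-- The cross-correlation operators `V_{l,m}`, given by
`Σ_{l,l}^{1/2} V_{l,m} Σ_{m,m}^{1/2} = Σ_{l,m}`, are compact for `l ≠ m`, and the joint
correlation operator `V` is invertible. -/
def CorrelationAssumption (ν : Measure 𝒳) : Prop :=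
  ∃ V : ∀ l m, H m →L[ℝ] H l,
    (∀ l m, posSqrt (crossCov ν (H l) (H l)) ∘L V l m ∘L posSqrt (crossCov ν (H m) (H m))
      = crossCov ν (H l) (H m)) ∧
    (∀ l m, l ≠ m → IsCompactOperator (V l m)) ∧
    IsUnit (blockOp V : PiLp 2 H →L[ℝ] PiLp 2 H)

end Covariance

end ElasticMKL

end

/-!
Write `I` for the active set of the true function `f`, `ε = Y - f(X)` for the noise, and `J` for
the map sending a vector of the Hilbert sum over `I` to the sum of its blocks in `L²` of the law
of `X`, so that `Σ_{I,I} = J† J`. Everything rests on the first-order conditions of the minimizer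
`fhat` on the event, of probability tending to one, that `fhat` has active set `I` and is close to
`f` (`goodEvent`). With `r = fhat - f` on `I` and `w l = λ₂ + λ₁ / (2 ‖f l‖)`, and up to
fluctuations, they read `(J† J + Diag(w)) r ≈ J† ε - Diag(w) f` on the active blocks, and
`|⟪J r, v⟫ - ⟪ε, v⟫| ≤ λ₁ / 2` for every unit vector `v` of an inactive block (`stationarity_active`,
`stationarity_inactive`). Eliminating `r` with the ridge solution `s = (J† J + Diag(w))⁻¹ J† v`
gives the central estimate
  `|⟪ε, v - s⟫ + ⟪Diag(w) f, s⟫| ≤ λ₁ / 2 + o(λ₁ + 1 / √n)`,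
where `⟪ε, ·⟫` is a sample mean (`exists_noise_residual_dominating`).

The weights of the exact equation are random, as they involve `‖fhat l‖`, whereas `s` has to be
deterministic for the fluctuations to be controllable. The resulting error
`∑ l, (w l - ŵ l) ⟪s l, r l⟫` is not covered by `‖r‖ → 0`, because `‖s‖` may blow up. It is
controlled by expanding `⟪s l, r l⟫` recursively along deterministic ridge solutions, which only
involves the seminorm `‖J ·‖`
(`exists_dominating`, `exists_residual_dominating`). For this the inverse of `J† J + Diag(w)` has
to be bounded, up to the factor `1 / min w`, in that seminorm (`norm_map_ridgeInv_le`), which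
follows from the invertibility of the correlation operator: the `L²` norm of a sum of functions
from the different spaces controls the `L²` norms of the summands
(`CorrelationAssumption.exists_sum_norm_sq_le`). The source condition makes `⟪f l, ·⟫` bounded in
the same seminorm (`SourceCondition.exists_abs_inner_le`).

The three claims follow. Testing the active equation with an active block of `f` forces the
weights, hence `λ₁` and `λ₂`, to zero (`tendsto_parameters`). If `λ₁ √n` were bounded along a
subsequence, the central estimate would confine `√n ⟪ε, v - s⟫` to a bounded interval with
probability close to one; but `v - s` converges in `L²` to the residual of the projection of `v`
onto the closed range of `J`, which is nonzero by the separation of the summands, so the central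
limit theorem forbids it (`tendsto_lam_mul_sqrt`). Once `λ₁ √n → ∞`, the noise is `o(λ₁)` and the
central estimate becomes `|⟪Diag(w) f, s⟫| ≤ λ₁ / 2 + o(λ₁)`. Replacing `Diag(w)` by `λ₂` in the
definition of `s` costs `o(λ₁)` by the source condition (`exists_forall_inner_ridgeInv_le`), and
by self-adjointness what remains is `λ₁ / 2` times the pairing of `v` with the vector of the
irrepresentable condition (`inner_irrepVec`, `eventually_norm_irrepVec_le`).
-/

noncomputable section

namespace ElasticMKL

set_option linter.unusedSectionVars false

/-! ### Ridge-regularised operators on a finite Hilbert sum -/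

section Ridge

variable {ι : Type*} [Fintype ι] {F : ι → Type*}
  [∀ i, NormedAddCommGroup (F i)] [∀ i, InnerProductSpace ℝ (F i)]
  {L : Type*} [NormedAddCommGroup L] [InnerProductSpace ℝ L]

theorem inner_diagOp (c : ι → ℝ) (x y : PiLp 2 F) :
    ⟪x, diagOp c y⟫_ℝ = ∑ i, c i * ⟪x i, y i⟫_ℝ := by
  simp [PiLp.inner_apply, diagOp_apply, inner_smul_right]

theorem inner_diagOp_comm (c : ι → ℝ) (x y : PiLp 2 F) :
    ⟪diagOp c x, y⟫_ℝ = ⟪x, diagOp c y⟫_ℝ := by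
  rw [inner_diagOp, real_inner_comm, inner_diagOp]
  exact Finset.sum_congr rfl fun i _ => by rw [real_inner_comm]

theorem diagOp_diagOp (c d : ι → ℝ) (x : PiLp 2 F) :
    diagOp c (diagOp d x) = diagOp (fun i => c i * d i) x := by
  ext i; simp [diagOp_apply, mul_smul]

theorem diagOp_one (x : PiLp 2 F) : diagOp (fun _ => (1 : ℝ)) x = x := by
  ext i; simp [diagOp_apply]

theorem diagOp_const (b : ℝ) (x : PiLp 2 F) : diagOp (fun _ => b) x = b • x := by
  ext i; simp [diagOp_apply]

theorem le_inner_diagOp {c : ι → ℝ} {k : ℝ} (hc : ∀ i, k ≤ c i) (x : PiLp 2 F) :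
    k * ‖x‖ ^ 2 ≤ ⟪x, diagOp c x⟫_ℝ := by
  rw [inner_diagOp, PiLp.norm_sq_eq_of_L2, Finset.mul_sum]
  refine Finset.sum_le_sum fun i _ => ?_
  rw [real_inner_self_eq_norm_sq]
  exact mul_le_mul_of_nonneg_right (hc i) (by positivity)

theorem inner_diagOp_nonneg {c : ι → ℝ} (hc : ∀ i, 0 ≤ c i) (x : PiLp 2 F) :
    0 ≤ ⟪x, diagOp c x⟫_ℝ := by
  simpa using le_inner_diagOp hc x

/-- A map `J` out of a Hilbert sum controls block-diagonal operators with constant `C`: rescaling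
the blocks by factors of size at most `K` enlarges `‖J t‖` by at most `K * C`. For `J` the embedding
of a sum of function spaces into `L²`, this expresses that the summands are in
general position with respect to the (weaker) `L²` norm. -/
def DiagBounded (J : PiLp 2 F →L[ℝ] L) (C : ℝ) : Prop :=
  ∀ (c : ι → ℝ) (K : ℝ), (∀ i, |c i| ≤ K) → ∀ t, ‖J (diagOp c t)‖ ≤ K * C * ‖J t‖

variable [∀ i, CompleteSpace (F i)] [CompleteSpace L]

/-- The operator `J† J + Diag(a)`. -/
def ridge (J : PiLp 2 F →L[ℝ] L) (a : ι → ℝ) : PiLp 2 F →L[ℝ] PiLp 2 F :=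
  J.adjoint ∘L J + diagOp a

theorem inner_ridge (J : PiLp 2 F →L[ℝ] L) (a : ι → ℝ) (h u : PiLp 2 F) :
    ⟪h, ridge J a u⟫_ℝ = ⟪J h, J u⟫_ℝ + ⟪h, diagOp a u⟫_ℝ := by
  simp [ridge, inner_add_right, ContinuousLinearMap.adjoint_inner_right]

theorem isUnit_ridge (J : PiLp 2 F →L[ℝ] L) {a : ι → ℝ} (ha : ∀ i, 0 < a i) :
    IsUnit (ridge J a) := by
  obtain ⟨k, hk, hka⟩ : ∃ k : ℝ, 0 < k ∧ ∀ i, k ≤ a i := by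
    rcases isEmpty_or_nonempty ι with h | h
    · exact ⟨1, one_pos, fun i => h.elim i⟩
    · obtain ⟨i, hi⟩ := Finite.exists_min a
      exact ⟨a i, ha i, hi⟩
  refine ContinuousLinearMap.isUnit_of_forall_le_norm_inner_map _ (c := ⟨k, hk.le⟩) hk fun x => ?_
  rw [real_inner_comm, inner_ridge, Real.norm_eq_abs]
  refine le_trans ?_ (le_abs_self _)
  have h1 := le_inner_diagOp hka x
  have h2 : 0 ≤ ⟪J x, J x⟫_ℝ := real_inner_self_nonneg
  change ‖x‖ ^ 2 * k ≤ _
  linarith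

/-- The inverse of `J† J + Diag(a)`; it is a genuine inverse as soon as all `a i` are positive. -/
def ridgeInv (J : PiLp 2 F →L[ℝ] L) (a : ι → ℝ) : PiLp 2 F →L[ℝ] PiLp 2 F :=
  Ring.inverse (ridge J a)

theorem ridge_ridgeInv (J : PiLp 2 F →L[ℝ] L) {a : ι → ℝ} (ha : ∀ i, 0 < a i)
    (t : PiLp 2 F) : ridge J a (ridgeInv J a t) = t := by
  have := Ring.mul_inverse_cancel _ (isUnit_ridge J ha)
  exact congrArg (fun T : PiLp 2 F →L[ℝ] PiLp 2 F => T t) this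

theorem ridgeInv_ridge (J : PiLp 2 F →L[ℝ] L) {a : ι → ℝ} (ha : ∀ i, 0 < a i)
    (t : PiLp 2 F) : ridgeInv J a (ridge J a t) = t := by
  have := Ring.inverse_mul_cancel _ (isUnit_ridge J ha)
  exact congrArg (fun T : PiLp 2 F →L[ℝ] PiLp 2 F => T t) this

/-- The variational equation solved by `ridgeInv J a t`. -/
theorem inner_ridgeInv (J : PiLp 2 F →L[ℝ] L) {a : ι → ℝ} (ha : ∀ i, 0 < a i)
    (h t : PiLp 2 F) :
    ⟪J h, J (ridgeInv J a t)⟫_ℝ + ⟪h, diagOp a (ridgeInv J a t)⟫_ℝ = ⟪h, t⟫_ℝ := by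
  rw [← inner_ridge, ridge_ridgeInv J ha]

theorem norm_ridgeInv_le (J : PiLp 2 F →L[ℝ] L) {a : ι → ℝ} {k : ℝ} (hk : 0 < k)
    (ha : ∀ i, k ≤ a i) (t : PiLp 2 F) : ‖ridgeInv J a t‖ ≤ k⁻¹ * ‖t‖ := by
  set u := ridgeInv J a t with hu
  have h1 := inner_ridgeInv J (fun i => hk.trans_le (ha i)) u t
  rw [← hu] at h1
  have h2 : 0 ≤ ⟪J u, J u⟫_ℝ := real_inner_self_nonneg
  have h3 := le_inner_diagOp ha u
  have h4 := real_inner_le_norm u t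
  rw [inv_mul_eq_div, le_div_iff₀ hk]
  rcases (norm_nonneg u).eq_or_lt with h | h
  · rw [← h]; simp
  · nlinarith

/-- The inverse `(J† J + Diag(a))⁻¹` is bounded by a multiple of `1 / min a` also for the weaker
seminorm `‖J ·‖`: pair the equation with `Diag(a)⁻¹ J† J u`. -/
theorem norm_map_ridgeInv_le {J : PiLp 2 F →L[ℝ] L} {C : ℝ} (hJ : DiagBounded J C)
    {a : ι → ℝ} {k : ℝ} (hk : 0 < k) (ha : ∀ i, k ≤ a i) (t : PiLp 2 F) :
    ‖J (ridgeInv J a t)‖ ≤ k⁻¹ * C * ‖J t‖ := by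
  have ha0 : ∀ i, 0 < a i := fun i => hk.trans_le (ha i)
  set u := ridgeInv J a t with hu
  set b : ι → ℝ := fun i => (a i)⁻¹ with hb
  set z := J.adjoint (J u) with hz
  have h1 := inner_ridgeInv J ha0 (diagOp b z) t
  have h2 : ⟪diagOp b z, diagOp a u⟫_ℝ = ⟪J u, J u⟫_ℝ := by
    rw [inner_diagOp_comm, diagOp_diagOp]
    have : (fun i => b i * a i) = fun _ => (1 : ℝ) := by
      ext i; exact inv_mul_cancel₀ (ha0 i).ne'
    rw [this, diagOp_one, hz, ContinuousLinearMap.adjoint_inner_left]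
  have h3 : ⟪J (diagOp b z), J u⟫_ℝ = ⟪z, diagOp b z⟫_ℝ := by
    rw [← ContinuousLinearMap.adjoint_inner_right, real_inner_comm]
  have h4 : ⟪diagOp b z, t⟫_ℝ = ⟪J u, J (diagOp b t)⟫_ℝ := by
    rw [inner_diagOp_comm, hz, ContinuousLinearMap.adjoint_inner_left]
  have h5 : 0 ≤ ⟪z, diagOp b z⟫_ℝ :=
    inner_diagOp_nonneg (fun i => inv_nonneg.mpr (ha0 i).le) z
  have h6 := real_inner_le_norm (J u) (J (diagOp b t))
  have h7 := hJ b k⁻¹ (fun i => by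
    rw [hb, abs_of_pos (inv_pos.mpr (ha0 i))]; exact inv_anti₀ hk (ha i)) t
  rw [← hu, h2, h3, h4, real_inner_self_eq_norm_sq] at h1
  rcases (norm_nonneg (J u)).eq_or_lt with h | h
  · rw [← h]; exact (norm_nonneg _).trans h7
  · nlinarith

/-- If `|⟪w, t⟫| ≤ C ‖J t‖` for all `t`, that is, if `w` is in the range of `J†`, then `w` is
approximated by vectors `J† J J† φ`, in the dual norm of `‖J ·‖`. -/
theorem exists_approx_adjoint (J : PiLp 2 F →L[ℝ] L) {w : PiLp 2 F} {C : ℝ}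
    (hw : ∀ t, |⟪w, t⟫_ℝ| ≤ C * ‖J t‖) {δ : ℝ} (hδ : 0 < δ) :
    ∃ φ : L, ∀ t, |⟪w, t⟫_ℝ - ⟪J (J.adjoint φ), J t⟫_ℝ| ≤ δ * ‖J t‖ := by
  -- represent the functional as `t ↦ ⟪ψ, J t⟫`
  obtain ⟨ψ, hψ⟩ : ∃ ψ : L, ∀ t, ⟪w, t⟫_ℝ = ⟪ψ, J t⟫_ℝ := by
    let R : PiLp 2 F →ₗ[ℝ] LinearMap.range J.toLinearMap := J.toLinearMap.rangeRestrict
    obtain ⟨g, hg⟩ := R.exists_rightInverse_of_surjective J.toLinearMap.range_rangeRestrict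
    have hJg : ∀ y, J (g y) = y := fun y => by
      have := congrArg (fun T => (T y : L)) hg
      simpa [R] using this
    let ℓ : LinearMap.range J.toLinearMap →ₗ[ℝ] ℝ := (innerSL ℝ w).toLinearMap ∘ₗ g
    let ℓ' : LinearMap.range J.toLinearMap →L[ℝ] ℝ := ℓ.mkContinuous C fun y => by
      have := hw (g y)
      rw [hJg] at this
      simpa [ℓ] using this
    obtain ⟨ℓL, hℓL, -⟩ := exists_extension_norm_eq _ ℓ'
    refine ⟨(InnerProductSpace.toDual ℝ L).symm ℓL, fun t => ?_⟩
    rw [InnerProductSpace.toDual_symm_apply]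
    have h1 : ℓL (J t) = ⟪w, g (R t)⟫_ℝ := hℓL (R t)
    rw [h1]
    have h2 := hw (t - g (R t))
    rw [map_sub, hJg] at h2
    have h3 : ((R t : LinearMap.range J.toLinearMap) : L) = J t := rfl
    rw [h3, sub_self, norm_zero, mul_zero, inner_sub_right] at h2
    have := abs_nonpos_iff.mp h2
    linarith
  -- the part of `ψ` orthogonal to the range of `J J†` is invisible to the functional
  set T : L →L[ℝ] L := J ∘L J.adjoint with hT
  set W := (LinearMap.range T.toLinearMap).topologicalClosure with hW
  have : CompleteSpace W := (Submodule.isClosed_topologicalClosure _).completeSpace_coe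
  have hp : (W.starProjection ψ) ∈ W := Submodule.starProjection_apply_mem _ _
  have hq : ψ - W.starProjection ψ ∈ Wᗮ := Submodule.sub_starProjection_mem_orthogonal _
  have hker : J.adjoint (ψ - W.starProjection ψ) = 0 := by
    set d := ψ - W.starProjection ψ
    have h0 : ⟪T d, d⟫_ℝ = 0 :=
      hq (T d) (Submodule.le_topologicalClosure _ ⟨d, rfl⟩)
    rw [hT, ContinuousLinearMap.comp_apply, ← ContinuousLinearMap.adjoint_inner_right] at h0
    exact inner_self_eq_zero.mp h0
  obtain ⟨y, ⟨φ, rfl⟩, hy⟩ := Metric.mem_closure_iff.mp hp δ hδ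
  refine ⟨φ, fun t => ?_⟩
  have h1 : ⟪ψ, J t⟫_ℝ = ⟪W.starProjection ψ, J t⟫_ℝ := by
    have : ⟪ψ - W.starProjection ψ, J t⟫_ℝ = 0 := by
      rw [← ContinuousLinearMap.adjoint_inner_left, hker, inner_zero_left]
    rw [inner_sub_left] at this
    linarith
  rw [hψ, h1, ← inner_sub_left]
  refine (abs_real_inner_le_norm _ _).trans ?_
  rw [dist_eq_norm] at hy
  exact mul_le_mul_of_nonneg_right hy.le (norm_nonneg _)

/-- The shrinkage `Diag(a) (J† J + Diag(a))⁻¹` tends to zero strongly as `a → 0` at comparable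
rates in all blocks, tested against vectors `f` whose blocks lie in the range of `J†` and uniformly
over `‖J t‖ ≤ 1`. -/
theorem exists_forall_inner_ridgeInv_le {J : PiLp 2 F →L[ℝ] L} {C : ℝ} (hC : 0 ≤ C)
    (hJ : DiagBounded J C)
    {f : PiLp 2 F} {Cf : ℝ} (hf : ∀ i t, |⟪f i, t i⟫_ℝ| ≤ Cf * ‖J t‖)
    {q Q : ℝ} (hq : 0 < q) (hQ : 0 ≤ Q) {δ : ℝ} (hδ : 0 < δ) :
    ∃ r > 0, ∀ (lam : ℝ) (a : ι → ℝ), 0 < lam → lam < r →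
      (∀ i, q * lam ≤ a i ∧ a i ≤ Q * lam) →
      ∀ t, |⟪diagOp a f, ridgeInv J a t⟫_ℝ| ≤ δ * ‖J t‖ := by
  classical
  set N : ℝ := (Fintype.card ι : ℝ) with hN
  have hN0 : 0 ≤ N := by positivity
  set B : ℝ := N * Q * q⁻¹ * C with hB
  have hB0 : 0 ≤ B := by positivity
  set δ' := δ / (2 * (B + 1)) with hδ'
  have hδ'0 : 0 < δ' := by positivity
  have happ : ∀ i, ∃ φ : L, ∀ t, |⟪f i, t i⟫_ℝ - ⟪J (J.adjoint φ), J t⟫_ℝ| ≤ δ' * ‖J t‖ := by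
    intro i
    have key : ∀ t, ⟪diagOp (Pi.single i 1) f, t⟫_ℝ = ⟪f i, t i⟫_ℝ := fun t => by
      rw [inner_diagOp_comm, inner_diagOp]
      simp [Pi.single_apply]
    obtain ⟨φ, hφ⟩ := exists_approx_adjoint J (w := diagOp (Pi.single i 1) f) (C := Cf)
      (fun t => by rw [key]; exact hf i t) hδ'0
    exact ⟨φ, fun t => by rw [← key]; exact hφ t⟩
  choose φ hφ using happ
  set S : ℝ := ∑ i, ‖φ i‖ with hS
  have hS0 : 0 ≤ S := Finset.sum_nonneg fun i _ => norm_nonneg _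
  set B' : ℝ := Q * S * (1 + Q * C * (q⁻¹ * C)) with hB'
  have hB'0 : 0 ≤ B' := by positivity
  refine ⟨δ / (2 * (B' + 1)), by positivity, fun lam a hlam hlamr ha t => ?_⟩
  have ha0 : ∀ i, 0 < a i := fun i => (mul_pos hq hlam).trans_le (ha i).1
  set u := ridgeInv J a t with hu
  have hJu : ‖J u‖ ≤ (q * lam)⁻¹ * C * ‖J t‖ :=
    norm_map_ridgeInv_le hJ (mul_pos hq hlam) (fun i => (ha i).1) t
  have hJau : ‖J (diagOp a u)‖ ≤ Q * C * (q⁻¹ * C) * ‖J t‖ := by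
    refine (hJ a (Q * lam) (fun i => by rw [abs_of_pos (ha0 i)]; exact (ha i).2) u).trans ?_
    calc Q * lam * C * ‖J u‖ ≤ Q * lam * C * ((q * lam)⁻¹ * C * ‖J t‖) := by gcongr
      _ = Q * C * (q⁻¹ * C) * ‖J t‖ := by field_simp
  have hterm : ∀ i, |⟪f i, u i⟫_ℝ| ≤
      δ' * ((q * lam)⁻¹ * C * ‖J t‖) + ‖φ i‖ * ((1 + Q * C * (q⁻¹ * C)) * ‖J t‖) := by
    intro i
    have h1 := hφ i u
    have h2 : ⟪J (J.adjoint (φ i)), J u⟫_ℝ = ⟪φ i, J t⟫_ℝ - ⟪φ i, J (diagOp a u)⟫_ℝ := by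
      have := inner_ridgeInv J ha0 (J.adjoint (φ i)) t
      rw [ContinuousLinearMap.adjoint_inner_left, ContinuousLinearMap.adjoint_inner_left] at this
      linarith
    have h3 := abs_real_inner_le_norm (φ i) (J t)
    have h4 := abs_real_inner_le_norm (φ i) (J (diagOp a u))
    have h5 : ‖φ i‖ * ‖J (diagOp a u)‖ ≤ ‖φ i‖ * (Q * C * (q⁻¹ * C) * ‖J t‖) := by gcongr
    have h6 : δ' * ‖J u‖ ≤ δ' * ((q * lam)⁻¹ * C * ‖J t‖) := by gcongr
    rw [h2] at h1
    rw [abs_le] at *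
    constructor <;> nlinarith
  have hsum : ⟪diagOp a f, u⟫_ℝ = ∑ i, a i * ⟪f i, u i⟫_ℝ := by
    rw [inner_diagOp_comm, inner_diagOp]
  rw [hsum]
  calc |∑ i, a i * ⟪f i, u i⟫_ℝ| ≤ ∑ i, |a i * ⟪f i, u i⟫_ℝ| := Finset.abs_sum_le_sum_abs _ _
    _ ≤ ∑ i, Q * lam * (δ' * ((q * lam)⁻¹ * C * ‖J t‖)
          + ‖φ i‖ * ((1 + Q * C * (q⁻¹ * C)) * ‖J t‖)) := by
        refine Finset.sum_le_sum fun i _ => ?_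
        rw [abs_mul, abs_of_pos (ha0 i)]
        exact mul_le_mul (ha i).2 (hterm i) (abs_nonneg _) (by positivity)
    _ = (B * δ' + B' * lam) * ‖J t‖ := by
        rw [← Finset.mul_sum, Finset.sum_add_distrib, Finset.sum_const, Finset.card_univ,
          nsmul_eq_mul, ← hN, ← Finset.sum_mul, ← hS, hB, hB']
        field_simp
    _ ≤ δ * ‖J t‖ := by
        gcongr
        have e1 : B * δ' ≤ δ / 2 := by
          rw [hδ']
          rw [mul_div_assoc', div_le_div_iff₀ (by positivity) (by positivity)]
          nlinarith
        have e2 : B' * lam ≤ δ / 2 := by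
          calc B' * lam ≤ B' * (δ / (2 * (B' + 1))) := by gcongr
            _ ≤ δ / 2 := by
              rw [mul_div_assoc', div_le_div_iff₀ (by positivity) (by positivity)]
              nlinarith
        linarith

/-- As `a → 0`, the ridge regression fit `J (J† J + Diag(a))⁻¹ J† y` of `y` tends to the
orthogonal projection of `y` onto the closed range of `J`. -/
theorem tendsto_map_ridgeInv_adjoint (J : PiLp 2 F →L[ℝ] L) {a : ℕ → ι → ℝ}
    (ha : ∀ n i, 0 < a n i) (ha0 : ∀ i, Tendsto (fun n => a n i) atTop (𝓝 0)) (y : L) :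
    ∃ p ∈ closure (Set.range J),
      Tendsto (fun n => J (ridgeInv J (a n) (J.adjoint y))) atTop (𝓝 p) := by
  set W := (LinearMap.range J.toLinearMap).topologicalClosure with hW
  have : CompleteSpace W := (Submodule.isClosed_topologicalClosure _).completeSpace_coe
  set p := W.starProjection y with hpdef
  have hp : p ∈ W := Submodule.starProjection_apply_mem _ _
  have hq : y - p ∈ Wᗮ := Submodule.sub_starProjection_mem_orthogonal _
  refine ⟨p, hp, Metric.tendsto_atTop'.mpr fun δ hδ => ?_⟩
  obtain ⟨z, ⟨e, rfl⟩, he⟩ := Metric.mem_closure_iff.mp hp (δ / 4) (by positivity)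
  have he' : ‖p - J e‖ ≤ δ / 4 := by rw [← dist_eq_norm]; exact he.le
  have hlim : Tendsto (fun n => ⟪e, diagOp (a n) e⟫_ℝ) atTop (𝓝 0) := by
    simp_rw [inner_diagOp]
    have : (0 : ℝ) = ∑ i, 0 * ⟪e i, e i⟫_ℝ := by simp
    rw [this]
    exact tendsto_finsetSum _ fun i _ => (ha0 i).mul_const _
  obtain ⟨N, hN⟩ := eventually_atTop.mp (hlim.eventually (gt_mem_nhds (by positivity :
    (0 : ℝ) < (δ / 4) ^ 2)))
  refine ⟨N, fun n hn => ?_⟩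
  have hNn := hN n hn.le
  set u := ridgeInv J (a n) (J.adjoint y) with hu
  rw [dist_eq_norm]
  have h1 := inner_ridgeInv J (ha n) (u - e) (J.adjoint y)
  rw [← hu, ContinuousLinearMap.adjoint_inner_right] at h1
  have h2 : ⟪J (u - e), y⟫_ℝ = ⟪J (u - e), p⟫_ℝ := by
    have : ⟪J (u - e), y - p⟫_ℝ = 0 :=
      hq _ (Submodule.le_topologicalClosure _ ⟨u - e, rfl⟩)
    rw [inner_sub_right] at this; linarith
  have h3 : 0 ≤ ⟪u - (1 / 2 : ℝ) • e, diagOp (a n) (u - (1 / 2 : ℝ) • e)⟫_ℝ :=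
    inner_diagOp_nonneg (fun i => (ha n i).le) _
  have h4 : ⟪e, diagOp (a n) u⟫_ℝ = ⟪u, diagOp (a n) e⟫_ℝ := by
    rw [← inner_diagOp_comm, real_inner_comm]
  have h5 : ‖J u - p‖ ^ 2 ≤ ‖J u - p‖ * (δ / 4) + (1 / 4) * (δ / 4) ^ 2 := by
    have e1 : ⟪J u - p, J u - p⟫_ℝ = ⟪J u - p, J e - p⟫_ℝ + ⟪J (u - e), J u - p⟫_ℝ := by
      rw [map_sub, real_inner_comm (J u - p) (J u - J e), ← inner_add_right]
      congr 1
      abel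
    have e2 := real_inner_le_norm (J u - p) (J e - p)
    rw [norm_sub_rev (J e) p] at e2
    have e3 : ‖J u - p‖ * ‖p - J e‖ ≤ ‖J u - p‖ * (δ / 4) := by gcongr
    rw [real_inner_self_eq_norm_sq, inner_sub_right (J (u - e))] at e1
    rw [inner_sub_left u] at h1
    simp only [map_sub (diagOp (a n)), map_smul, inner_sub_left u,
      inner_sub_right, inner_smul_left, inner_smul_right, RCLike.conj_to_real] at h3
    linarith
  by_contra! hcon
  nlinarith

end Ridge

/-! ### The embedding of a reproducing kernel Hilbert space into `L²` -/

section Embedding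

variable {𝒳 : Type*} [MeasurableSpace 𝒳] {G : Type*} [NormedAddCommGroup G]
  [InnerProductSpace ℝ G] [CompleteSpace G] [RKHS ℝ G 𝒳 ℝ]

theorem inner_kerFun_one (x : 𝒳) (f : G) : ⟪RKHS.kerFun G x 1, f⟫_ℝ = f x := by
  rw [RKHS.kerFun_inner]; simp

theorem kerFun_one_apply (x x' : 𝒳) : RKHS.kerFun G x 1 x' = ker G x' x := by
  rw [RKHS.kerFun_apply, ker]

theorem norm_kerFun_one_sq (x : 𝒳) : ‖RKHS.kerFun G x 1‖ ^ 2 = ker G x x := by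
  rw [← real_inner_self_eq_norm_sq, inner_kerFun_one, kerFun_one_apply]

theorem norm_kerFun_one_le (h : KernelAssumption G) (x : 𝒳) : ‖RKHS.kerFun G x 1‖ ≤ 1 := by
  obtain ⟨c, hc, hb⟩ := h.bounded
  have h1 : ‖RKHS.kerFun G x 1‖ ^ 2 ≤ 1 := by
    rw [norm_kerFun_one_sq]
    exact (le_abs_self _).trans ((hb x).trans hc.le)
  nlinarith [norm_nonneg (RKHS.kerFun G x (1 : ℝ))]

theorem KernelAssumption.memLp (h : KernelAssumption G) (ν : Measure 𝒳) [IsFiniteMeasure ν]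
    (f : G) : MemLp (fun x => f x) 2 ν :=
  MemLp.of_bound (h.measurable f).aestronglyMeasurable ‖f‖
    (Eventually.of_forall (norm_apply_le_norm h f))

/-- The embedding of a reproducing kernel Hilbert space with bounded kernel into `L²(ν)`. -/
def toL2 (h : KernelAssumption G) (ν : Measure 𝒳) [IsProbabilityMeasure ν] : G →L[ℝ] Lp ℝ 2 ν :=
  LinearMap.mkContinuous
    { toFun := fun f => (h.memLp ν f).toLp _
      map_add' := fun f g => by
        rw [← MemLp.toLp_add]; congr 1; ext x; simp
      map_smul' := fun c f => by
        rw [RingHom.id_apply, ← MemLp.toLp_const_smul]; congr 1; ext x; simp }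
    1 (fun f => by
      simp only [LinearMap.coe_mk, AddHom.coe_mk, one_mul]
      refine (Lp.norm_le_of_ae_bound (norm_nonneg f) ?_).trans (by simp [measureUnivNNReal])
      filter_upwards [(h.memLp ν f).coeFn_toLp] with x hx
      rw [hx]; exact norm_apply_le_norm h f x)

theorem coeFn_toL2 (h : KernelAssumption G) (ν : Measure 𝒳) [IsProbabilityMeasure ν] (f : G) :
    toL2 h ν f =ᵐ[ν] fun x => f x :=
  (h.memLp ν f).coeFn_toLp

theorem inner_toL2 {G₂ : Type*} [NormedAddCommGroup G₂] [InnerProductSpace ℝ G₂]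
    [CompleteSpace G₂] [RKHS ℝ G₂ 𝒳 ℝ] (h : KernelAssumption G) (h₂ : KernelAssumption G₂)
    (ν : Measure 𝒳) [IsProbabilityMeasure ν] (f : G) (g : G₂) :
    ⟪toL2 h ν f, toL2 h₂ ν g⟫_ℝ = ⟪f, crossCov ν G G₂ g⟫_ℝ := by
  rw [inner_crossCov h h₂, L2.inner_def]
  refine integral_congr_ae ?_
  filter_upwards [coeFn_toL2 h ν f, coeFn_toL2 h₂ ν g] with x h1 h2
  rw [h1, h2]; simp [mul_comm]

end Embedding

/-! ### The orthonormal basis given by the spectral representation of the kernel -/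

section Spectral

variable {𝒳 : Type*} [MeasurableSpace 𝒳] {G : Type*} [NormedAddCommGroup G]
  [InnerProductSpace ℝ G] [CompleteSpace G] [RKHS ℝ G 𝒳 ℝ]
  {ν : Measure 𝒳} [IsProbabilityMeasure ν] {μ : ℕ → ℝ} {φ : ℕ → 𝒳 → ℝ}

/-- The eigenfunction `φ j` as an element of `L²`. -/
def SpectralRep.eigen (S : SpectralRep ν (ker G) μ φ) (j : ℕ) : Lp ℝ 2 ν :=
  (S.memLp j).toLp (φ j)

theorem SpectralRep.inner_eigen_eigen (S : SpectralRep ν (ker G) μ φ) (i j : ℕ) (hi : 0 < μ i)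
    (hj : 0 < μ j) : ⟪S.eigen i, S.eigen j⟫_ℝ = if i = j then 1 else 0 := by
  rw [← S.orthonormal i j hi hj, L2.inner_def]
  refine integral_congr_ae ?_
  filter_upwards [(S.memLp i).coeFn_toLp, (S.memLp j).coeFn_toLp] with x h1 h2
  rw [SpectralRep.eigen, SpectralRep.eigen, h1, h2]; simp [mul_comm]

theorem SpectralRep.orthonormal_eigen (S : SpectralRep ν (ker G) μ φ) :
    Orthonormal ℝ (fun j : {j // 0 < μ j} => S.eigen j) := by
  classical
  rw [orthonormal_iff_ite]
  intro i j
  rw [S.inner_eigen_eigen _ _ i.2 j.2]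
  simp [Subtype.ext_iff]

/-- Each `φ j` with `μ j > 0` is an eigenfunction of the integral operator with kernel `k`. -/
theorem SpectralRep.inner_eigen_kerFun (S : SpectralRep ν (ker G) μ φ) (h : KernelAssumption G)
    {j : ℕ} (hj : 0 < μ j) (x : 𝒳) :
    ⟪S.eigen j, toL2 h ν (RKHS.kerFun G x 1)⟫_ℝ = μ j * φ j x := by
  obtain ⟨c, hc, hb⟩ := h.bounded
  have hdiag : ∀ (s : Finset ℕ) (y : 𝒳), ∑ i ∈ s, μ i * φ i y ^ 2 ≤ 1 := fun s y => by
    have h1 := S.hasSum y y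
    have h2 : ∑ i ∈ s, μ i * φ i y * φ i y ≤ ker G y y :=
      sum_le_hasSum s (fun i _ => by
        rw [mul_assoc]; exact mul_nonneg (S.nonneg i) (mul_self_nonneg _)) h1
    calc ∑ i ∈ s, μ i * φ i y ^ 2 = ∑ i ∈ s, μ i * φ i y * φ i y :=
          Finset.sum_congr rfl fun i _ => by ring
      _ ≤ 1 := h2.trans ((le_abs_self _).trans ((hb y).trans hc.le))
  have hbound : ∀ (n : ℕ) (y : 𝒳), |∑ i ∈ Finset.range n, μ i * φ i y * φ i x| ≤ 1 := by
    intro n y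
    calc |∑ i ∈ Finset.range n, μ i * φ i y * φ i x|
        ≤ ∑ i ∈ Finset.range n, |μ i * φ i y * φ i x| := Finset.abs_sum_le_sum_abs _ _
      _ ≤ ∑ i ∈ Finset.range n, (μ i * φ i y ^ 2 + μ i * φ i x ^ 2) / 2 := by
          refine Finset.sum_le_sum fun i _ => ?_
          have h0 := S.nonneg i
          rw [abs_le]
          constructor
          · nlinarith [mul_nonneg h0 (sq_nonneg (φ i y + φ i x))]
          · nlinarith [mul_nonneg h0 (sq_nonneg (φ i y - φ i x))]
      _ = (∑ i ∈ Finset.range n, μ i * φ i y ^ 2 + ∑ i ∈ Finset.range n, μ i * φ i x ^ 2) / 2 := by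
          rw [← Finset.sum_add_distrib, Finset.sum_div]
      _ ≤ 1 := by linarith [hdiag (Finset.range n) y, hdiag (Finset.range n) x]
  have hlim : Tendsto (fun n => ∫ y, φ j y * ∑ i ∈ Finset.range n, μ i * φ i y * φ i x ∂ν) atTop
      (𝓝 (∫ y, φ j y * ker G y x ∂ν)) := by
    refine tendsto_integral_of_dominated_convergence (fun y => |φ j y|) (fun n => ?_)
      ((S.memLp j).integrable one_le_two).abs (fun n => Eventually.of_forall fun y => ?_)
      (Eventually.of_forall fun y => ?_)
    · refine (S.memLp j).aestronglyMeasurable.mul ?_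
      exact Finset.aestronglyMeasurable_fun_sum _ fun i _ =>
        ((S.memLp i).aestronglyMeasurable.const_mul _).mul_const _
    · rw [Real.norm_eq_abs, abs_mul]
      exact mul_le_of_le_one_right (abs_nonneg _) (hbound n y)
    · exact (S.hasSum y x).tendsto_sum_nat.const_mul _
  have heq : ∀ᶠ n in atTop, ∫ y, φ j y * ∑ i ∈ Finset.range n, μ i * φ i y * φ i x ∂ν
      = μ j * φ j x := by
    filter_upwards [eventually_gt_atTop j] with n hn
    have h1 : ∀ y, φ j y * ∑ i ∈ Finset.range n, μ i * φ i y * φ i x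
        = ∑ i ∈ Finset.range n, (μ i * φ i x) * (φ j y * φ i y) := fun y => by
      rw [Finset.mul_sum]; exact Finset.sum_congr rfl fun i _ => by ring
    simp_rw [h1]
    have hint : ∀ i ∈ Finset.range n, Integrable (fun y => μ i * φ i x * (φ j y * φ i y)) ν :=
      fun i _ => ((S.memLp j).integrable_mul (S.memLp i)).const_mul _
    rw [integral_finsetSum _ hint]
    rw [Finset.sum_eq_single_of_mem j (Finset.mem_range.mpr hn)]
    · rw [integral_const_mul, S.orthonormal j j hj hj]; simp
    · intro i _ hij
      rw [integral_const_mul]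
      rcases (S.nonneg i).eq_or_lt with h0 | h0
      · rw [← h0]; simp
      · rw [S.orthonormal j i hj h0, if_neg (Ne.symm hij), mul_zero]
  have hval : ⟪S.eigen j, toL2 h ν (RKHS.kerFun G x 1)⟫_ℝ = ∫ y, φ j y * ker G y x ∂ν := by
    rw [L2.inner_def]
    refine integral_congr_ae ?_
    filter_upwards [(S.memLp j).coeFn_toLp, coeFn_toL2 h ν (RKHS.kerFun G x 1)] with y h1 h2
    rw [SpectralRep.eigen, h1, h2, kerFun_one_apply]; simp [mul_comm]
  rw [hval]
  exact tendsto_nhds_unique hlim (tendsto_const_nhds.congr' (heq.mono fun n hn => hn.symm))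

/-- The function `√(μ j) * φ j` as an element of the reproducing kernel Hilbert space. -/
def SpectralRep.basisFun (S : SpectralRep ν (ker G) μ φ) (h : KernelAssumption G) (j : ℕ) : G :=
  (√(μ j))⁻¹ • (toL2 h ν).adjoint (S.eigen j)

theorem SpectralRep.basisFun_apply (S : SpectralRep ν (ker G) μ φ) (h : KernelAssumption G)
    {j : ℕ} (hj : 0 < μ j) (x : 𝒳) : S.basisFun h j x = √(μ j) * φ j x := by
  rw [← inner_kerFun_one, SpectralRep.basisFun, inner_smul_right,
    ContinuousLinearMap.adjoint_inner_right, real_inner_comm, S.inner_eigen_kerFun h hj]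
  have h1 := Real.sqrt_pos.mpr hj
  have h2 := Real.mul_self_sqrt hj.le
  field_simp
  rw [sq, h2]

theorem SpectralRep.inner_eigen_toL2 (S : SpectralRep ν (ker G) μ φ) (h : KernelAssumption G)
    {j : ℕ} (hj : 0 < μ j) (f : G) :
    ⟪S.eigen j, toL2 h ν f⟫_ℝ = √(μ j) * ⟪S.basisFun h j, f⟫_ℝ := by
  have h1 := Real.sqrt_pos.mpr hj
  rw [SpectralRep.basisFun, inner_smul_left, ContinuousLinearMap.adjoint_inner_left]
  simp only [RCLike.conj_to_real]
  field_simp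

theorem SpectralRep.toL2_basisFun (S : SpectralRep ν (ker G) μ φ) (h : KernelAssumption G)
    {j : ℕ} (hj : 0 < μ j) : toL2 h ν (S.basisFun h j) = √(μ j) • S.eigen j := by
  refine Lp.ext ?_
  filter_upwards [coeFn_toL2 h ν (S.basisFun h j), Lp.coeFn_smul (√(μ j)) (S.eigen j),
    (S.memLp j).coeFn_toLp] with x h1 h2 h3
  rw [h1, h2, S.basisFun_apply h hj, Pi.smul_apply, SpectralRep.eigen, h3, smul_eq_mul]

theorem SpectralRep.orthonormal_basisFun (S : SpectralRep ν (ker G) μ φ)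
    (h : KernelAssumption G) :
    Orthonormal ℝ (fun j : {j // 0 < μ j} => S.basisFun h j) := by
  classical
  rw [orthonormal_iff_ite]
  intro i j
  have hi := Real.sqrt_pos.mpr i.2
  have hj := Real.sqrt_pos.mpr j.2
  have h1 := S.inner_eigen_toL2 h i.2 (S.basisFun h j)
  rw [S.toL2_basisFun h j.2, inner_smul_right, S.inner_eigen_eigen _ _ i.2 j.2] at h1
  by_cases hij : i = j
  · subst hij
    simp only [if_true, mul_one] at h1 ⊢
    exact (mul_left_cancel₀ hi.ne' (by rw [← h1, mul_one]))
  · rw [if_neg hij]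
    rw [if_neg (fun hh => hij (Subtype.ext hh)), mul_zero] at h1
    exact (mul_eq_zero.mp h1.symm).resolve_left hi.ne'

theorem SpectralRep.hasSum_basisFun_sq (S : SpectralRep ν (ker G) μ φ) (h : KernelAssumption G)
    (x : 𝒳) : HasSum (fun j : {j // 0 < μ j} => S.basisFun h j x ^ 2) (ker G x x) := by
  have h1 : ∀ j : {j // 0 < μ j}, S.basisFun h j x ^ 2 = μ j * φ j x * φ j x := fun j => by
    rw [S.basisFun_apply h j.2, mul_pow, Real.sq_sqrt j.2.le]; ring
  simp_rw [h1]
  refine (hasSum_subtype_iff_of_support_subset (s := {j | 0 < μ j})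
    (f := fun j => μ j * φ j x * φ j x) fun j hj => ?_).mpr (S.hasSum x x)
  refine lt_of_le_of_ne (S.nonneg j) fun h0 => hj ?_
  simp [← h0]

/-- The functions `√(μ j) * φ j` span the space: the partial sums of `∑ j, μ j * φ j x ^ 2` exhaust
`k(x, x)`, which is Parseval's identity for the kernel functions. -/
theorem SpectralRep.orthogonal_basisFun (S : SpectralRep ν (ker G) μ φ)
    (h : KernelAssumption G) :
    (Submodule.span ℝ (Set.range fun j : {j // 0 < μ j} => S.basisFun h j))ᗮ = ⊥ := by
  rw [Submodule.eq_bot_iff]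
  intro s hs
  have hs' : ∀ j : {j // 0 < μ j}, ⟪S.basisFun h j, s⟫_ℝ = 0 := fun j =>
    hs _ (Submodule.subset_span ⟨j, rfl⟩)
  refine RKHS.ext fun x => ?_
  rw [RKHS.coe_zero, Pi.zero_apply]
  set k := RKHS.kerFun G x (1 : ℝ) with hk
  have hon := S.orthonormal_basisFun h
  have key : ∀ t : Finset {j // 0 < μ j},
      (s x) ^ 2 ≤ (ker G x x - ∑ j ∈ t, S.basisFun h j x ^ 2) * ‖s‖ ^ 2 := by
    intro t
    have h1 : s x = ⟪k - ∑ j ∈ t, S.basisFun h j x • S.basisFun h j, s⟫_ℝ := by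
      rw [inner_sub_left, hk, inner_kerFun_one, sum_inner]
      simp [inner_smul_left, hs']
    have h2 : ‖k - ∑ j ∈ t, S.basisFun h j x • S.basisFun h j‖ ^ 2
        = ker G x x - ∑ j ∈ t, S.basisFun h j x ^ 2 := by
      rw [norm_sub_sq_real, ← real_inner_self_eq_norm_sq (∑ j ∈ t, _), hon.inner_sum, hk,
        norm_kerFun_one_sq, inner_kerFun_one]
      have : (∑ j ∈ t, S.basisFun h j x • S.basisFun h j) x = ∑ j ∈ t, S.basisFun h j x ^ 2 := by
        rw [← inner_kerFun_one, inner_sum]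
        exact Finset.sum_congr rfl fun j _ => by
          rw [inner_smul_right, inner_kerFun_one, sq]
      rw [this]
      simp only [RCLike.conj_to_real, ← sq]
      ring
    rw [h1, ← h2, ← mul_pow]
    exact sq_le_sq' (by linarith [neg_le_of_abs_le (abs_real_inner_le_norm
      (k - ∑ j ∈ t, S.basisFun h j x • S.basisFun h j) s)]) (real_inner_le_norm _ _)
  have hlim : Tendsto (fun t : Finset {j // 0 < μ j} =>
      (ker G x x - ∑ j ∈ t, S.basisFun h j x ^ 2) * ‖s‖ ^ 2) atTop
      (𝓝 ((ker G x x - ker G x x) * ‖s‖ ^ 2)) :=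
    ((S.hasSum_basisFun_sq h x).const_sub _).mul_const _
  rw [sub_self, zero_mul] at hlim
  have := ge_of_tendsto' hlim key
  exact pow_eq_zero_iff two_ne_zero |>.mp (le_antisymm this (sq_nonneg _))

/-- The Hilbert basis `√(μ j) * φ j`, `μ j > 0`, of a reproducing kernel Hilbert space. -/
def SpectralRep.basis (S : SpectralRep ν (ker G) μ φ) (h : KernelAssumption G) :
    HilbertBasis {j // 0 < μ j} ℝ G :=
  HilbertBasis.mkOfOrthogonalEqBot (S.orthonormal_basisFun h) (S.orthogonal_basisFun h)

theorem SpectralRep.toL2_injective (S : SpectralRep ν (ker G) μ φ) (h : KernelAssumption G) :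
    Function.Injective (toL2 h ν) := by
  rw [injective_iff_map_eq_zero]
  intro f hf
  have h1 : f ∈ (Submodule.span ℝ (Set.range fun j : {j // 0 < μ j} => S.basisFun h j))ᗮ := by
    rw [Submodule.mem_orthogonal]
    intro u hu
    induction hu using Submodule.span_induction with
    | mem u hu =>
      obtain ⟨j, rfl⟩ := hu
      have h1 := S.inner_eigen_toL2 h j.2 f
      rw [hf, inner_zero_right] at h1
      exact (mul_eq_zero.mp h1.symm).resolve_left (Real.sqrt_pos.mpr j.2).ne'
    | zero => simp
    | add u v _ _ hu hv => rw [inner_add_left, hu, hv, add_zero]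
    | smul c u _ hu => rw [inner_smul_left, hu, mul_zero]
  rw [S.orthogonal_basisFun h] at h1
  exact (Submodule.mem_bot ℝ).mp h1

/-- The feature map of a reproducing kernel Hilbert space is strongly measurable, being the sum
of its expansion in the basis `√(μ j) * φ j`. -/
theorem SpectralRep.stronglyMeasurable_kerFun (S : SpectralRep ν (ker G) μ φ)
    (h : KernelAssumption G) : StronglyMeasurable (fun x : 𝒳 => RKHS.kerFun G x (1 : ℝ)) := by
  refine stronglyMeasurable_of_tendsto (atTop : Filter (Finset {j // 0 < μ j}))
    (f := fun t x => ∑ j ∈ t, (S.basis h j) x • S.basis h j) (fun t => ?_) ?_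
  · exact Finset.stronglyMeasurable_fun_sum _ fun j _ =>
      (h.measurable (S.basis h j)).stronglyMeasurable.smul_const _
  · rw [tendsto_pi_nhds]
    intro x
    have h1 := (S.basis h).hasSum_repr (RKHS.kerFun G x (1 : ℝ))
    have h2 : ∀ j, (S.basis h).repr (RKHS.kerFun G x (1 : ℝ)) j = (S.basis h j) x := fun j => by
      rw [HilbertBasis.repr_apply_apply, real_inner_comm, inner_kerFun_one]
    simp_rw [h2] at h1
    exact h1

/-- The source condition says that `f` is in the range of the square root of the covariance
operator; hence `⟪f, ·⟫` is bounded with respect to the `L²` norm. -/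
theorem SourceCondition.exists_abs_inner_le {S : SpectralRep ν (ker G) μ φ} {f : G}
    (hf : SourceCondition S f) (h : KernelAssumption G) :
    ∃ C, 0 ≤ C ∧ ∀ s : G, |⟪f, s⟫_ℝ| ≤ C * ‖toL2 h ν s‖ := by
  obtain ⟨g, hg⟩ := hf
  refine ⟨‖g‖, norm_nonneg _, fun s => ?_⟩
  set c : {j // 0 < μ j} → ℝ := fun j => ⟪S.eigen j, toL2 h ν g⟫_ℝ with hc
  have hc2 : ∀ j, c j = √(μ j) * ⟪S.basisFun h j, g⟫_ℝ := fun j => S.inner_eigen_toL2 h j.2 g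
  -- the expansion of the kernel square root, and of `f`
  have hhalf : ∀ x, HasSum (fun j : {j // 0 < μ j} => c j * S.basisFun h j x) (f x) := by
    intro x
    have hsum : Summable (fun j : {j // 0 < μ j} => (√(μ j) * φ j x) • S.eigen j) := by
      have h1 := (S.orthonormal_eigen.orthogonalFamily).summable_iff_norm_sq_summable
        (fun j => √(μ j) * φ j x)
      refine h1.mpr ?_
      refine (S.hasSum_basisFun_sq h x).summable.congr fun j => ?_
      rw [S.basisFun_apply h j.2, Real.norm_eq_abs, sq_abs]
    have hhs : HasSum (fun j : {j // 0 < μ j} => (√(μ j) * φ j x) • S.eigen j)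
        (halfKernel S x) := by
      have h1 := hsum.hasSum
      have h2 := (hasSum_subtype_iff_of_support_subset (s := {j | 0 < μ j})
        (f := fun j => (√(μ j) * φ j x) • S.eigen j) fun j hj => by
          refine lt_of_le_of_ne (S.nonneg j) fun h0 => hj ?_
          simp [← h0]).mp h1
      rw [halfKernel]
      have h3 := h2.tsum_eq
      exact h3 ▸ h1
    have hfx : f x = ⟪halfKernel S x, toL2 h ν g⟫_ℝ := by
      rw [hg x, L2.inner_def]
      refine integral_congr_ae ?_
      filter_upwards [coeFn_toL2 h ν g] with y hy
      rw [hy]; simp [mul_comm]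
    rw [hfx]
    have h4 := hhs.mapL (innerSL ℝ (toL2 h ν g))
    rw [innerSL_apply_apply, real_inner_comm] at h4
    refine h4.congr_fun fun j => ?_
    rw [innerSL_apply_apply, inner_smul_right, real_inner_comm, S.basisFun_apply h j.2, mul_comm]
  have hF : Summable (fun j : {j // 0 < μ j} => c j • S.basisFun h j) := by
    refine ((S.orthonormal_basisFun h).orthogonalFamily.summable_iff_norm_sq_summable c).mpr ?_
    exact S.orthonormal_eigen.inner_products_summable (toL2 h ν g)
  have hfF : HasSum (fun j : {j // 0 < μ j} => c j • S.basisFun h j) f := by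
    have h1 := hF.hasSum
    convert h1
    refine RKHS.ext fun x => ?_
    have h2 := h1.mapL (innerSL ℝ (RKHS.kerFun G x (1 : ℝ)))
    simp only [innerSL_apply_apply, inner_smul_right, inner_kerFun_one] at h2
    exact (hhalf x).unique h2
  have hfs := hfF.mapL (innerSL ℝ s)
  simp only [innerSL_apply_apply, inner_smul_right] at hfs
  rw [real_inner_comm]
  refine le_of_tendsto (hfs.abs) (Eventually.of_forall fun t => ?_)
  have h1 : ∑ j ∈ t, c j * ⟪s, S.basisFun h j⟫_ℝ
      = ∑ j ∈ t, ⟪S.basisFun h j, g⟫_ℝ * ⟪S.eigen j, toL2 h ν s⟫_ℝ :=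
    Finset.sum_congr rfl fun j _ => by
      rw [hc2, S.inner_eigen_toL2 h j.2, real_inner_comm s]; ring
  have h2 := (S.orthonormal_basisFun h).sum_inner_products_le g (s := t)
  have h3 := S.orthonormal_eigen.sum_inner_products_le (toL2 h ν s) (s := t)
  simp only [Real.norm_eq_abs, sq_abs] at h2 h3
  rw [h1]
  refine abs_le_of_sq_le_sq ?_ (by positivity)
  rw [mul_pow]
  exact (Finset.sum_mul_sq_le_sq_mul_sq _ _ _).trans
    (mul_le_mul h2 h3 (Finset.sum_nonneg fun _ _ => sq_nonneg _) (sq_nonneg _))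

end Spectral

/-! ### Separation of the summands in `L²` -/

section Separation

/-- A positive invertible operator is bounded below as a quadratic form. -/
theorem exists_norm_sq_le_inner_of_isUnit {K : Type*} [NormedAddCommGroup K]
    [InnerProductSpace ℝ K] {T : K →L[ℝ] K} (hT : IsUnit T)
    (hsymm : ∀ x y, ⟪x, T y⟫_ℝ = ⟪y, T x⟫_ℝ) (hpos : ∀ x, 0 ≤ ⟪x, T x⟫_ℝ) :
    ∃ C, 0 < C ∧ ∀ x, ‖x‖ ^ 2 ≤ C * ⟪x, T x⟫_ℝ := by
  obtain ⟨U, hU⟩ := hT.exists_left_inv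
  have hUT : ∀ x, U (T x) = x := fun x => congrArg (fun S : K →L[ℝ] K => S x) hU
  set k : ℝ := ‖T‖ + 1 with hk
  have hk0 : 0 < k := by positivity
  refine ⟨(‖U‖ ^ 2 + 1) * k, by positivity, fun x => ?_⟩
  have h1 : ‖x‖ ≤ ‖U‖ * ‖T x‖ := by
    conv_lhs => rw [← hUT x]
    exact U.le_opNorm _
  -- positivity of the form at `x - k⁻¹ T x`, where `k > ‖T‖`
  have h2 := hpos (x - k⁻¹ • T x)
  rw [map_sub, map_smul, inner_sub_left, inner_sub_right, inner_sub_right, inner_smul_left,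
    inner_smul_left, inner_smul_right, inner_smul_right, hsymm x (T x),
    real_inner_self_eq_norm_sq] at h2
  simp only [RCLike.conj_to_real] at h2
  have h3 : ⟪T x, T (T x)⟫_ℝ ≤ k * ‖T x‖ ^ 2 := by
    calc ⟪T x, T (T x)⟫_ℝ ≤ ‖T x‖ * ‖T (T x)‖ := real_inner_le_norm _ _
      _ ≤ ‖T x‖ * (‖T‖ * ‖T x‖) := by gcongr; exact T.le_opNorm _
      _ ≤ k * ‖T x‖ ^ 2 := by rw [hk]; nlinarith [sq_nonneg ‖T x‖]
  have h4 : ‖T x‖ ^ 2 ≤ k * ⟪x, T x⟫_ℝ := by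
    have h5 : k⁻¹ * (k⁻¹ * ⟪T x, T (T x)⟫_ℝ) ≤ k⁻¹ * ‖T x‖ ^ 2 := by
      rw [← mul_assoc]
      calc k⁻¹ * k⁻¹ * ⟪T x, T (T x)⟫_ℝ ≤ k⁻¹ * k⁻¹ * (k * ‖T x‖ ^ 2) := by gcongr
        _ = k⁻¹ * ‖T x‖ ^ 2 := by field_simp
    have h6 : k⁻¹ * ‖T x‖ ^ 2 ≤ ⟪x, T x⟫_ℝ := by linarith
    rwa [inv_mul_eq_div, div_le_iff₀ hk0, mul_comm] at h6
  calc ‖x‖ ^ 2 ≤ (‖U‖ * ‖T x‖) ^ 2 := by gcongr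
    _ = ‖U‖ ^ 2 * ‖T x‖ ^ 2 := mul_pow _ _ _
    _ ≤ (‖U‖ ^ 2 + 1) * (k * ⟪x, T x⟫_ℝ) := by
        gcongr
        linarith
    _ = _ := by ring

variable {𝒳 : Type*} [MeasurableSpace 𝒳] {M : ℕ} {H : Fin M → Type*}
  [∀ m, NormedAddCommGroup (H m)] [∀ m, InnerProductSpace ℝ (H m)]
  [∀ m, CompleteSpace (H m)] [∀ m, RKHS ℝ (H m) 𝒳 ℝ]

/-- A factorization `T = R V R` through the (total) function `posSqrt` forces `T` to have a positive
square root: otherwise `R` would be zero, hence `T` would be zero, whose square root is zero. -/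
theorem posSqrt_spec {G : Type*} [NormedAddCommGroup G] [InnerProductSpace ℝ G] {T V : G →L[ℝ] G}
    (hT : posSqrt T ∘L V ∘L posSqrt T = T) :
    (posSqrt T).IsPositive ∧ posSqrt T ∘L posSqrt T = T := by
  classical
  by_cases h : ∃ R : G →L[ℝ] G, R.IsPositive ∧ R ∘L R = T
  · have h1 : posSqrt T = h.choose := by rw [posSqrt, dif_pos h]
    rw [h1]; exact h.choose_spec
  · have h1 : posSqrt T = 0 := by rw [posSqrt, dif_neg h]
    rw [h1] at hT
    exact absurd ⟨0, ContinuousLinearMap.isPositive_zero, by rw [← hT]; simp⟩ h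

/-- If the joint correlation operator is invertible then the `L²` norm of a sum controls the
`L²` norms of the summands. -/
theorem CorrelationAssumption.exists_sum_norm_sq_le {ν : Measure 𝒳} [IsProbabilityMeasure ν]
    (hV : CorrelationAssumption H ν) (hk : ∀ m, KernelAssumption (H m))
    (hinj : ∀ m, Function.Injective (toL2 (hk m) ν)) :
    ∃ C, 0 < C ∧ ∀ s : PiLp 2 H,
      ∑ m, ‖toL2 (hk m) ν (s m)‖ ^ 2 ≤ C * ‖∑ m, toL2 (hk m) ν (s m)‖ ^ 2 := by
  obtain ⟨V, hV1, -, hV3⟩ := hV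
  set R : ∀ m, H m →L[ℝ] H m := fun m => posSqrt (crossCov ν (H m) (H m)) with hR
  have hRpos : ∀ m, (R m).IsPositive := fun m => (posSqrt_spec (hV1 m m)).1
  have hRR : ∀ m x, R m (R m x) = crossCov ν (H m) (H m) x := fun m x =>
    congrArg (fun S : H m →L[ℝ] H m => S x) (posSqrt_spec (hV1 m m)).2
  have hRsymm : ∀ m x y, ⟪R m x, y⟫_ℝ = ⟪x, R m y⟫_ℝ := fun m x y =>
    (hRpos m).isSymmetric x y
  have hRnorm : ∀ m x, ‖R m x‖ ^ 2 = ‖toL2 (hk m) ν x‖ ^ 2 := fun m x => by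
    rw [← real_inner_self_eq_norm_sq, ← real_inner_self_eq_norm_sq, hRsymm, hRR,
      inner_toL2]
  let RL : PiLp 2 H →ₗ[ℝ] PiLp 2 H :=
    { toFun := fun s => WithLp.toLp 2 fun m => R m (s m)
      map_add' := fun s t => by ext m; simp
      map_smul' := fun c s => by ext m; simp }
  have hRL : ∀ s m, RL s m = R m (s m) := fun s m => rfl
  have hdense : DenseRange RL := by
    have h1 : (LinearMap.range RL)ᗮ = ⊥ := by
      classical
      rw [Submodule.eq_bot_iff]
      intro y hy
      refine PiLp.ext fun m => ?_
      have h2 : R m (y m) = 0 := by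
        have h3 := hy (RL (WithLp.toLp 2 (Pi.single m (R m (y m))))) ⟨_, rfl⟩
        rw [PiLp.inner_apply, Finset.sum_eq_single m] at h3
        · rw [hRL, hRsymm] at h3
          simpa using h3
        · intro j _ hj
          rw [hRL]; simp [hj]
        · simp
      have h4 := hRnorm m (y m)
      rw [h2, norm_zero, zero_pow two_ne_zero] at h4
      have h5 : toL2 (hk m) ν (y m) = 0 :=
        norm_eq_zero.mp (pow_eq_zero_iff two_ne_zero |>.mp h4.symm)
      exact hinj m (h5.trans (map_zero _).symm)
    have h2 := Submodule.topologicalClosure_eq_top_iff.mpr h1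
    have h3 := (Submodule.dense_iff_topologicalClosure_eq_top).mpr h2
    rw [LinearMap.coe_range] at h3
    exact h3
  have hform : ∀ s t : PiLp 2 H, ⟪RL s, blockOp V (RL t)⟫_ℝ
      = ⟪∑ m, toL2 (hk m) ν (s m), ∑ m, toL2 (hk m) ν (t m)⟫_ℝ := by
    intro s t
    rw [PiLp.inner_apply, sum_inner]
    refine Finset.sum_congr rfl fun l _ => ?_
    rw [blockOp_apply, inner_sum, inner_sum]
    refine Finset.sum_congr rfl fun m _ => ?_
    rw [hRL, hRL, hRsymm, inner_toL2, ← hV1 l m]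
    rfl
  have hsymm : ∀ x y, ⟪x, blockOp V y⟫_ℝ = ⟪y, blockOp V x⟫_ℝ := by
    intro x y
    refine hdense.induction_on₂ (p := fun x y => ⟪x, blockOp V y⟫_ℝ = ⟪y, blockOp V x⟫_ℝ)
      (isClosed_eq (by fun_prop) (by fun_prop)) (fun s t => ?_) x y
    rw [hform, hform, real_inner_comm]
  have hpos : ∀ x, 0 ≤ ⟪x, blockOp V x⟫_ℝ := by
    intro x
    refine hdense.induction_on (p := fun x => 0 ≤ ⟪x, blockOp V x⟫_ℝ) x
      (isClosed_le (by fun_prop) (by fun_prop)) (fun s => ?_)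
    rw [hform]
    exact real_inner_self_nonneg
  obtain ⟨C, hC, hb⟩ := exists_norm_sq_le_inner_of_isUnit hV3 hsymm hpos
  refine ⟨C, hC, fun s => ?_⟩
  have h1 := hb (RL s)
  rw [hform, real_inner_self_eq_norm_sq, PiLp.norm_sq_eq_of_L2] at h1
  refine le_trans (le_of_eq ?_) h1
  exact Finset.sum_congr rfl fun m _ => by rw [hRL, hRnorm]

end Separation

/-! ### Fluctuations of sample means -/

section SampleMean

variable {𝒵 Ω : Type*} [MeasurableSpace 𝒵] [MeasurableSpace Ω]
  {K : Type*} [NormedAddCommGroup K] [InnerProductSpace ℝ K]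

/-- The mean of `w` over the first `n` sample points. -/
def sampleMean (z : ℕ → 𝒵) (n : ℕ) (w : 𝒵 → K) : K :=
  (n : ℝ)⁻¹ • ∑ i ∈ Finset.range n, w (z i)

variable {ρ : Measure 𝒵} {P : Measure Ω}
  {Z : ℕ → Ω → 𝒵} {w : 𝒵 → K}

theorem memLp_comp_hasLaw {X : Ω → 𝒵} (hX : HasLaw X ρ P) (hw : MemLp w 2 ρ) :
    MemLp (fun ω => w (X ω)) 2 P :=
  MemLp.comp_of_map (by rw [hX.map_eq]; exact hw) hX.aemeasurable

theorem memLp_sampleMean (hlaw : ∀ i, HasLaw (Z i) ρ P) (hw : MemLp w 2 ρ) (n : ℕ) :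
    MemLp (fun ω => sampleMean (fun i => Z i ω) n w) 2 P := by
  have := memLp_finsetSum (p := 2) (μ := P) (Finset.range n) (f := fun i ω => w (Z i ω))
    fun i _ => memLp_comp_hasLaw (hlaw i) hw
  exact this.const_smul _

theorem sq_integral_le_integral_sq [IsProbabilityMeasure P] {X : Ω → ℝ} (hX : MemLp X 2 P) :
    (∫ ω, X ω ∂P) ^ 2 ≤ ∫ ω, X ω ^ 2 ∂P := by
  have h1 := variance_nonneg X P
  rw [variance_eq_sub hX] at h1
  simpa using h1

variable [CompleteSpace K] [IsProbabilityMeasure ρ] [IsProbabilityMeasure P]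

/-- The variance bound for sample means of centred Hilbert-space-valued variables. -/
theorem integral_norm_sum_sq (hlaw : ∀ i, HasLaw (Z i) ρ P) (hind : iIndepFun Z P)
    (hw : MemLp w 2 ρ) (hw0 : ∫ z, w z ∂ρ = 0) (n : ℕ) :
    ∫ ω, ‖∑ i ∈ Finset.range n, w (Z i ω)‖ ^ 2 ∂P = n * ∫ z, ‖w z‖ ^ 2 ∂ρ := by
  have hmem : ∀ i, MemLp (fun ω => w (Z i ω)) 2 P := fun i => memLp_comp_hasLaw (hlaw i) hw
  have hint : ∀ i j, Integrable (fun ω => ⟪w (Z i ω), w (Z j ω)⟫_ℝ) P := fun i j =>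
    ((hmem i).norm.integrable_mul (hmem j).norm).mono ((hmem i).1.inner (hmem j).1)
      (Eventually.of_forall fun ω => by
        simpa using norm_inner_le_norm (𝕜 := ℝ) (w (Z i ω)) (w (Z j ω)))
  have hw1 : Integrable w ρ := hw.integrable one_le_two
  have hcov : ∀ i j, ∫ ω, ⟪w (Z i ω), w (Z j ω)⟫_ℝ ∂P
      = if i = j then ∫ z, ‖w z‖ ^ 2 ∂ρ else 0 := by
    intro i j
    by_cases hij : i = j
    · subst hij
      rw [if_pos rfl]
      simp_rw [real_inner_self_eq_norm_sq]
      exact (hlaw i).integral_comp (f := fun z => ‖w z‖ ^ 2) (hw1.1.norm.pow 2)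
    · rw [if_neg hij]
      have h1 := (hind.indepFun hij).integral_bilin_comp_comp (f := w) (g := w) (𝕜 := ℝ)
        (hlaw i).aemeasurable (hlaw j).aemeasurable
        (by rw [(hlaw i).map_eq]; exact hw1) (by rw [(hlaw j).map_eq]; exact hw1) (innerSL ℝ)
      have h2 : ∫ ω, w (Z i ω) ∂P = 0 := by rw [← hw0]; exact (hlaw i).integral_comp hw1.1
      rw [h2, map_zero] at h1
      exact h1
  have hexp : ∀ ω, ‖∑ i ∈ Finset.range n, w (Z i ω)‖ ^ 2
      = ∑ i ∈ Finset.range n, ∑ j ∈ Finset.range n, ⟪w (Z i ω), w (Z j ω)⟫_ℝ := fun ω => by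
    rw [← real_inner_self_eq_norm_sq, sum_inner]
    exact Finset.sum_congr rfl fun i _ => by rw [inner_sum]
  simp_rw [hexp]
  rw [integral_finsetSum _ fun i _ => integrable_finsetSum _ fun j _ => hint i j]
  have : ∀ i ∈ Finset.range n, ∫ ω, ∑ j ∈ Finset.range n, ⟪w (Z i ω), w (Z j ω)⟫_ℝ ∂P
      = ∫ z, ‖w z‖ ^ 2 ∂ρ := fun i hi => by
    rw [integral_finsetSum _ fun j _ => hint i j]
    simp_rw [hcov]
    simp only [Finset.sum_ite_eq, hi, if_true]
  rw [Finset.sum_congr rfl this]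
  simp

theorem integral_norm_sub_integral_sq_le (hw : MemLp w 2 ρ) :
    ∫ z, ‖w z - ∫ z, w z ∂ρ‖ ^ 2 ∂ρ ≤ ∫ z, ‖w z‖ ^ 2 ∂ρ := by
  have hw1 : Integrable w ρ := hw.integrable one_le_two
  obtain ⟨m, hm⟩ : ∃ m, m = ∫ z, w z ∂ρ := ⟨_, rfl⟩
  rw [← hm]
  have i1 : Integrable (fun z => ‖w z‖ ^ 2) ρ := hw.integrable_norm_pow two_ne_zero
  have i2 : Integrable (fun z => ⟪w z, m⟫_ℝ) ρ := hw1.inner_const m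
  have i3 : Integrable (fun z => 2 * ⟪w z, m⟫_ℝ) ρ := i2.const_mul 2
  have i4 : Integrable (fun z => ‖w z‖ ^ 2 - 2 * ⟪w z, m⟫_ℝ) ρ := i1.sub i3
  have e2 : ∫ z, ⟪w z, m⟫_ℝ ∂ρ = ‖m‖ ^ 2 := by
    have := integral_inner (𝕜 := ℝ) hw1 m
    rw [← real_inner_self_eq_norm_sq]
    nth_rewrite 3 [hm]
    rw [← this]
    exact integral_congr_ae (Eventually.of_forall fun z => real_inner_comm _ _)
  have e1 : ∫ z, ‖w z - m‖ ^ 2 ∂ρ = ∫ z, (‖w z‖ ^ 2 - 2 * ⟪w z, m⟫_ℝ + ‖m‖ ^ 2) ∂ρ :=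
    integral_congr_ae (Eventually.of_forall fun z => norm_sub_sq_real _ _)
  rw [e1, integral_add i4 (integrable_const _), integral_sub i1 i3, integral_const_mul, e2,
    integral_const, probReal_univ, one_smul]
  nlinarith [sq_nonneg ‖m‖]

theorem sampleMean_sub_const (z : ℕ → 𝒵) {n : ℕ} (hn : 0 < n) (w : 𝒵 → K) (m : K) :
    sampleMean z n w - m = (n : ℝ)⁻¹ • ∑ i ∈ Finset.range n, (w (z i) - m) := by
  have hn' : (n : ℝ) ≠ 0 := Nat.cast_ne_zero.mpr hn.ne'
  rw [sampleMean, Finset.sum_sub_distrib, smul_sub, Finset.sum_const, Finset.card_range,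
    ← Nat.cast_smul_eq_nsmul ℝ, smul_smul, inv_mul_cancel₀ hn', one_smul]

/-- The mean deviation of a sample mean from the mean is at most `√(E‖w‖² / n)`. -/
theorem integral_norm_sampleMean_sub_le (hlaw : ∀ i, HasLaw (Z i) ρ P) (hind : iIndepFun Z P)
    (hw : MemLp w 2 ρ) {n : ℕ} (hn : 0 < n) :
    ∫ ω, ‖sampleMean (fun i => Z i ω) n w - ∫ z, w z ∂ρ‖ ∂P
      ≤ √(∫ z, ‖w z‖ ^ 2 ∂ρ) / √n := by
  have hn' : (0 : ℝ) < n := Nat.cast_pos.mpr hn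
  have hsq := integral_norm_sub_integral_sq_le hw
  obtain ⟨V, hV⟩ : ∃ V, V = ∫ z, ‖w z‖ ^ 2 ∂ρ := ⟨_, rfl⟩
  rw [← hV] at hsq ⊢
  have hw00 : ∫ z, (w z - ∫ z, w z ∂ρ) ∂ρ = 0 := by
    rw [integral_sub (hw.integrable one_le_two) (integrable_const _), integral_const,
      probReal_univ, one_smul, sub_self]
  obtain ⟨m, hm⟩ : ∃ m, m = ∫ z, w z ∂ρ := ⟨_, rfl⟩
  rw [← hm] at hsq hw00 ⊢
  have hw0m : MemLp (fun z => w z - m) 2 ρ := hw.sub (memLp_const m)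
  have hS : MemLp (fun ω => ‖∑ i ∈ Finset.range n, (w (Z i ω) - m)‖) 2 P :=
    (memLp_finsetSum (Finset.range n) (f := fun i ω => w (Z i ω) - m)
      fun i _ => memLp_comp_hasLaw (hlaw i) hw0m).norm
  have h1 := (sq_integral_le_integral_sq hS).trans_eq
    (integral_norm_sum_sq hlaw hind hw0m hw00 n)
  have h2 : ∫ ω, ‖∑ i ∈ Finset.range n, (w (Z i ω) - m)‖ ∂P ≤ √(n * V) :=
    Real.le_sqrt_of_sq_le (h1.trans (mul_le_mul_of_nonneg_left hsq hn'.le))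
  have h3 : ∫ ω, ‖sampleMean (fun i => Z i ω) n w - m‖ ∂P
      = (n : ℝ)⁻¹ * ∫ ω, ‖∑ i ∈ Finset.range n, (w (Z i ω) - m)‖ ∂P := by
    rw [← integral_const_mul]
    refine integral_congr_ae (Eventually.of_forall fun ω => ?_)
    simp only
    rw [sampleMean_sub_const _ hn, norm_smul, norm_inv, Real.norm_natCast]
  rw [h3]
  refine (mul_le_mul_of_nonneg_left h2 (inv_nonneg.mpr hn'.le)).trans (le_of_eq ?_)
  rw [Real.sqrt_mul hn'.le]
  have h4 := Real.mul_self_sqrt hn'.le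
  have h5 := Real.sqrt_pos.mpr hn'
  field_simp
  rw [sq, h4]

/-- By the central limit theorem, normalized sums of centred nondegenerate variables do not
concentrate on any bounded interval. -/
theorem exists_measure_abs_sum_le {g : 𝒵 → ℝ} (hlaw : ∀ i, HasLaw (Z i) ρ P)
    (hind : iIndepFun Z P) (hg : StronglyMeasurable g) (hg2 : MemLp g 2 ρ)
    (hg0 : ∫ z, g z ∂ρ = 0) (hgpos : 0 < ∫ z, g z ^ 2 ∂ρ) (R : ℝ) :
    ∃ γ < 1, ∀ᶠ n : ℕ in atTop,
      P {ω | |√n * sampleMean (fun i => Z i ω) n g| ≤ R} < γ := by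
  have hident : ∀ i, IdentDistrib (fun ω => g (Z i ω)) (fun ω => g (Z 0 ω)) P P := fun i => by
    have h1 : IdentDistrib (Z i) (Z 0) P P :=
      ⟨(hlaw i).aemeasurable, (hlaw 0).aemeasurable, by rw [(hlaw i).map_eq, (hlaw 0).map_eq]⟩
    exact h1.comp hg.measurable
  have hmean : ∫ ω, g (Z 0 ω) ∂P = 0 := by rw [← hg0]; exact (hlaw 0).integral_comp hg2.1
  have hvar : Var[fun ω => g (Z 0 ω); P] = ∫ z, g z ^ 2 ∂ρ := by
    rw [variance_of_integral_eq_zero (hident 0).aemeasurable_fst hmean]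
    exact (hlaw 0).integral_comp (f := fun z => g z ^ 2) (hg2.1.pow 2)
  set v := Var[fun ω => g (Z 0 ω); P].toNNReal with hv
  have hv0 : v ≠ 0 := by
    rw [hv, hvar]; exact (Real.toNNReal_pos.mpr hgpos).ne'
  have hclt := tendstoInDistribution_inv_sqrt_mul_sum_sub (P := P) (P' := gaussianReal 0 v)
    (X := fun i ω => g (Z i ω)) (Y := id) HasLaw.id (memLp_comp_hasLaw (hlaw 0) hg2)
    (hind.comp (fun _ => g) fun _ => hg.measurable) hident
  have hlt : gaussianReal 0 v (Set.Icc (-R) R) < 1 := by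
    have h1 : (gaussianReal 0 v) (Set.Icc (-R) R)ᶜ ≠ 0 := by
      intro h0
      have h2 := gaussianReal_absolutelyContinuous' 0 hv0 h0
      have h3 : (volume : Measure ℝ) (Set.Ioi R) ≤ volume (Set.Icc (-R) R)ᶜ :=
        measure_mono fun x hx hx' => not_le.mpr hx hx'.2
      rw [h2, Real.volume_Ioi] at h3
      simp at h3
    refine lt_of_le_of_ne prob_le_one fun h2 => h1 ?_
    exact (prob_compl_eq_zero_iff measurableSet_Icc).mpr h2
  have hport := ProbabilityMeasure.limsup_measure_closed_le_of_tendsto hclt.tendsto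
    (F := Set.Icc (-R) R) isClosed_Icc
  simp only [ProbabilityMeasure.coe_mk, Measure.map_id] at hport
  obtain ⟨γ, hγ1, hγ2⟩ := exists_between hlt
  refine ⟨γ, hγ2, ?_⟩
  filter_upwards [eventually_lt_of_limsup_lt (hport.trans_lt hγ1), eventually_gt_atTop 0]
    with n hn hn0
  refine lt_of_eq_of_lt ?_ hn
  rw [Measure.map_apply_of_aemeasurable (hclt.forall_aemeasurable n) measurableSet_Icc]
  congr 1
  ext ω
  have hn' : (0 : ℝ) < n := Nat.cast_pos.mpr hn0
  have h3 := Real.mul_self_sqrt hn'.le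
  have h4 := Real.sqrt_pos.mpr hn'
  have h5 : √n * sampleMean (fun i => Z i ω) n g
      = (√n)⁻¹ * (∑ k ∈ Finset.range n, g (Z k ω) - n * ∫ ω, g (Z 0 ω) ∂P) := by
    rw [hmean, sampleMean, smul_eq_mul, mul_zero, sub_zero]
    field_simp
    rw [sq, h3]
  simp only [Set.mem_ofPred_eq, Set.mem_preimage, Set.mem_Icc, h5, abs_le]

end SampleMean

/-! ### The noise -/

section Noise

variable {𝒳 : Type*} [MeasurableSpace 𝒳] {M : ℕ} {H : Fin M → Type*}
  [∀ m, NormedAddCommGroup (H m)] [∀ m, InnerProductSpace ℝ (H m)]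
  [∀ m, CompleteSpace (H m)] [∀ m, RKHS ℝ (H m) 𝒳 ℝ]

/-- The noise `ε = Y - f(X)`, as a function on the sample space `𝒳 × ℝ`. -/
def noise (f : PiLp 2 H) (z : 𝒳 × ℝ) : ℝ := z.2 - evalSum f z.1

theorem abs_evalSum_le (hk : ∀ m, KernelAssumption (H m)) (f : PiLp 2 H) (x : 𝒳) :
    |evalSum f x| ≤ ∑ m, ‖f m‖ :=
  (Finset.abs_sum_le_sum_abs _ _).trans
    (Finset.sum_le_sum fun m _ => norm_apply_le_norm (hk m) (f m) x)

theorem measurable_evalSum (hk : ∀ m, KernelAssumption (H m)) (f : PiLp 2 H) :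
    Measurable (evalSum f : 𝒳 → ℝ) :=
  Finset.measurable_fun_sum _ fun m _ => (hk m).measurable (f m)

theorem measurable_noise (hk : ∀ m, KernelAssumption (H m)) (f : PiLp 2 H) :
    Measurable (noise f : 𝒳 × ℝ → ℝ) :=
  measurable_snd.sub ((measurable_evalSum hk f).comp measurable_fst)

variable {ρ : Measure (𝒳 × ℝ)} [IsProbabilityMeasure ρ] {f : PiLp 2 H}

/-- An essential bound of the noise that is nonnegative. -/
theorem ModelAssumption.exists_noise_le (h : ModelAssumption ρ f) :
    ∃ L, 0 ≤ L ∧ ∀ᵐ z ∂ρ, |noise f z| ≤ L := by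
  obtain ⟨L, hL⟩ := h.noise_bdd
  exact ⟨max L 0, le_max_right _ _, hL.mono fun z hz => hz.trans (le_max_left _ _)⟩

theorem memLp_comp_fst {g : 𝒳 → ℝ} (hg2 : MemLp g 2 (ρ.map Prod.fst)) :
    MemLp (fun z : 𝒳 × ℝ => g z.1) 2 ρ :=
  hg2.comp_of_map measurable_fst.aemeasurable

theorem integral_sq_map_fst {g : 𝒳 → ℝ} (hg2 : MemLp g 2 (ρ.map Prod.fst)) :
    ∫ x, g x ^ 2 ∂(ρ.map Prod.fst) = ∫ z, g z.1 ^ 2 ∂ρ :=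
  integral_map (f := fun x => g x ^ 2) measurable_fst.aemeasurable (hg2.1.pow 2)

theorem memLp_noise_mul (hk : ∀ m, KernelAssumption (H m)) {L : ℝ}
    (hL : ∀ᵐ z ∂ρ, |noise f z| ≤ L) {g : 𝒳 → ℝ} (hg2 : MemLp g 2 (ρ.map Prod.fst)) :
    MemLp (fun z : 𝒳 × ℝ => noise f z * g z.1) 2 ρ := by
  refine MemLp.of_le_mul (c := L) (memLp_comp_fst hg2)
    ((measurable_noise hk f).aestronglyMeasurable.mul (memLp_comp_fst hg2).1) ?_
  filter_upwards [hL] with z hz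
  rw [norm_mul]
  exact mul_le_mul_of_nonneg_right hz (norm_nonneg _)

theorem integral_noise_mul_sq_le (hk : ∀ m, KernelAssumption (H m)) {L : ℝ}
    (hL : ∀ᵐ z ∂ρ, |noise f z| ≤ L) {g : 𝒳 → ℝ} (hg2 : MemLp g 2 (ρ.map Prod.fst)) :
    ∫ z, ‖noise f z * g z.1‖ ^ 2 ∂ρ ≤ L ^ 2 * ∫ x, g x ^ 2 ∂(ρ.map Prod.fst) := by
  rw [integral_sq_map_fst hg2, ← integral_const_mul]
  refine integral_mono_ae ((memLp_noise_mul hk hL hg2).integrable_norm_pow two_ne_zero)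
    (((memLp_comp_fst hg2).integrable_sq).const_mul _) ?_
  filter_upwards [hL] with z hz
  rw [norm_mul, mul_pow, Real.norm_eq_abs, Real.norm_eq_abs, sq_abs (g z.1)]
  exact mul_le_mul_of_nonneg_right (pow_le_pow_left₀ (abs_nonneg _) hz 2) (sq_nonneg _)

theorem stronglyMeasurable_inputSigma {g : 𝒳 → ℝ} (hg : StronglyMeasurable g) :
    StronglyMeasurable[inputSigma 𝒳] (fun z : 𝒳 × ℝ => g z.1) :=
  hg.comp_measurable (comap_measurable Prod.fst)

theorem ModelAssumption.integral_noise_mul (h : ModelAssumption ρ f)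
    (hk : ∀ m, KernelAssumption (H m)) {g : 𝒳 → ℝ} (hg : StronglyMeasurable g)
    (hg2 : MemLp g 2 (ρ.map Prod.fst)) :
    ∫ z, noise f z * g z.1 ∂ρ = 0 := by
  obtain ⟨L, hL0, hL⟩ := h.exists_noise_le
  have hm : inputSigma 𝒳 ≤ (inferInstance : MeasurableSpace (𝒳 × ℝ)) := measurable_fst.comap_le
  have hG := memLp_comp_fst (ρ := ρ) hg2
  have hFb : ∀ z : 𝒳 × ℝ, |evalSum f z.1| ≤ ∑ m, ‖f m‖ := fun z => abs_evalSum_le hk f z.1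
  have hYm : AEStronglyMeasurable (fun z : 𝒳 × ℝ => z.2) ρ :=
    measurable_snd.aestronglyMeasurable
  have hYb : ∀ᵐ z ∂ρ, ‖z.2‖ ≤ L + ∑ m, ‖f m‖ := by
    filter_upwards [hL] with z hz
    have e : z.2 = noise f z + evalSum f z.1 := by rw [noise]; ring
    rw [e]
    exact (norm_add_le _ _).trans (add_le_add hz (hFb z))
  have hY : Integrable (fun z : 𝒳 × ℝ => z.2) ρ := Integrable.of_bound hYm _ hYb
  have hFm : AEStronglyMeasurable (fun z : 𝒳 × ℝ => evalSum f z.1) ρ :=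
    ((measurable_evalSum hk f).comp measurable_fst).aestronglyMeasurable
  have hGY : Integrable (fun z : 𝒳 × ℝ => g z.1 * z.2) ρ :=
    (hG.integrable one_le_two).mul_bdd hYm hYb
  have hGF : Integrable (fun z : 𝒳 × ℝ => g z.1 * evalSum f z.1) ρ :=
    (hG.integrable one_le_two).mul_bdd hFm (Eventually.of_forall hFb)
  have h1 := condExp_mul_of_stronglyMeasurable_left (stronglyMeasurable_inputSigma hg) hGY hY
  have h2 : ∫ z, g z.1 * z.2 ∂ρ = ∫ z, g z.1 * evalSum f z.1 ∂ρ := by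
    calc ∫ z, g z.1 * z.2 ∂ρ
        = ∫ z, (ρ[(fun z : 𝒳 × ℝ => g z.1) * fun z => z.2 | inputSigma 𝒳]) z ∂ρ :=
          (integral_condExp hm).symm
      _ = _ := by
          refine integral_congr_ae ?_
          filter_upwards [h1, h.regression] with z e1 e2
          rw [e1, Pi.mul_apply, e2]
  have h3 : ∀ z : 𝒳 × ℝ, noise f z * g z.1 = g z.1 * z.2 - g z.1 * evalSum f z.1 := fun z => by
    rw [noise]; ring
  simp_rw [h3]
  rw [integral_sub hGY hGF, h2, sub_self]

theorem ModelAssumption.integral_noise_mul_sq_pos (h : ModelAssumption ρ f)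
    (hk : ∀ m, KernelAssumption (H m)) {g : 𝒳 → ℝ} (hg : StronglyMeasurable g)
    (hg2 : MemLp g 2 (ρ.map Prod.fst)) (hpos : 0 < ∫ x, g x ^ 2 ∂(ρ.map Prod.fst)) :
    0 < ∫ z, (noise f z * g z.1) ^ 2 ∂ρ := by
  obtain ⟨L, hL0, hL⟩ := h.exists_noise_le
  obtain ⟨σ, hσ, hσv⟩ := h.noise_var
  have hm : inputSigma 𝒳 ≤ (inferInstance : MeasurableSpace (𝒳 × ℝ)) := measurable_fst.comap_le
  have hG := (memLp_comp_fst (ρ := ρ) hg2).integrable_sq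
  have hEm : AEStronglyMeasurable (fun z : 𝒳 × ℝ => noise f z ^ 2) ρ :=
    ((measurable_noise hk f).pow_const 2).aestronglyMeasurable
  have hEb : ∀ᵐ z ∂ρ, ‖noise f z ^ 2‖ ≤ L ^ 2 := by
    filter_upwards [hL] with z hz
    rw [norm_pow]
    exact pow_le_pow_left₀ (norm_nonneg _) hz 2
  have hE : Integrable (fun z : 𝒳 × ℝ => noise f z ^ 2) ρ := Integrable.of_bound hEm _ hEb
  have hGE : Integrable ((fun z : 𝒳 × ℝ => g z.1 ^ 2) * fun z => noise f z ^ 2) ρ :=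
    hG.mul_bdd hEm hEb
  have hg' : StronglyMeasurable[inputSigma 𝒳] (fun z : 𝒳 × ℝ => g z.1 ^ 2) :=
    stronglyMeasurable_inputSigma (g := fun x => g x ^ 2) (hg.pow 2)
  have h1 := condExp_mul_of_stronglyMeasurable_left hg' hGE hE
  have h2 : ∫ z, (noise f z * g z.1) ^ 2 ∂ρ
      = ∫ z, (ρ[(fun z : 𝒳 × ℝ => g z.1 ^ 2) * fun z => noise f z ^ 2 | inputSigma 𝒳]) z ∂ρ := by
    rw [integral_condExp hm]
    exact integral_congr_ae (Eventually.of_forall fun z => by simp [mul_pow, mul_comm])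
  rw [integral_sq_map_fst hg2] at hpos
  have h3 : σ ^ 2 * ∫ z, g z.1 ^ 2 ∂ρ ≤ ∫ z, (noise f z * g z.1) ^ 2 ∂ρ := by
    rw [h2, ← integral_const_mul]
    refine integral_mono_ae (hG.const_mul _) integrable_condExp ?_
    filter_upwards [h1, hσv] with z e1 e2
    rw [e1, Pi.mul_apply, mul_comm]
    exact mul_le_mul_of_nonneg_left e2.le (sq_nonneg _)
  exact lt_of_lt_of_le (by positivity) h3

end Noise

/-! ### Domination of random directions -/

section Domination

variable {ι : Type*} [Fintype ι] {F : ι → Type*}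
  [∀ i, NormedAddCommGroup (F i)] [∀ i, InnerProductSpace ℝ (F i)] [∀ i, CompleteSpace (F i)]
  {L : Type*} [NormedAddCommGroup L] [InnerProductSpace ℝ L] [CompleteSpace L]
  {Ω : Type*} [MeasurableSpace Ω] {P : Measure Ω}

open Classical in
/-- The block `t i`, as an element of the Hilbert sum. -/
def block (i : ι) (t : PiLp 2 F) : PiLp 2 F := diagOp (Pi.single i 1) t

theorem inner_block (i : ι) (r t : PiLp 2 F) : ⟪r, block i t⟫_ℝ = ⟪r i, t i⟫_ℝ := by
  rw [block, inner_diagOp, Finset.sum_eq_single i]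
  · simp
  · intro j _ hj; simp [hj]
  · simp

theorem norm_block_le (i : ι) (t : PiLp 2 F) : ‖block i t‖ ≤ ‖t‖ := by
  have h1 : ‖block i t‖ ^ 2 ≤ ‖block i t‖ * ‖t‖ := by
    have h2 : ⟪block i t, block i t⟫_ℝ = ⟪block i t, t⟫_ℝ := by
      rw [inner_block, real_inner_comm t, inner_block]
      simp [block, diagOp_apply]
    rw [← real_inner_self_eq_norm_sq, h2]
    exact real_inner_le_norm _ _
  nlinarith [norm_nonneg (block i t), norm_nonneg t]

theorem DiagBounded.norm_map_block_le {J : PiLp 2 F →L[ℝ] L} {C : ℝ} (hJ : DiagBounded J C)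
    (i : ι) (t : PiLp 2 F) : ‖J (block i t)‖ ≤ C * ‖J t‖ := by
  rw [← one_mul C]
  refine hJ _ 1 (fun j => ?_) t
  by_cases h : j = i
  · subst h; simp
  · simp [h]

theorem norm_map_ridgeInv_adjoint_le (J : PiLp 2 F →L[ℝ] L) {a : ι → ℝ} (ha : ∀ i, 0 < a i)
    (y : L) : ‖J (ridgeInv J a (J.adjoint y))‖ ≤ ‖y‖ := by
  set s := ridgeInv J a (J.adjoint y) with hs
  have h1 := inner_ridgeInv J ha s (J.adjoint y)
  rw [← hs, ContinuousLinearMap.adjoint_inner_right, real_inner_self_eq_norm_sq] at h1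
  have h2 := inner_diagOp_nonneg (fun i => (ha i).le) s
  have h3 := real_inner_le_norm (J s) y
  rcases (norm_nonneg (J s)).eq_or_lt with h | h
  · rw [← h]; exact norm_nonneg y
  · nlinarith

theorem abs_inner_diagOp_le {c : ι → ℝ} {k : ℝ} (hk : ∀ i, |c i| ≤ k) (u f : PiLp 2 F) :
    |⟪u, diagOp c f⟫_ℝ| ≤ k * ∑ i, |⟪u i, f i⟫_ℝ| := by
  rw [inner_diagOp, Finset.mul_sum]
  refine (Finset.abs_sum_le_sum_abs _ _).trans (Finset.sum_le_sum fun i _ => ?_)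
  rw [abs_mul]
  exact mul_le_mul_of_nonneg_right (hk i) (abs_nonneg _)

theorem sum_abs_inner_le {J : PiLp 2 F →L[ℝ] L} {f : PiLp 2 F} {Cf : ℝ}
    (hf : ∀ i t, |⟪f i, t i⟫_ℝ| ≤ Cf * ‖J t‖) (u : PiLp 2 F) :
    ∑ i, |⟪u i, f i⟫_ℝ| ≤ Fintype.card ι * (Cf * ‖J u‖) := by
  calc ∑ i, |⟪u i, f i⟫_ℝ| ≤ ∑ _i : ι, Cf * ‖J u‖ :=
        Finset.sum_le_sum fun i _ => by rw [real_inner_comm]; exact hf i u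
    _ = Fintype.card ι * (Cf * ‖J u‖) := by simp

set_option maxHeartbeats 1000000 in
/-- The random vector `r` solves `J† J r + Diag(â) (f + r) ≈ 0` with random weights `â` close to
deterministic weights `a`, up to errors `N u` in the direction `u`. Then `⟪r, t⟫` is dominated on
the event `good` by a random variable whose mean is controlled by `‖J t‖` alone, not by `‖t‖`, up to
a multiple of `‖t‖` that decreases geometrically with `k`. In the induction on `k`, `⟪r, t⟫` is
rewritten with the *deterministic* solution `u` of `J† J u + Diag(a) u = t`, which leaves the cross
terms `(a i - â i) ⟪r i, u i⟫`: the same problem for the blocks of `u`, with a small factor in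
front. -/
theorem exists_dominating [IsProbabilityMeasure P] {J : PiLp 2 F →L[ℝ] L} {C : ℝ} (hC : 0 ≤ C)
    (hJ : DiagBounded J C)
    {f : PiLp 2 F} {Cf : ℝ} (hCf : 0 ≤ Cf) (hf : ∀ i t, |⟪f i, t i⟫_ℝ| ≤ Cf * ‖J t‖)
    {a : ι → ℝ} {q Q lam : ℝ} (hq : 0 < q) (hQ : 0 ≤ Q) (hlam : 0 < lam)
    (ha : ∀ i, q * lam ≤ a i) (haQ : ∀ i, a i ≤ Q * lam)
    {good : Set Ω} {r : Ω → PiLp 2 F} {ah : Ω → ι → ℝ} {N : PiLp 2 F → Ω → ℝ} {τ : ℝ}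
    (hτ : 0 ≤ τ) (hN0 : ∀ u ω, 0 ≤ N u ω) (hNi : ∀ u, Integrable (N u) P)
    (hN : ∀ u, ∫ ω, N u ω ∂P ≤ τ * ‖J u‖)
    (hkkt : ∀ ω ∈ good, ∀ u,
      |⟪J u, J (r ω)⟫_ℝ + ⟪u, diagOp (ah ω) (f + r ω)⟫_ℝ| ≤ N u ω)
    (hr : ∀ ω ∈ good, ‖r ω‖ ≤ 1)
    {η : ℝ} (hη0 : 0 ≤ η) (hη1 : η ≤ 1) (hη : ∀ ω ∈ good, ∀ i, |ah ω i - a i| ≤ η * lam)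
    (hsmall : 2 * (Fintype.card ι * η * q⁻¹ * (C ^ 2 + 1)) ≤ 1) (k : ℕ) (t : PiLp 2 F) :
    ∃ Y : Ω → ℝ, (∀ ω, 0 ≤ Y ω) ∧ Integrable Y P ∧
      ∫ ω, Y ω ∂P ≤ 2 * (q⁻¹ * C * (τ / lam + Fintype.card ι * (Q + 1) * Cf)) * ‖J t‖ ∧
      ∀ ω ∈ good, |⟪r ω, t⟫_ℝ| ≤ Y ω + (1 / 2) ^ k * ‖t‖ := by
  obtain ⟨D, hD⟩ : ∃ D : ℝ, D = Fintype.card ι := ⟨_, rfl⟩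
  have hD0 : 0 ≤ D := by rw [hD]; positivity
  rw [← hD] at hsmall ⊢
  obtain ⟨B, hB⟩ : ∃ B : ℝ, B = q⁻¹ * C * (τ / lam + D * (Q + 1) * Cf) := ⟨_, rfl⟩
  have hB0 : 0 ≤ B := by rw [hB]; positivity
  rw [← hB]
  have hqlam : 0 < q * lam := mul_pos hq hlam
  induction k generalizing t with
  | zero =>
    refine ⟨fun _ => 0, fun _ => le_rfl, integrable_zero _ _ _, ?_, fun ω hω => ?_⟩
    · simp only [integral_zero]; positivity
    · rw [pow_zero, one_mul, zero_add]
      refine (abs_real_inner_le_norm _ _).trans ?_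
      exact mul_le_of_le_one_left (norm_nonneg _) (hr ω hω)
  | succ k ih =>
    obtain ⟨u, hu⟩ : ∃ u, u = ridgeInv J a t := ⟨_, rfl⟩
    choose Y hY0 hYi hYint hYle using fun i : ι => ih (block i u)
    have hJu : ‖J u‖ ≤ (q * lam)⁻¹ * C * ‖J t‖ := hu ▸ norm_map_ridgeInv_le hJ hqlam ha t
    have hnu : ‖u‖ ≤ (q * lam)⁻¹ * ‖t‖ := hu ▸ norm_ridgeInv_le J hqlam ha t
    set b : ℝ := q⁻¹ * C * (D * (Q + 1) * Cf) * ‖J t‖ with hb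
    have hb0 : 0 ≤ b := by positivity
    have hsumi : Integrable (fun ω => ∑ i, η * lam * Y i ω) P :=
      integrable_finsetSum _ fun i _ => (hYi i).const_mul _
    have hNb : Integrable (fun ω => N u ω + b) P := (hNi u).add (integrable_const b)
    refine ⟨fun ω => N u ω + b + ∑ i, η * lam * Y i ω, fun ω => ?_, hNb.add hsumi, ?_,
      fun ω hω => ?_⟩
    · have : 0 ≤ ∑ i, η * lam * Y i ω :=
        Finset.sum_nonneg fun i _ => mul_nonneg (mul_nonneg hη0 hlam.le) (hY0 i ω)
      have := hN0 u ω
      positivity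
    · rw [integral_add hNb hsumi, integral_add (hNi u) (integrable_const b), integral_const,
        probReal_univ, one_smul, integral_finsetSum _ fun i _ => (hYi i).const_mul _]
      have h1 : ∫ ω, N u ω ∂P ≤ τ * ((q * lam)⁻¹ * C * ‖J t‖) :=
        (hN u).trans (mul_le_mul_of_nonneg_left hJu hτ)
      have h2 : ∑ i, ∫ ω, η * lam * Y i ω ∂P
          ≤ ∑ _i : ι, η * lam * (2 * B * (C * ((q * lam)⁻¹ * C * ‖J t‖))) := by
        refine Finset.sum_le_sum fun i _ => ?_
        rw [integral_const_mul]
        refine mul_le_mul_of_nonneg_left ((hYint i).trans ?_) (mul_nonneg hη0 hlam.le)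
        refine mul_le_mul_of_nonneg_left ((hJ.norm_map_block_le i u).trans ?_) (by positivity)
        exact mul_le_mul_of_nonneg_left hJu hC
      rw [Finset.sum_const, Finset.card_univ, nsmul_eq_mul, ← hD] at h2
      have h3 : τ * ((q * lam)⁻¹ * C * ‖J t‖) + b = B * ‖J t‖ := by
        rw [hb, hB]; field_simp
      have h4 : D * (η * lam * (2 * B * (C * ((q * lam)⁻¹ * C * ‖J t‖))))
          = 2 * (D * η * q⁻¹ * C ^ 2) * (B * ‖J t‖) := by field_simp
      have h5 : 2 * (D * η * q⁻¹ * C ^ 2) ≤ 1 := by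
        have : 0 ≤ D * η * q⁻¹ := by positivity
        nlinarith
      have h6 : 2 * (D * η * q⁻¹ * C ^ 2) * (B * ‖J t‖) ≤ 1 * (B * ‖J t‖) :=
        mul_le_mul_of_nonneg_right h5 (by positivity)
      linarith
    · have e1 := inner_ridgeInv J (fun i => hqlam.trans_le (ha i)) (r ω) t
      rw [← hu] at e1
      have e2 := hkkt ω hω u
      rw [map_add, inner_add_right, real_inner_comm (J (r ω))] at e2
      have e3 : ⟪r ω, diagOp a u⟫_ℝ - ⟪u, diagOp (ah ω) (r ω)⟫_ℝ
          = ∑ i, (a i - ah ω i) * ⟪r ω i, u i⟫_ℝ := by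
        rw [inner_diagOp, inner_diagOp, ← Finset.sum_sub_distrib]
        exact Finset.sum_congr rfl fun i _ => by rw [real_inner_comm (r ω i) (u i)]; ring
      have e4 : |∑ i, (a i - ah ω i) * ⟪r ω i, u i⟫_ℝ|
          ≤ ∑ i, (η * lam * Y i ω + η * lam * ((1 / 2) ^ k * ((q * lam)⁻¹ * ‖t‖))) := by
        refine (Finset.abs_sum_le_sum_abs _ _).trans (Finset.sum_le_sum fun i _ => ?_)
        rw [abs_mul, abs_sub_comm, ← mul_add, ← inner_block]
        refine mul_le_mul (hη ω hω i) ((hYle i ω hω).trans ?_) (abs_nonneg _)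
          (mul_nonneg hη0 hlam.le)
        gcongr
        exact (norm_block_le i u).trans hnu
      rw [Finset.sum_add_distrib, Finset.sum_const, Finset.card_univ, nsmul_eq_mul, ← hD] at e4
      have e5 : |⟪u, diagOp (ah ω) f⟫_ℝ| ≤ b := by
        have h1 := abs_inner_diagOp_le (c := ah ω) (k := (Q + 1) * lam) (fun i => by
          have h1 := hη ω hω i
          have h2 := ha i
          have h3 := haQ i
          rw [abs_le] at h1 ⊢
          constructor <;> nlinarith) u f
        refine h1.trans ?_
        have h2 := sum_abs_inner_le hf u
        rw [← hD] at h2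
        calc (Q + 1) * lam * ∑ i, |⟪u i, f i⟫_ℝ|
            ≤ (Q + 1) * lam * (D * (Cf * ((q * lam)⁻¹ * C * ‖J t‖))) := by
              gcongr
              exact h2.trans (by gcongr)
          _ = b := by rw [hb]; field_simp
      have e6 : D * (η * lam * ((1 / 2) ^ k * ((q * lam)⁻¹ * ‖t‖))) ≤ (1 / 2) ^ (k + 1) * ‖t‖ := by
        have h1 : D * (η * lam * ((1 / 2) ^ k * ((q * lam)⁻¹ * ‖t‖)))
            = (D * η * q⁻¹) * ((1 / 2) ^ k * ‖t‖) := by field_simp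
        have h2 : D * η * q⁻¹ ≤ 1 / 2 := by
          have : 0 ≤ D * η * q⁻¹ := by positivity
          nlinarith [sq_nonneg C]
        rw [h1, pow_succ]
        calc (D * η * q⁻¹) * ((1 / 2) ^ k * ‖t‖) ≤ 1 / 2 * ((1 / 2) ^ k * ‖t‖) := by gcongr
          _ = _ := by ring
      have e7 : ⟪r ω, t⟫_ℝ = (⟪J (r ω), J u⟫_ℝ + (⟪u, diagOp (ah ω) f⟫_ℝ
          + ⟪u, diagOp (ah ω) (r ω)⟫_ℝ)) - ⟪u, diagOp (ah ω) f⟫_ℝ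
          + ∑ i, (a i - ah ω i) * ⟪r ω i, u i⟫_ℝ := by
        rw [← e1, ← e3]; ring
      rw [e7]
      refine (abs_add_le _ _).trans ?_
      have e8 := abs_sub (⟪J (r ω), J u⟫_ℝ + (⟪u, diagOp (ah ω) f⟫_ℝ
          + ⟪u, diagOp (ah ω) (r ω)⟫_ℝ)) ⟪u, diagOp (ah ω) f⟫_ℝ
      linarith

end Domination

/-! ### Optimality conditions of the estimator -/

section Optimality

theorem abs_le_of_forall_nonneg_quadratic {A N B : ℝ}
    (h : ∀ t : ℝ, 0 ≤ t * A + |t| * N + t ^ 2 * B) : |A| ≤ N := by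
  by_contra! hlt
  have hB : 0 < |B| + 1 := by positivity
  set e := (|A| - N) / (2 * (|B| + 1)) with he
  have he0 : 0 < e := div_pos (by linarith) (by positivity)
  have h1 : e * (2 * (|B| + 1)) = |A| - N := div_mul_cancel₀ _ (by positivity)
  have h2 : e * B ≤ e * |B| := mul_le_mul_of_nonneg_left (le_abs_self B) he0.le
  have h3 : 0 ≤ e * (-|A| + N + e * B) := by
    rcases le_total 0 A with hA | hA
    · have := h (-e)
      rw [abs_neg, abs_of_pos he0] at this
      rw [abs_of_nonneg hA]
      nlinarith
    · have := h e
      rw [abs_of_pos he0] at this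
      rw [abs_of_nonpos hA]
      nlinarith
  have h4 := nonneg_of_mul_nonneg_right h3 he0
  linarith

open Classical in
theorem norm_add_smul_le {G : Type*} [NormedAddCommGroup G] [InnerProductSpace ℝ G] (f h : G)
    (t : ℝ) : ‖f + t • h‖ ≤ ‖f‖ + t * (‖f‖⁻¹ * ⟪f, h⟫_ℝ) + |t| * (if f = 0 then ‖h‖ else 0)
      + t ^ 2 * (‖f‖⁻¹ * ‖h‖ ^ 2 / 2) := by
  by_cases hf : f = 0
  · subst hf; simp [norm_smul]
  · rw [if_neg hf, mul_zero, add_zero]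
    have h0 : 0 < ‖f‖ := norm_pos_iff.mpr hf
    have h1 : ‖f + t • h‖ ^ 2 = ‖f‖ ^ 2 + 2 * (t * ⟪f, h⟫_ℝ) + t ^ 2 * ‖h‖ ^ 2 := by
      rw [norm_add_sq_real, inner_smul_right, norm_smul, mul_pow, Real.norm_eq_abs, sq_abs]
    have h2 : ‖f + t • h‖ * (2 * ‖f‖) ≤ ‖f + t • h‖ ^ 2 + ‖f‖ ^ 2 := by
      nlinarith [sq_nonneg (‖f + t • h‖ - ‖f‖)]
    have h3 : ‖f + t • h‖ ≤ (‖f + t • h‖ ^ 2 + ‖f‖ ^ 2) / (2 * ‖f‖) := by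
      rwa [le_div_iff₀ (by positivity)]
    refine h3.trans (le_of_eq ?_)
    rw [h1]
    field_simp
    ring

variable {𝒳 : Type*} {M : ℕ} {H : Fin M → Type*}
  [∀ m, NormedAddCommGroup (H m)] [∀ m, InnerProductSpace ℝ (H m)]
  [∀ m, RKHS ℝ (H m) 𝒳 ℝ]

theorem evalSum_add_smul (f h : PiLp 2 H) (t : ℝ) (x : 𝒳) :
    evalSum (f + t • h) x = evalSum f x + t * evalSum h x := by
  simp [evalSum, Finset.sum_add_distrib, Finset.mul_sum]

theorem evalSum_sub (f h : PiLp 2 H) (x : 𝒳) :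
    evalSum (f - h) x = evalSum f x - evalSum h x := by
  simp [evalSum, Finset.sum_sub_distrib]

open Classical in
/-- First-order optimality of a minimizer `f` of the objective in the direction `h`. In the blocks
where `f` vanishes the penalty is not differentiable, which gives an inequality. -/
theorem abs_optimality_le {z : ℕ → 𝒳 × ℝ} {n : ℕ} {a b : ℝ} (ha : 0 ≤ a)
    {f : PiLp 2 H} (hf : IsMinOn (objective z n a b) Set.univ f) (h : PiLp 2 H) :
    |2 * sampleMean z n (fun p => (evalSum f p.1 - p.2) * evalSum h p.1)
      + ∑ m, (a * ‖f m‖⁻¹ + 2 * b) * ⟪f m, h m⟫_ℝ|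
      ≤ a * ∑ m, (if f m = 0 then ‖h m‖ else 0) := by
  refine abs_le_of_forall_nonneg_quadratic
    (B := (n : ℝ)⁻¹ * ∑ i ∈ Finset.range n, evalSum h (z i).1 ^ 2
      + a * ∑ m, ‖f m‖⁻¹ * ‖h m‖ ^ 2 / 2 + b * ∑ m, ‖h m‖ ^ 2) fun t => ?_
  have hmin : objective z n a b f ≤ objective z n a b (f + t • h) := hf (Set.mem_univ _)
  have hloss : ∑ i ∈ Finset.range n, ((z i).2 - evalSum (f + t • h) (z i).1) ^ 2
      = ∑ i ∈ Finset.range n, ((z i).2 - evalSum f (z i).1) ^ 2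
        + t * (2 * ∑ i ∈ Finset.range n, (evalSum f (z i).1 - (z i).2) * evalSum h (z i).1)
        + t ^ 2 * ∑ i ∈ Finset.range n, evalSum h (z i).1 ^ 2 := by
    simp only [Finset.mul_sum, ← Finset.sum_add_distrib]
    refine Finset.sum_congr rfl fun i _ => ?_
    rw [evalSum_add_smul]; ring
  have hsq : ∑ m, ‖(f + t • h) m‖ ^ 2
      = ∑ m, ‖f m‖ ^ 2 + t * (2 * ∑ m, ⟪f m, h m⟫_ℝ) + t ^ 2 * ∑ m, ‖h m‖ ^ 2 := by
    simp only [Finset.mul_sum, ← Finset.sum_add_distrib]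
    refine Finset.sum_congr rfl fun m _ => ?_
    rw [PiLp.add_apply, PiLp.smul_apply, norm_add_sq_real, inner_smul_right, norm_smul, mul_pow,
      Real.norm_eq_abs, sq_abs]
    ring
  have hnorm : ∑ m, ‖(f + t • h) m‖ ≤ ∑ m, ‖f m‖ + t * ∑ m, ‖f m‖⁻¹ * ⟪f m, h m⟫_ℝ
      + |t| * ∑ m, (if f m = 0 then ‖h m‖ else 0)
      + t ^ 2 * ∑ m, ‖f m‖⁻¹ * ‖h m‖ ^ 2 / 2 := by
    simp only [Finset.mul_sum, ← Finset.sum_add_distrib]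
    refine Finset.sum_le_sum fun m _ => ?_
    rw [PiLp.add_apply, PiLp.smul_apply]
    exact norm_add_smul_le (f m) (h m) t
  have hlin : ∑ m, (a * ‖f m‖⁻¹ + 2 * b) * ⟪f m, h m⟫_ℝ
      = a * ∑ m, ‖f m‖⁻¹ * ⟪f m, h m⟫_ℝ + 2 * b * ∑ m, ⟪f m, h m⟫_ℝ := by
    simp only [Finset.mul_sum, ← Finset.sum_add_distrib]
    exact Finset.sum_congr rfl fun m _ => by ring
  have hnorm' := mul_le_mul_of_nonneg_left hnorm ha
  rw [objective, objective, hloss, hsq, one_div] at hmin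
  rw [hlin, sampleMean, smul_eq_mul]
  nlinarith

theorem restrict_apply (f : PiLp 2 H) (I : Finset (Fin M)) (l : I) : restrict f I l = f l := rfl

/-- The function `x ↦ ∑ l, h l x` for an element of the Hilbert sum over `I`. -/
def partialEval {I : Finset (Fin M)} (h : PiLp 2 (fun l : I => H l)) (x : 𝒳) : ℝ := ∑ l, h l x

/-- Extension by zero from the Hilbert sum over `I` to the full Hilbert sum. -/
def extend {I : Finset (Fin M)} (h : PiLp 2 (fun l : I => H l)) : PiLp 2 H :=
  WithLp.toLp 2 fun m => if hm : m ∈ I then h ⟨m, hm⟩ else 0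

theorem extend_apply_mem {I : Finset (Fin M)} (h : PiLp 2 (fun l : I => H l)) (l : I) :
    extend h l = h l := by simp [extend]

theorem extend_apply_notMem {I : Finset (Fin M)} (h : PiLp 2 (fun l : I => H l)) {m : Fin M}
    (hm : m ∉ I) : extend h m = 0 := by simp [extend, hm]

theorem sum_eq_sum_subtype {I : Finset (Fin M)} {G : Type*} [AddCommMonoid G] {c : Fin M → G}
    (hc : ∀ m ∉ I, c m = 0) : ∑ m, c m = ∑ l : I, c l := by
  rw [Finset.sum_coe_sort I c]
  exact (Finset.sum_subset (Finset.subset_univ I) fun m _ hm => hc m hm).symm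

theorem evalSum_extend {I : Finset (Fin M)} (h : PiLp 2 (fun l : I => H l)) (x : 𝒳) :
    evalSum (extend h) x = partialEval h x := by
  rw [evalSum, sum_eq_sum_subtype (I := I)
    (fun m hm => by rw [extend_apply_notMem h hm, RKHS.coe_zero, Pi.zero_apply])]
  exact Finset.sum_congr rfl fun l _ => by rw [extend_apply_mem]

theorem mem_activeSet {f : PiLp 2 H} {m : Fin M} : m ∈ activeSet f ↔ f m ≠ 0 := by
  simp [activeSet]

theorem evalSum_eq_partialEval_restrict {f : PiLp 2 H} {I : Finset (Fin M)}
    (hf : ∀ m ∉ I, f m = 0) (x : 𝒳) : evalSum f x = partialEval (restrict f I) x := by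
  rw [evalSum, sum_eq_sum_subtype (I := I)
    (fun m hm => by rw [hf m hm, RKHS.coe_zero, Pi.zero_apply])]
  rfl

/-- The weights `b + a / (2 ‖f l‖)` of the linearized penalty at `f`. -/
def weight (a b : ℝ) (f : PiLp 2 H) {I : Finset (Fin M)} (l : I) : ℝ := b + a / 2 * ‖f l‖⁻¹

theorem sampleMean_add {𝒵 K : Type*} [NormedAddCommGroup K] [InnerProductSpace ℝ K]
    (z : ℕ → 𝒵) (n : ℕ) (v w : 𝒵 → K) :
    sampleMean z n (fun p => v p + w p) = sampleMean z n v + sampleMean z n w := by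
  simp [sampleMean, Finset.sum_add_distrib]

theorem sampleMean_sub {𝒵 K : Type*} [NormedAddCommGroup K] [InnerProductSpace ℝ K]
    (z : ℕ → 𝒵) (n : ℕ) (v w : 𝒵 → K) :
    sampleMean z n (fun p => v p - w p) = sampleMean z n v - sampleMean z n w := by
  simp [sampleMean, Finset.sum_sub_distrib, smul_sub]

/-- The stationarity equation on the active blocks, written in terms of the estimation error
`f - f₀` and the noise. -/
theorem stationarity_active {z : ℕ → 𝒳 × ℝ} {n : ℕ} {a b : ℝ} (ha : 0 ≤ a)
    {f f₀ : PiLp 2 H} (hf : IsMinOn (objective z n a b) Set.univ f)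
    (hact : activeSet f = activeSet f₀) (h : PiLp 2 (fun l : activeSet f₀ => H l)) :
    sampleMean z n (fun p => partialEval h p.1 * partialEval (restrict (f - f₀) (activeSet f₀)) p.1)
      - sampleMean z n (fun p => noise f₀ p * partialEval h p.1)
      + ⟪h, diagOp (weight a b f) (restrict f (activeSet f₀))⟫_ℝ = 0 := by
  classical
  have h1 := abs_optimality_le ha hf (extend h)
  have h2 : ∑ m, (if f m = 0 then ‖extend h m‖ else 0) = 0 := by
    refine Finset.sum_eq_zero fun m _ => ?_
    by_cases hm : f m = 0
    · rw [if_pos hm, extend_apply_notMem h, norm_zero]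
      rw [← hact, mem_activeSet]; simpa using hm
    · rw [if_neg hm]
  have h3 : ∑ m, (a * ‖f m‖⁻¹ + 2 * b) * ⟪f m, extend h m⟫_ℝ
      = 2 * ⟪h, diagOp (weight a b f) (restrict f (activeSet f₀))⟫_ℝ := by
    rw [inner_diagOp, sum_eq_sum_subtype (I := activeSet f₀)
      (fun m hm => by rw [extend_apply_notMem h hm, inner_zero_right, mul_zero]), Finset.mul_sum]
    refine Finset.sum_congr rfl fun l _ => ?_
    rw [extend_apply_mem, restrict_apply, weight, real_inner_comm]
    ring
  have hoff : ∀ m ∉ activeSet f₀, (f - f₀) m = 0 := fun m hm => by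
    have e1 : f m = 0 := by
      rw [← hact, mem_activeSet] at hm; simpa using hm
    have e2 : f₀ m = 0 := by rw [mem_activeSet] at hm; simpa using hm
    rw [PiLp.sub_apply, e1, e2, sub_zero]
  have h4 : (fun p : 𝒳 × ℝ => (evalSum f p.1 - p.2) * evalSum (extend h) p.1)
      = fun p => partialEval h p.1 * partialEval (restrict (f - f₀) (activeSet f₀)) p.1
          - noise f₀ p * partialEval h p.1 := by
    ext p
    rw [evalSum_extend, ← evalSum_eq_partialEval_restrict hoff, evalSum_sub, noise]
    ring
  rw [h2, mul_zero, h3, h4, sampleMean_sub] at h1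
  have := abs_nonpos_iff.mp h1
  linarith

/-- The subgradient inequality on an inactive block. -/
theorem stationarity_inactive {z : ℕ → 𝒳 × ℝ} {n : ℕ} {a b : ℝ} (ha : 0 ≤ a)
    {f f₀ : PiLp 2 H} (hf : IsMinOn (objective z n a b) Set.univ f)
    (hact : activeSet f = activeSet f₀) {m : Fin M} (hm : m ∉ activeSet f₀) (v : H m) :
    |sampleMean z n (fun p => v p.1 * partialEval (restrict (f - f₀) (activeSet f₀)) p.1)
      - sampleMean z n (fun p => noise f₀ p * v p.1)| ≤ a / 2 * ‖v‖ := by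
  classical
  have hoff : ∀ m ∉ activeSet f₀, f m = 0 ∧ (f - f₀) m = 0 := fun m hm => by
    have e1 : f m = 0 := by
      rw [← hact, mem_activeSet] at hm; simpa using hm
    have e2 : f₀ m = 0 := by rw [mem_activeSet] at hm; simpa using hm
    exact ⟨e1, by rw [PiLp.sub_apply, e1, e2, sub_zero]⟩
  set h : PiLp 2 H := WithLp.toLp 2 (Pi.single m v) with hh
  have hne : ∀ j, j ≠ m → h j = 0 := fun j hj => by simp [hh, hj]
  have hm' : h m = v := by simp [hh]
  have h1 := abs_optimality_le ha hf h
  have h2 : ∑ j, (if f j = 0 then ‖h j‖ else 0) = ‖v‖ := by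
    rw [Finset.sum_eq_single m, if_pos (hoff m hm).1, hm']
    · intro j _ hj; rw [hne j hj]; simp
    · simp
  have h3 : ∑ j, (a * ‖f j‖⁻¹ + 2 * b) * ⟪f j, h j⟫_ℝ = 0 := by
    refine Finset.sum_eq_zero fun j _ => ?_
    by_cases hj : j = m
    · subst hj; rw [(hoff j hm).1, inner_zero_left, mul_zero]
    · rw [hne j hj, inner_zero_right, mul_zero]
  have h5 : ∀ x, evalSum h x = v x := fun x => by
    rw [evalSum, Finset.sum_eq_single m, hm']
    · intro j _ hj; rw [hne j hj, RKHS.coe_zero, Pi.zero_apply]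
    · simp
  have h4 : (fun p : 𝒳 × ℝ => (evalSum f p.1 - p.2) * evalSum h p.1)
      = fun p => v p.1 * partialEval (restrict (f - f₀) (activeSet f₀)) p.1
          - noise f₀ p * v p.1 := by
    ext p
    rw [h5, ← evalSum_eq_partialEval_restrict (fun m hm => (hoff m hm).2), evalSum_sub, noise]
    ring
  rw [h2, h3, h4, sampleMean_sub, add_zero, abs_mul, abs_two] at h1
  linarith

end Optimality

/-! ### The partial sums as square-integrable functions, and their fluctuations -/

section Partial

variable {𝒳 : Type*} [MeasurableSpace 𝒳] {M : ℕ} {H : Fin M → Type*}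
  [∀ m, NormedAddCommGroup (H m)] [∀ m, InnerProductSpace ℝ (H m)]
  [∀ m, CompleteSpace (H m)] [∀ m, RKHS ℝ (H m) 𝒳 ℝ]

/-- The map sending `h` in the Hilbert sum over `I` to the function `∑ l, h l` in `L²(ν)`. -/
def sumL2 (hk : ∀ m, KernelAssumption (H m)) (ν : Measure 𝒳) [IsProbabilityMeasure ν]
    (I : Finset (Fin M)) : PiLp 2 (fun l : I => H l) →L[ℝ] Lp ℝ 2 ν :=
  rowOp fun l : I => toL2 (hk l) ν

theorem sumL2_apply (hk : ∀ m, KernelAssumption (H m)) (ν : Measure 𝒳) [IsProbabilityMeasure ν]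
    (I : Finset (Fin M)) (h : PiLp 2 (fun l : I => H l)) :
    sumL2 hk ν I h = ∑ l : I, toL2 (hk l) ν (h l) := rowOp_apply _ _

theorem coeFn_sumL2 (hk : ∀ m, KernelAssumption (H m)) (ν : Measure 𝒳) [IsProbabilityMeasure ν]
    {I : Finset (Fin M)} (h : PiLp 2 (fun l : I => H l)) :
    sumL2 hk ν I h =ᵐ[ν] partialEval h := by
  rw [sumL2_apply]
  refine (Lp.coeFn_finsetSum _ _).trans ?_
  have h1 : ∀ᵐ x ∂ν, ∀ l : I, toL2 (hk l) ν (h l) x = h l x :=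
    ae_all_iff.mpr fun l => coeFn_toL2 (hk l) ν (h l)
  filter_upwards [h1] with x hx
  rw [Finset.sum_apply, partialEval]
  exact Finset.sum_congr rfl fun l _ => hx l

theorem covII_add_eq_ridge (hk : ∀ m, KernelAssumption (H m)) (ν : Measure 𝒳)
    [IsProbabilityMeasure ν] (I : Finset (Fin M)) (b : ℝ) :
    covII H ν I + b • 1 = ridge (sumL2 hk ν I) (fun _ => b) := by
  ext1 u
  refine ext_inner_left ℝ fun h => ?_
  rw [inner_ridge, diagOp_const]
  simp only [add_apply, smul_apply, one_apply_eq_self, inner_add_right]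
  congr 1
  rw [covII, PiLp.inner_apply, sumL2_apply, sum_inner]
  refine Finset.sum_congr rfl fun l _ => ?_
  rw [blockOp_apply, inner_sum, sumL2_apply, inner_sum]
  exact Finset.sum_congr rfl fun m _ => (inner_toL2 (hk l) (hk m) ν (h l) (u m)).symm

theorem inner_covRow (hk : ∀ m, KernelAssumption (H m)) (ν : Measure 𝒳)
    [IsProbabilityMeasure ν] (I : Finset (Fin M)) {m : Fin M} (v : H m)
    (u : PiLp 2 (fun l : I => H l)) :
    ⟪v, covRow H ν m I u⟫_ℝ = ⟪toL2 (hk m) ν v, sumL2 hk ν I u⟫_ℝ := by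
  rw [covRow, rowOp_apply, inner_sum, sumL2_apply, inner_sum]
  exact Finset.sum_congr rfl fun l _ => (inner_toL2 (hk m) (hk l) ν v (u l)).symm

theorem norm_toL2_le {G : Type*} [NormedAddCommGroup G] [InnerProductSpace ℝ G]
    [CompleteSpace G] [RKHS ℝ G 𝒳 ℝ] (h : KernelAssumption G) (ν : Measure 𝒳)
    [IsProbabilityMeasure ν] (f : G) : ‖toL2 h ν f‖ ≤ ‖f‖ := by
  refine (Lp.norm_le_of_ae_bound (norm_nonneg f) ?_).trans (by simp [measureUnivNNReal])
  filter_upwards [coeFn_toL2 h ν f] with x hx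
  rw [hx]; exact norm_apply_le_norm h f x

/-- The separation of the summands, in the form used for the active blocks: `J = sumL2` controls
block-diagonal operators, as well as the individual blocks and the blocks outside `I`. -/
theorem exists_separation {hk : ∀ m, KernelAssumption (H m)} {ν : Measure 𝒳}
    [IsProbabilityMeasure ν] {C : ℝ} (hC : 0 < C) (hsep : ∀ s : PiLp 2 H,
      ∑ m, ‖toL2 (hk m) ν (s m)‖ ^ 2 ≤ C * ‖∑ m, toL2 (hk m) ν (s m)‖ ^ 2)
    (I : Finset (Fin M)) :
    ∃ D, 0 ≤ D ∧ DiagBounded (sumL2 hk ν I) D ∧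
      (∀ (l : I) (t : PiLp 2 (fun l : I => H l)), ‖toL2 (hk l) ν (t l)‖ ≤ D * ‖sumL2 hk ν I t‖) ∧
      (∀ m ∉ I, ∀ (v : H m) (t : PiLp 2 (fun l : I => H l)),
        ‖toL2 (hk m) ν v‖ ≤ D * ‖toL2 (hk m) ν v - sumL2 hk ν I t‖) := by
  have hblock : ∀ (l : I) (t : PiLp 2 (fun l : I => H l)),
      ‖toL2 (hk l) ν (t l)‖ ≤ √C * ‖sumL2 hk ν I t‖ := fun l t => by
    have h1 := hsep (extend t)
    have h2 : ∑ m, toL2 (hk m) ν (extend t m) = sumL2 hk ν I t := by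
      rw [sumL2_apply, sum_eq_sum_subtype (I := I)
        (fun m hm => by rw [extend_apply_notMem t hm, map_zero])]
      exact Finset.sum_congr rfl fun l _ => by rw [extend_apply_mem]
    have h3 := Finset.single_le_sum (f := fun m => ‖toL2 (hk m) ν (extend t m)‖ ^ 2)
      (fun m _ => sq_nonneg _) (Finset.mem_univ (l : Fin M))
    rw [h2] at h1
    simp only [extend_apply_mem] at h3
    refine le_of_sq_le_sq ?_ (by positivity)
    rw [mul_pow, Real.sq_sqrt hC.le]
    exact h3.trans h1
  have hcard : (1 : ℝ) ≤ 1 + Fintype.card I := by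
    have : (0 : ℝ) ≤ Fintype.card I := by positivity
    linarith
  refine ⟨(1 + Fintype.card I) * √C, by positivity, ?_, fun l t => ?_, fun m hm v t => ?_⟩
  · intro c K hc t
    rw [sumL2_apply]
    refine (norm_sum_le _ _).trans ?_
    have h1 : ∀ l : I, ‖toL2 (hk l) ν (diagOp c t l)‖ ≤ K * (√C * ‖sumL2 hk ν I t‖) := fun l => by
      rw [diagOp_apply, map_smul, norm_smul]
      exact mul_le_mul (hc l) (hblock l t) (norm_nonneg _) ((abs_nonneg _).trans (hc l))
    refine (Finset.sum_le_sum fun l _ => h1 l).trans ?_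
    rw [Finset.sum_const, Finset.card_univ, nsmul_eq_mul]
    rcases isEmpty_or_nonempty I with hI | ⟨⟨l⟩⟩
    · have : t = 0 := Subsingleton.elim _ _
      subst this
      simp
    · have hK : 0 ≤ K := (abs_nonneg _).trans (hc l)
      have : 0 ≤ K * (√C * ‖sumL2 hk ν I t‖) := by positivity
      nlinarith
  · refine (hblock l t).trans ?_
    have : 0 ≤ √C * ‖sumL2 hk ν I t‖ := by positivity
    nlinarith
  · classical
    set s : PiLp 2 H := WithLp.toLp 2 (Pi.single m v) - extend t with hs
    have hsm : s m = v := by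
      rw [hs, PiLp.sub_apply, extend_apply_notMem t hm]; simp
    have h2 : ∑ j, toL2 (hk j) ν (s j) = toL2 (hk m) ν v - sumL2 hk ν I t := by
      simp only [hs, PiLp.sub_apply, map_sub, Finset.sum_sub_distrib]
      congr 1
      · rw [Finset.sum_eq_single m]
        · simp
        · intro j _ hj; simp [hj]
        · simp
      · rw [sumL2_apply, sum_eq_sum_subtype (I := I)
          (fun m hm => by rw [extend_apply_notMem t hm, map_zero])]
        exact Finset.sum_congr rfl fun l _ => by rw [extend_apply_mem]
    have h3 := Finset.single_le_sum (f := fun m => ‖toL2 (hk m) ν (s m)‖ ^ 2)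
      (fun m _ => sq_nonneg _) (Finset.mem_univ m)
    have h1 := hsep s
    rw [h2] at h1
    simp only [hsm] at h3
    have h4 : ‖toL2 (hk m) ν v‖ ≤ √C * ‖toL2 (hk m) ν v - sumL2 hk ν I t‖ := by
      refine le_of_sq_le_sq ?_ (by positivity)
      rw [mul_pow, Real.sq_sqrt hC.le]
      exact h3.trans h1
    have : 0 ≤ √C * ‖toL2 (hk m) ν v - sumL2 hk ν I t‖ := by positivity
    nlinarith

/-- The feature map of the Hilbert sum over `I`. -/
def feature (H : Fin M → Type*) [∀ m, NormedAddCommGroup (H m)]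
    [∀ m, InnerProductSpace ℝ (H m)] [∀ m, CompleteSpace (H m)] [∀ m, RKHS ℝ (H m) 𝒳 ℝ]
    (I : Finset (Fin M)) (x : 𝒳) : PiLp 2 (fun l : I => H l) :=
  WithLp.toLp 2 fun l : I => RKHS.kerFun (H l) x (1 : ℝ)

theorem inner_feature {I : Finset (Fin M)} (x : 𝒳) (h : PiLp 2 (fun l : I => H l)) :
    ⟪feature H I x, h⟫_ℝ = partialEval h x := by
  rw [PiLp.inner_apply, partialEval]
  exact Finset.sum_congr rfl fun l _ => inner_kerFun_one x (h l)

theorem norm_feature_le (hk : ∀ m, KernelAssumption (H m)) (I : Finset (Fin M)) (x : 𝒳) :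
    ‖feature H I x‖ ≤ √(Fintype.card I) := by
  refine Real.le_sqrt_of_sq_le ?_
  rw [PiLp.norm_sq_eq_of_L2]
  calc ∑ l : I, ‖feature H I x l‖ ^ 2 ≤ ∑ _l : I, (1 : ℝ) :=
        Finset.sum_le_sum fun l _ =>
          pow_le_one₀ (norm_nonneg _) (norm_kerFun_one_le (hk l) x)
    _ = Fintype.card I := by simp

theorem stronglyMeasurable_feature {ν : Measure 𝒳} [IsProbabilityMeasure ν] {μ : Fin M → ℕ → ℝ}
    {φ : Fin M → ℕ → 𝒳 → ℝ} (S : ∀ m, SpectralRep ν (ker (H m)) (μ m) (φ m))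
    (hk : ∀ m, KernelAssumption (H m)) (I : Finset (Fin M)) :
    StronglyMeasurable (feature H I : 𝒳 → _) := by
  have h1 : (feature H I : 𝒳 → _) = fun x => ∑ l : I,
      WithLp.toLp 2 (Pi.single l (RKHS.kerFun (H l) x (1 : ℝ))) := by
    funext x
    rw [← WithLp.toLp_sum, Finset.univ_sum_single]
    rfl
  rw [h1]
  refine Finset.stronglyMeasurable_fun_sum _ fun l _ => ?_
  exact ((PiLp.continuous_toLp 2 (fun l : I => H l)).comp
    (continuous_single l)).comp_stronglyMeasurable ((S l).stronglyMeasurable_kerFun (hk l))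

theorem measurable_partialEval (hk : ∀ m, KernelAssumption (H m)) {I : Finset (Fin M)}
    (h : PiLp 2 (fun l : I => H l)) : Measurable (partialEval h : 𝒳 → ℝ) :=
  Finset.measurable_fun_sum _ fun l _ => (hk l).measurable (h l)

theorem memLp_partialEval (hk : ∀ m, KernelAssumption (H m)) (ν : Measure 𝒳)
    [IsProbabilityMeasure ν] {I : Finset (Fin M)} (h : PiLp 2 (fun l : I => H l)) :
    MemLp (partialEval h : 𝒳 → ℝ) 2 ν :=
  (memLp_congr_ae (coeFn_sumL2 hk ν h)).mp (Lp.memLp _)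

theorem integral_mul_eq_inner {ν : Measure 𝒳} {F G : Lp ℝ 2 ν} {f g : 𝒳 → ℝ} (hf : F =ᵐ[ν] f)
    (hg : G =ᵐ[ν] g) : ∫ x, f x * g x ∂ν = ⟪F, G⟫_ℝ := by
  rw [L2.inner_def]
  refine integral_congr_ae ?_
  filter_upwards [hf, hg] with x h1 h2
  rw [h1, h2]; simp [mul_comm]

theorem sqrt_integral_sq_eq_norm {ν : Measure 𝒳} {F : Lp ℝ 2 ν} {f : 𝒳 → ℝ} (hf : F =ᵐ[ν] f) :
    √(∫ x, f x ^ 2 ∂ν) = ‖F‖ := by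
  simp_rw [sq]
  rw [integral_mul_eq_inner hf hf, real_inner_self_eq_norm_mul_norm,
    Real.sqrt_mul_self (norm_nonneg _)]

instance isProbabilityMeasure_map_fst (ρ : Measure (𝒳 × ℝ)) [IsProbabilityMeasure ρ] :
    IsProbabilityMeasure (ρ.map Prod.fst) :=
  Measure.isProbabilityMeasure_map measurable_fst.aemeasurable

/-- The norm of the centred sample mean of `g` times the feature map: it bounds the fluctuations of
the sample means of `g * partialEval r`, uniformly over the unit ball of directions `r`. -/
def deviation (H : Fin M → Type*) [∀ m, NormedAddCommGroup (H m)]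
    [∀ m, InnerProductSpace ℝ (H m)] [∀ m, CompleteSpace (H m)] [∀ m, RKHS ℝ (H m) 𝒳 ℝ]
    (ρ : Measure (𝒳 × ℝ)) (I : Finset (Fin M)) (z : ℕ → 𝒳 × ℝ) (n : ℕ) (g : 𝒳 → ℝ) : ℝ :=
  ‖sampleMean z n (fun p => g p.1 • feature H I p.1) - ∫ p, g p.1 • feature H I p.1 ∂ρ‖

section Fluctuation

variable {ρ : Measure (𝒳 × ℝ)} [IsProbabilityMeasure ρ] {μ : Fin M → ℕ → ℝ}
  {φ : Fin M → ℕ → 𝒳 → ℝ} (S : ∀ m, SpectralRep (ρ.map Prod.fst) (ker (H m)) (μ m) (φ m))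
  (hk : ∀ m, KernelAssumption (H m)) {I : Finset (Fin M)}

include S hk

theorem memLp_smul_feature {g : 𝒳 → ℝ} (hg : MemLp g 2 (ρ.map Prod.fst)) :
    MemLp (fun p : 𝒳 × ℝ => g p.1 • feature H I p.1) 2 ρ := by
  refine MemLp.of_le_mul (c := √(Fintype.card I)) (memLp_comp_fst hg)
    ((memLp_comp_fst hg).1.smul
      ((stronglyMeasurable_feature S hk I).comp_measurable measurable_fst).aestronglyMeasurable)
    (Eventually.of_forall fun p => ?_)
  rw [norm_smul, mul_comm]
  exact mul_le_mul_of_nonneg_right (norm_feature_le hk I p.1) (norm_nonneg _)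

theorem abs_sampleMean_sub_integral_le {g : 𝒳 → ℝ} (hg : MemLp g 2 (ρ.map Prod.fst))
    (z : ℕ → 𝒳 × ℝ) (n : ℕ) (r : PiLp 2 (fun l : I => H l)) :
    |sampleMean z n (fun p => g p.1 * partialEval r p.1)
      - ∫ x, g x * partialEval r x ∂(ρ.map Prod.fst)| ≤ deviation H ρ I z n g * ‖r‖ := by
  have h1 : sampleMean z n (fun p => g p.1 * partialEval r p.1)
      = ⟪sampleMean z n (fun p => g p.1 • feature H I p.1), r⟫_ℝ := by
    simp only [sampleMean, inner_smul_left, sum_inner, inner_feature, RCLike.conj_to_real,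
      smul_eq_mul]
  have h2 : ∫ x, g x * partialEval r x ∂(ρ.map Prod.fst)
      = ⟪∫ p, g p.1 • feature H I p.1 ∂ρ, r⟫_ℝ := by
    rw [integral_map (f := fun x => g x * partialEval r x) measurable_fst.aemeasurable
      (hg.1.mul (measurable_partialEval hk r).aestronglyMeasurable), real_inner_comm,
      ← integral_inner ((memLp_smul_feature S hk hg).integrable one_le_two)]
    refine integral_congr_ae (Eventually.of_forall fun p => ?_)
    simp only
    rw [inner_smul_right, real_inner_comm, inner_feature]
  rw [h1, h2, ← inner_sub_left]
  exact abs_real_inner_le_norm _ _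

variable {Ω : Type*} [MeasurableSpace Ω] {P : Measure Ω} [IsProbabilityMeasure P]
  {Z : ℕ → Ω → 𝒳 × ℝ} (hlaw : ∀ i, HasLaw (Z i) ρ P) (hind : iIndepFun Z P)

include hlaw

theorem integrable_deviation {g : 𝒳 → ℝ} (hg : MemLp g 2 (ρ.map Prod.fst)) (n : ℕ) :
    Integrable (fun ω => deviation H ρ I (fun i => Z i ω) n g) P :=
  ((((memLp_sampleMean hlaw (memLp_smul_feature S hk hg) n)).sub
    (memLp_const _)).integrable one_le_two).norm

include hind

theorem integral_deviation_le {g : 𝒳 → ℝ} (hg : MemLp g 2 (ρ.map Prod.fst)) {n : ℕ} (hn : 0 < n) :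
    ∫ ω, deviation H ρ I (fun i => Z i ω) n g ∂P
      ≤ √(Fintype.card I) / √n * √(∫ x, g x ^ 2 ∂(ρ.map Prod.fst)) := by
  have hm := memLp_smul_feature (I := I) S hk hg
  refine (integral_norm_sampleMean_sub_le hlaw hind hm hn).trans ?_
  rw [div_mul_eq_mul_div, ← Real.sqrt_mul (by positivity)]
  gcongr
  rw [integral_sq_map_fst hg, ← integral_const_mul]
  refine integral_mono (hm.integrable_norm_pow two_ne_zero)
    ((memLp_comp_fst hg).integrable_sq.const_mul _) fun p => ?_
  simp only
  rw [norm_smul, mul_pow, Real.norm_eq_abs, sq_abs, mul_comm]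
  refine mul_le_mul_of_nonneg_right ?_ (sq_nonneg _)
  calc ‖feature H I p.1‖ ^ 2 ≤ √(Fintype.card I : ℝ) ^ 2 := by
        gcongr; exact norm_feature_le hk I p.1
    _ = (Fintype.card I : ℝ) := Real.sq_sqrt (by positivity)

omit S in
theorem integral_abs_sampleMean_noise_le {f : PiLp 2 H} (hmod : ModelAssumption ρ f) {L : ℝ}
    (hL0 : 0 ≤ L) (hL : ∀ᵐ z ∂ρ, |noise f z| ≤ L) {g : 𝒳 → ℝ} (hgm : StronglyMeasurable g)
    (hg : MemLp g 2 (ρ.map Prod.fst)) {n : ℕ} (hn : 0 < n) :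
    ∫ ω, |sampleMean (fun i => Z i ω) n (fun p => noise f p * g p.1)| ∂P
      ≤ L / √n * √(∫ x, g x ^ 2 ∂(ρ.map Prod.fst)) := by
  have h1 := integral_norm_sampleMean_sub_le hlaw hind (memLp_noise_mul hk hL hg) hn
  rw [hmod.integral_noise_mul hk hgm hg] at h1
  simp only [sub_zero, Real.norm_eq_abs] at h1
  refine h1.trans ?_
  rw [div_mul_eq_mul_div]
  gcongr
  refine Real.sqrt_le_iff.mpr ⟨by positivity, ?_⟩
  rw [mul_pow, Real.sq_sqrt (integral_nonneg fun x => sq_nonneg _)]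
  have h2 := integral_noise_mul_sq_le hk hL hg
  simpa only [Real.norm_eq_abs] using h2

end Fluctuation

end Partial

/-! ### The noise in the residual direction -/

section Residual

variable {ι : Type*} [Fintype ι] {F : ι → Type*}
  [∀ i, NormedAddCommGroup (F i)] [∀ i, InnerProductSpace ℝ (F i)] [∀ i, CompleteSpace (F i)]
  {L : Type*} [NormedAddCommGroup L] [InnerProductSpace ℝ L] [CompleteSpace L]
  {Ω : Type*} [MeasurableSpace Ω] {P : Measure Ω}

set_option maxHeartbeats 1000000 in
/-- In addition to the equation of `exists_dominating`, let the random vector `r` satisfy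
`⟪J r, y⟫ ≈ ev` up to `κ`. Eliminating `r` by means of the deterministic ridge solution
`s` for the data `y` yields `ev - es + ⟪Diag(a) f, s⟫ ≈ 0` up to `κ` and a term that is small in
mean. The elimination leaves `∑ i, (a i - â i) ⟪s i, r i⟫`, which `exists_dominating` controls even
though `‖s‖` may be unbounded as the weights tend to zero. -/
theorem exists_residual_dominating [IsProbabilityMeasure P] {J : PiLp 2 F →L[ℝ] L} {C : ℝ}
    (hC : 0 ≤ C) (hJ : DiagBounded J C)
    {f : PiLp 2 F} {Cf : ℝ} (hCf : 0 ≤ Cf) (hf : ∀ i t, |⟪f i, t i⟫_ℝ| ≤ Cf * ‖J t‖)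
    {a : ι → ℝ} {q Q lam lam₁ : ℝ} (hq : 0 < q) (hQ : 0 ≤ Q) (hlam : 0 < lam) (hlam₁ : 0 ≤ lam₁)
    (hle : lam₁ ≤ lam) (ha : ∀ i, q * lam ≤ a i) (haQ : ∀ i, a i ≤ Q * lam)
    {good : Set Ω} {r : Ω → PiLp 2 F} {ah : Ω → ι → ℝ} {N : PiLp 2 F → Ω → ℝ} {τ : ℝ}
    (hτ : 0 ≤ τ) (hN0 : ∀ u ω, 0 ≤ N u ω) (hNi : ∀ u, Integrable (N u) P)
    (hN : ∀ u, ∫ ω, N u ω ∂P ≤ τ * ‖J u‖)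
    (hkkt : ∀ ω ∈ good, ∀ u,
      |⟪J u, J (r ω)⟫_ℝ + ⟪u, diagOp (ah ω) (f + r ω)⟫_ℝ| ≤ N u ω)
    (hr : ∀ ω ∈ good, ‖r ω‖ ≤ 1)
    {η : ℝ} (hη0 : 0 ≤ η) (hη1 : η ≤ 1) (hη : ∀ ω ∈ good, ∀ i, |ah ω i - a i| ≤ η * lam₁)
    (hsmall : 2 * (Fintype.card ι * η * q⁻¹ * (C ^ 2 + 1)) ≤ 1)
    {y : L} (hy : ‖y‖ ≤ 1) {s : PiLp 2 F} (hs : s = ridgeInv J a (J.adjoint y))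
    {es ev Ds Dv : Ω → ℝ} {κ : ℝ} (hDs0 : ∀ ω, 0 ≤ Ds ω) (hDv0 : ∀ ω, 0 ≤ Dv ω)
    (hDsi : Integrable Ds P) (hDvi : Integrable Dv P) (hDs : ∫ ω, Ds ω ∂P ≤ τ)
    (hDv : ∫ ω, Dv ω ∂P ≤ τ)
    (hes : ∀ ω ∈ good,
      |⟪J s, J (r ω)⟫_ℝ + ⟪s, diagOp (ah ω) (f + r ω)⟫_ℝ - es ω| ≤ η * Ds ω)
    (hev : ∀ ω ∈ good, |⟪J (r ω), y⟫_ℝ - ev ω| ≤ κ + η * Dv ω) :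
    ∃ Y : Ω → ℝ, (∀ ω, 0 ≤ Y ω) ∧ Integrable Y P ∧
      ∫ ω, Y ω ∂P ≤ (2 + Fintype.card ι * (Cf + 1 +
        2 * (q⁻¹ * C * (1 + Fintype.card ι * (Q + 1) * Cf)) * C)) * (τ + lam₁) ∧
      ∀ ω ∈ good, |ev ω - es ω + ⟪diagOp a f, s⟫_ℝ| ≤ κ + η * Y ω := by
  have ha0 : ∀ i, 0 < a i := fun i => (mul_pos hq hlam).trans_le (ha i)
  have hJs : ‖J s‖ ≤ 1 := (hs ▸ norm_map_ridgeInv_adjoint_le J ha0 y).trans hy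
  obtain ⟨k, hk⟩ : ∃ k : ℕ, (1 / 2 : ℝ) ^ k * ‖s‖ ≤ 1 := by
    obtain ⟨k, hk⟩ := exists_pow_lt_of_lt_one (show (0 : ℝ) < (‖s‖ + 1)⁻¹ by positivity)
      (show (1 / 2 : ℝ) < 1 by norm_num)
    refine ⟨k, ?_⟩
    have h1 : (‖s‖ + 1)⁻¹ * (‖s‖ + 1) = 1 := inv_mul_cancel₀ (by positivity)
    have h2 := mul_le_mul_of_nonneg_right hk.le (show (0 : ℝ) ≤ ‖s‖ + 1 by positivity)
    have h3 : (0 : ℝ) ≤ (1 / 2) ^ k := by positivity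
    nlinarith
  choose Y hY0 hYi hYint hYle using fun i : ι =>
    exists_dominating hC hJ hCf hf hq hQ hlam ha haQ hτ hN0 hNi hN hkkt hr hη0 hη1
      (fun ω hω i => (hη ω hω i).trans (mul_le_mul_of_nonneg_left hle hη0)) hsmall k (block i s)
  obtain ⟨D, hD⟩ : ∃ D : ℝ, D = Fintype.card ι := ⟨_, rfl⟩
  have hD0 : 0 ≤ D := by rw [hD]; positivity
  rw [← hD] at hYint ⊢
  have hYi' : ∀ i, Integrable (fun ω => lam₁ * (Y i ω + 1)) P :=
    fun i => ((hYi i).add (integrable_const 1)).const_mul _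
  have hsumi : Integrable (fun ω => ∑ i, lam₁ * (Y i ω + 1)) P :=
    integrable_finsetSum _ fun i _ => hYi' i
  have hDD : Integrable (fun ω => Ds ω + Dv ω) P := hDsi.add hDvi
  have hDDc : Integrable (fun ω => Ds ω + Dv ω + lam₁ * (D * Cf)) P :=
    hDD.add (integrable_const _)
  refine ⟨fun ω => Ds ω + Dv ω + lam₁ * (D * Cf) + ∑ i, lam₁ * (Y i ω + 1), fun ω => ?_,
    hDDc.add hsumi, ?_, fun ω hω => ?_⟩
  · have h1 : 0 ≤ ∑ i, lam₁ * (Y i ω + 1) :=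
      Finset.sum_nonneg fun i _ => mul_nonneg hlam₁ (by linarith [hY0 i ω])
    have := hDs0 ω
    have := hDv0 ω
    positivity
  · rw [integral_add hDDc hsumi, integral_add hDD (integrable_const _),
      integral_add hDsi hDvi, integral_const, probReal_univ, one_smul,
      integral_finsetSum _ fun i _ => hYi' i]
    obtain ⟨B, hB⟩ : ∃ B : ℝ, B = q⁻¹ * C * (1 + D * (Q + 1) * Cf) := ⟨_, rfl⟩
    have h2 : ∑ i, ∫ ω, lam₁ * (Y i ω + 1) ∂P
        ≤ ∑ _i : ι, (2 * B * C * (τ + lam₁) + lam₁) := by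
      refine Finset.sum_le_sum fun i _ => ?_
      rw [integral_const_mul, integral_add (hYi i) (integrable_const 1), integral_const,
        probReal_univ, one_smul]
      have h3 : ‖J (block i s)‖ ≤ C :=
        (hJ.norm_map_block_le i s).trans (mul_le_of_le_one_right hC hJs)
      have h4 : lam₁ * (τ / lam + D * (Q + 1) * Cf)
          ≤ (1 + D * (Q + 1) * Cf) * (τ + lam₁) := by
        have h5 : lam₁ * (τ / lam) ≤ τ := by
          rw [mul_div_assoc', div_le_iff₀ hlam, mul_comm]
          exact mul_le_mul_of_nonneg_left hle hτ
        have h6 : 0 ≤ D * (Q + 1) * Cf := by positivity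
        nlinarith
      have h5 : ∫ ω, Y i ω ∂P ≤ 2 * (q⁻¹ * C * (τ / lam + D * (Q + 1) * Cf)) * C :=
        (hYint i).trans (mul_le_mul_of_nonneg_left h3 (by positivity))
      have h6 : 0 ≤ 2 * (q⁻¹ * C) * C := by positivity
      have h7 := mul_le_mul_of_nonneg_left h4 h6
      have h8 := mul_le_mul_of_nonneg_left h5 hlam₁
      rw [hB]
      nlinarith
    rw [Finset.sum_const, Finset.card_univ, nsmul_eq_mul, ← hD] at h2
    rw [← hB]
    have h3 : 0 ≤ D * Cf * τ := by positivity
    have h4 : 0 ≤ D * τ := by positivity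
    nlinarith
  · have e1 := inner_ridgeInv J ha0 (r ω) (J.adjoint y)
    rw [← hs, ContinuousLinearMap.adjoint_inner_right] at e1
    have e2 : ⟪s, diagOp (ah ω) (f + r ω)⟫_ℝ = ⟪diagOp a f, s⟫_ℝ + ⟪r ω, diagOp a s⟫_ℝ
        + ⟪s, diagOp (fun i => ah ω i - a i) f⟫_ℝ
        + ⟪s, diagOp (fun i => ah ω i - a i) (r ω)⟫_ℝ := by
      rw [real_inner_comm s (diagOp a f)]
      simp only [inner_diagOp, ← Finset.sum_add_distrib]
      refine Finset.sum_congr rfl fun i _ => ?_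
      rw [PiLp.add_apply, inner_add_right, real_inner_comm (s i) (r ω i)]
      ring
    have e3 := hes ω hω
    have e4 := hev ω hω
    have e5 := abs_inner_diagOp_le (c := fun i => ah ω i - a i) (hη ω hω) s f
    have e6 := abs_inner_diagOp_le (c := fun i => ah ω i - a i) (hη ω hω) s (r ω)
    have e7 : ∑ i, |⟪s i, f i⟫_ℝ| ≤ D * Cf := by
      refine (sum_abs_inner_le hf s).trans ?_
      rw [← hD]
      exact mul_le_mul_of_nonneg_left (mul_le_of_le_one_right hCf hJs) hD0
    have e8 : ∑ i, |⟪s i, r ω i⟫_ℝ| ≤ ∑ i, (Y i ω + 1) := by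
      refine Finset.sum_le_sum fun i _ => ?_
      rw [real_inner_comm, ← inner_block]
      refine (hYle i ω hω).trans (add_le_add_right ?_ _)
      exact (mul_le_mul_of_nonneg_left (norm_block_le i s) (by positivity)).trans hk
    have hηl : 0 ≤ η * lam₁ := mul_nonneg hη0 hlam₁
    have e9 := e5.trans (mul_le_mul_of_nonneg_left e7 hηl)
    have e10 := e6.trans (mul_le_mul_of_nonneg_left e8 hηl)
    have e11 : ev ω - es ω + ⟪diagOp a f, s⟫_ℝ = -(⟪J (r ω), y⟫_ℝ - ev ω)
        + (⟪J s, J (r ω)⟫_ℝ + ⟪s, diagOp (ah ω) (f + r ω)⟫_ℝ - es ω)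
        - ⟪s, diagOp (fun i => ah ω i - a i) f⟫_ℝ
        - ⟪s, diagOp (fun i => ah ω i - a i) (r ω)⟫_ℝ := by
      rw [e2, ← e1, real_inner_comm (J (r ω)) (J s)]; ring
    rw [e11]
    beta_reduce
    rw [← Finset.mul_sum]
    rw [abs_le] at e3 e4 e9 e10 ⊢
    have e12 : η * (Ds ω + Dv ω + lam₁ * (D * Cf) + lam₁ * ∑ i, (Y i ω + 1))
        = η * Ds ω + η * Dv ω + η * lam₁ * (D * Cf) + η * lam₁ * ∑ i, (Y i ω + 1) := by ring
    rw [e12]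
    constructor <;> linarith [e3.1, e3.2, e4.1, e4.2, e9.1, e9.2, e10.1, e10.2]

end Residual

/-! ### The stationarity equations on a favourable event -/

section Favourable

variable {𝒳 : Type*} [MeasurableSpace 𝒳] {M : ℕ} {H : Fin M → Type*}
  [∀ m, NormedAddCommGroup (H m)] [∀ m, InnerProductSpace ℝ (H m)]
  [∀ m, CompleteSpace (H m)] [∀ m, RKHS ℝ (H m) 𝒳 ℝ]

/-- The event on which `fhat` minimizes the objective, has the active set of `f`, and is `η`-close
to `f`, also in the inverse norms of the active blocks. -/
def goodEvent {Ω : Type*} (Z : ℕ → Ω → 𝒳 × ℝ) (n : ℕ) (a b : ℝ) (f : PiLp 2 H)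
    (fhat : Ω → PiLp 2 H) (η : ℝ) : Set Ω :=
  {ω | IsMinOn (objective (fun i => Z i ω) n a b) Set.univ (fhat ω) ∧
    activeSet (fhat ω) = activeSet f ∧
    (∀ l ∈ activeSet f, |‖fhat ω l‖⁻¹ - ‖f l‖⁻¹| ≤ η) ∧ ‖fhat ω - f‖ ≤ η}

theorem norm_restrict_le (f : PiLp 2 H) (I : Finset (Fin M)) : ‖restrict f I‖ ≤ ‖f‖ := by
  refine le_of_sq_le_sq ?_ (norm_nonneg f)
  rw [PiLp.norm_sq_eq_of_L2, PiLp.norm_sq_eq_of_L2]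
  refine (Finset.sum_coe_sort I (fun m => ‖f m‖ ^ 2)).trans_le ?_
  exact Finset.sum_le_sum_of_subset_of_nonneg (Finset.subset_univ I) fun _ _ _ => sq_nonneg _

theorem restrict_sub (f g : PiLp 2 H) (I : Finset (Fin M)) :
    restrict (f - g) I = restrict f I - restrict g I := rfl

/-- The weights are comparable to `a + b`. -/
theorem exists_weight_bounds (f : PiLp 2 H) :
    ∃ q Q : ℝ, 0 < q ∧ 0 ≤ Q ∧ ∀ a b : ℝ, 0 ≤ a → 0 < b → ∀ l : activeSet f,
      q * (a + b) ≤ weight a b f l ∧ weight a b f l ≤ Q * (a + b) := by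
  refine ⟨(2 * (1 + ‖f‖))⁻¹, 1 + ∑ m, ‖f m‖⁻¹, by positivity, by positivity,
    fun a b ha hb l => ⟨?_, ?_⟩⟩
  · have hl : 0 < ‖f l‖ := norm_pos_iff.mpr (mem_activeSet.mp l.2)
    have h1 : (1 + ‖f‖)⁻¹ ≤ ‖f l‖⁻¹ :=
      inv_anti₀ hl ((PiLp.norm_apply_le f l).trans (by linarith))
    have h2 : (1 + ‖f‖)⁻¹ ≤ 1 := inv_le_one_of_one_le₀ (by linarith [norm_nonneg f])
    rw [weight, mul_inv]
    nlinarith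
  · have h1 : ‖f l‖⁻¹ ≤ ∑ m, ‖f m‖⁻¹ :=
      Finset.single_le_sum (f := fun m => ‖f m‖⁻¹) (fun m _ => by positivity)
        (Finset.mem_univ (l : Fin M))
    have h2 : 0 ≤ ‖f l‖⁻¹ := by positivity
    rw [weight]
    nlinarith

/-- The source condition bounds `⟪f l, t l⟫` by the `L²` norm of the *sum* of the blocks. -/
theorem exists_abs_inner_restrict_le {ν : Measure 𝒳} [IsProbabilityMeasure ν]
    {hk : ∀ m, KernelAssumption (H m)} {μ : Fin M → ℕ → ℝ} {φ : Fin M → ℕ → 𝒳 → ℝ}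
    {S : ∀ m, SpectralRep ν (ker (H m)) (μ m) (φ m)} {f : PiLp 2 H}
    (hf : ∀ m, SourceCondition (S m) (f m)) {I : Finset (Fin M)} {D : ℝ} (hD0 : 0 ≤ D)
    (hD : ∀ (l : I) (t : PiLp 2 (fun l : I => H l)),
      ‖toL2 (hk l) ν (t l)‖ ≤ D * ‖sumL2 hk ν I t‖) :
    ∃ Cf, 0 ≤ Cf ∧ ∀ (l : I) (t : PiLp 2 (fun l : I => H l)),
      |⟪restrict f I l, t l⟫_ℝ| ≤ Cf * ‖sumL2 hk ν I t‖ := by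
  choose c hc0 hc using fun m => (hf m).exists_abs_inner_le (hk m)
  refine ⟨(∑ m, c m) * D, mul_nonneg (Finset.sum_nonneg fun m _ => hc0 m) hD0, fun l t => ?_⟩
  refine (hc l (t l)).trans ?_
  rw [mul_assoc]
  exact mul_le_mul (Finset.single_le_sum (fun m _ => hc0 m) (Finset.mem_univ (l : Fin M)))
    (hD l t) (norm_nonneg _) (Finset.sum_nonneg fun m _ => hc0 m)

set_option maxHeartbeats 1000000 in
/-- On the good event, the noise in the direction of the residual `v - s` of the ridge regression of
an inactive direction `v` on the active blocks offsets the bias `⟪Diag(w) f, s⟫`, up to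
`a / 2` and a term that is small in mean relative to `a + 1 / √n`. -/
theorem exists_noise_residual_dominating {ρ : Measure (𝒳 × ℝ)} [IsProbabilityMeasure ρ]
    {hk : ∀ m, KernelAssumption (H m)} {μ : Fin M → ℕ → ℝ} {φ : Fin M → ℕ → 𝒳 → ℝ}
    (S : ∀ m, SpectralRep (ρ.map Prod.fst) (ker (H m)) (μ m) (φ m))
    {Ω : Type*} [MeasurableSpace Ω] {P : Measure Ω} [IsProbabilityMeasure P]
    {Z : ℕ → Ω → 𝒳 × ℝ} (hlaw : ∀ i, HasLaw (Z i) ρ P) (hind : iIndepFun Z P)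
    {f : PiLp 2 H} (hmod : ModelAssumption ρ f) {D : ℝ} (hD0 : 0 ≤ D)
    (hD : DiagBounded (sumL2 hk (ρ.map Prod.fst) (activeSet f)) D) {Cf : ℝ} (hCf : 0 ≤ Cf)
    (hf : ∀ (l : activeSet f) (t : PiLp 2 (fun l : activeSet f => H l)),
      |⟪restrict f (activeSet f) l, t l⟫_ℝ|
        ≤ Cf * ‖sumL2 hk (ρ.map Prod.fst) (activeSet f) t‖) :
    ∃ K η₀ : ℝ, 0 ≤ K ∧ 0 < η₀ ∧ ∀ n : ℕ, 0 < n → ∀ a b : ℝ, 0 ≤ a → 0 < b →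
      ∀ fhat : Ω → PiLp 2 H, ∀ η, 0 ≤ η → η ≤ η₀ → ∀ m ∉ activeSet f, ∀ v : H m, ‖v‖ ≤ 1 →
      ∀ s, s = ridgeInv (sumL2 hk (ρ.map Prod.fst) (activeSet f)) (weight a b f)
        ((sumL2 hk (ρ.map Prod.fst) (activeSet f)).adjoint (toL2 (hk m) (ρ.map Prod.fst) v)) →
      ∃ Y : Ω → ℝ, (∀ ω, 0 ≤ Y ω) ∧ Integrable Y P ∧ ∫ ω, Y ω ∂P ≤ K * (a + 1 / √n) ∧
        ∀ ω ∈ goodEvent Z n a b f fhat η,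
          |sampleMean (fun i => Z i ω) n (fun p => noise f p * v p.1)
            - sampleMean (fun i => Z i ω) n (fun p => noise f p * partialEval s p.1)
            + ⟪diagOp (weight a b f) (restrict f (activeSet f)), s⟫_ℝ| ≤ a / 2 + η * Y ω := by
  obtain ⟨q, Q, hq, hQ, hw⟩ := exists_weight_bounds f
  obtain ⟨Lb, hL0, hL⟩ := hmod.exists_noise_le
  set ν := ρ.map Prod.fst with hν
  set I := activeSet f with hI
  set J := sumL2 hk ν I with hJ
  set T : ℝ := Lb + √(Fintype.card I) with hT
  have hT0 : 0 ≤ T := by positivity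
  set X : ℝ := 2 * (Fintype.card I * q⁻¹ * (D ^ 2 + 1)) with hX
  have hX0 : 0 ≤ X := by positivity
  set K₀ : ℝ := 2 + Fintype.card I * (Cf + 1 +
        2 * (q⁻¹ * D * (1 + Fintype.card I * (Q + 1) * Cf)) * D) with hK₀
  have hK₀0 : 0 ≤ K₀ := by positivity
  refine ⟨K₀ * (T + 1), (1 + X)⁻¹, by positivity, by positivity, fun n hn a b ha hb fhat η hη0 hη
    m hm v hv s hs => ?_⟩
  have hη1 : η ≤ 1 := hη.trans (inv_le_one_of_one_le₀ (by linarith))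
  have hn0 : (0 : ℝ) < √n := by positivity
  have hsqrt : ∀ u : PiLp 2 (fun l : I => H l), √(∫ x, partialEval u x ^ 2 ∂ν) = ‖J u‖ :=
    fun u => sqrt_integral_sq_eq_norm (coeFn_sumL2 hk ν u)
  have hsqrtv : √(∫ x, v x ^ 2 ∂ν) ≤ 1 := by
    rw [sqrt_integral_sq_eq_norm (coeFn_toL2 (hk m) ν v)]
    exact (norm_toL2_le (hk m) ν v).trans hv
  have hvL : MemLp (fun x => v x) 2 ν := (hk m).memLp ν v
  have hdevi := fun u : PiLp 2 (fun l : I => H l) =>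
    integrable_deviation (I := I) S hk hlaw (memLp_partialEval hk ν u) n
  have hdev : ∀ u : PiLp 2 (fun l : I => H l),
      ∫ ω, deviation H ρ I (fun i => Z i ω) n (partialEval u) ∂P ≤ T / √n * ‖J u‖ := fun u => by
    refine (integral_deviation_le S hk hlaw hind (memLp_partialEval hk ν u) hn).trans ?_
    rw [← hν, hsqrt]
    gcongr
    linarith
  have hnoisei : ∀ u : PiLp 2 (fun l : I => H l), Integrable (fun ω =>
      |sampleMean (fun i => Z i ω) n (fun p => noise f p * partialEval u p.1)|) P := fun u =>
    ((memLp_sampleMean hlaw (memLp_noise_mul hk hL (memLp_partialEval hk ν u)) n).integrable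
      one_le_two).norm
  -- the equation on the active blocks, with the sample covariance still in place
  have hact : ∀ ω ∈ goodEvent Z n a b f fhat η, ∀ u : PiLp 2 (fun l : I => H l),
      |⟪J u, J (restrict (fhat ω - f) I)⟫_ℝ + ⟪u, diagOp (weight a b (fhat ω))
        (restrict f I + restrict (fhat ω - f) I)⟫_ℝ
        - sampleMean (fun i => Z i ω) n (fun p => noise f p * partialEval u p.1)|
        ≤ η * deviation H ρ I (fun i => Z i ω) n (partialEval u) := fun ω hω u => by
    have h1 := stationarity_active ha hω.1 hω.2.1 u
    have h2 := abs_sampleMean_sub_integral_le S hk (memLp_partialEval hk ν u) (fun i => Z i ω) n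
      (restrict (fhat ω - f) I)
    rw [← hν, integral_mul_eq_inner (coeFn_sumL2 hk ν u) (coeFn_sumL2 hk ν _)] at h2
    have h3 : restrict f I + restrict (fhat ω - f) I = restrict (fhat ω) I := by
      rw [restrict_sub]; abel
    have h4 : ‖restrict (fhat ω - f) I‖ ≤ η := (norm_restrict_le _ _).trans hω.2.2.2
    have h5 : deviation H ρ I (fun i => Z i ω) n (partialEval u) * ‖restrict (fhat ω - f) I‖
        ≤ η * deviation H ρ I (fun i => Z i ω) n (partialEval u) := by
      rw [mul_comm]; exact mul_le_mul_of_nonneg_right h4 (norm_nonneg _)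
    rw [h3]
    refine le_trans (le_of_eq ?_) (h2.trans h5)
    rw [abs_sub_comm]
    congr 1
    linarith
  have hvJ : ∀ r : PiLp 2 (fun l : I => H l),
      ∫ x, v x * partialEval r x ∂ν = ⟪J r, toL2 (hk m) ν v⟫_ℝ := fun r => by
    rw [integral_mul_eq_inner (coeFn_toL2 (hk m) ν v) (coeFn_sumL2 hk ν r), real_inner_comm]
  obtain ⟨Y, hY0, hYi, hYint, hY⟩ := exists_residual_dominating (P := P) hD0 hD hCf hf hq hQ
    (show 0 < a + b by linarith) ha (by linarith) (fun l => (hw a b ha hb l).1)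
    (fun l => (hw a b ha hb l).2) (good := goodEvent Z n a b f fhat η)
    (r := fun ω => restrict (fhat ω - f) I) (ah := fun ω => weight a b (fhat ω))
    (N := fun u ω => |sampleMean (fun i => Z i ω) n (fun p => noise f p * partialEval u p.1)|
      + deviation H ρ I (fun i => Z i ω) n (partialEval u)) (τ := T / √n) (by positivity)
    (fun u ω => add_nonneg (abs_nonneg _) (norm_nonneg _))
    (fun u => (hnoisei u).add (hdevi u))
    (fun u => by
      rw [integral_add (hnoisei u) (hdevi u)]
      have h1 := integral_abs_sampleMean_noise_le hk hlaw hind hmod hL0 hL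
        (measurable_partialEval hk u).stronglyMeasurable (memLp_partialEval hk ν u) hn
      have h2 := integral_deviation_le (I := I) S hk hlaw hind (memLp_partialEval hk ν u) hn
      rw [← hν, hsqrt] at h1 h2
      refine (add_le_add h1 h2).trans (le_of_eq ?_)
      rw [hT]; ring)
    (fun ω hω u => by
      have h1 := hact ω hω u
      have h2 : η * deviation H ρ I (fun i => Z i ω) n (partialEval u)
          ≤ deviation H ρ I (fun i => Z i ω) n (partialEval u) :=
        mul_le_of_le_one_left (norm_nonneg _) hη1
      have h4 := abs_sub_abs_le_abs_sub (⟪J u, J (restrict (fhat ω - f) I)⟫_ℝ + ⟪u, diagOp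
        (weight a b (fhat ω)) (restrict f I + restrict (fhat ω - f) I)⟫_ℝ)
        (sampleMean (fun i => Z i ω) n (fun p => noise f p * partialEval u p.1))
      linarith)
    (fun ω hω => ((norm_restrict_le _ _).trans hω.2.2.2).trans hη1) hη0 hη1
    (fun ω hω l => by
      have h1 := hω.2.2.1 l l.2
      have h2 : weight a b (fhat ω) l - weight a b f l = a / 2 * (‖fhat ω l‖⁻¹ - ‖f l‖⁻¹) := by
        simp only [weight]; ring
      rw [h2, abs_mul, abs_of_nonneg (by positivity)]
      have := mul_le_mul_of_nonneg_left h1 (show 0 ≤ a / 2 by positivity)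
      nlinarith)
    (by
      have h1 : η * (1 + X) ≤ 1 := by
        have := mul_le_mul_of_nonneg_right hη (show 0 ≤ 1 + X by positivity)
        rwa [inv_mul_cancel₀ (by positivity)] at this
      have h2 : 2 * (Fintype.card I * η * q⁻¹ * (D ^ 2 + 1)) = η * X := by rw [hX]; ring
      rw [h2]
      linarith)
    ((norm_toL2_le (hk m) ν v).trans hv) hs
    (es := fun ω => sampleMean (fun i => Z i ω) n (fun p => noise f p * partialEval s p.1))
    (ev := fun ω => sampleMean (fun i => Z i ω) n (fun p => noise f p * v p.1))
    (Ds := fun ω => deviation H ρ I (fun i => Z i ω) n (partialEval s))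
    (Dv := fun ω => deviation H ρ I (fun i => Z i ω) n (fun x => v x)) (κ := a / 2)
    (fun ω => norm_nonneg _) (fun ω => norm_nonneg _) (hdevi s)
    (integrable_deviation S hk hlaw hvL n)
    (by
      refine (hdev s).trans (mul_le_of_le_one_right (by positivity) ?_)
      have h1 := norm_map_ridgeInv_adjoint_le J
        (fun l => (mul_pos hq (show 0 < a + b by linarith)).trans_le (hw a b ha hb l).1)
        (toL2 (hk m) ν v)
      rw [← hs] at h1
      exact h1.trans ((norm_toL2_le (hk m) ν v).trans hv))
    (by
      refine (integral_deviation_le S hk hlaw hind hvL hn).trans ?_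
      rw [← hν]
      refine (mul_le_of_le_one_right (by positivity) hsqrtv).trans ?_
      gcongr
      linarith)
    (fun ω hω => hact ω hω s)
    (fun ω hω => by
      have h1 := stationarity_inactive ha hω.1 hω.2.1 hm v
      have h2 := abs_sampleMean_sub_integral_le S hk hvL (fun i => Z i ω) n
        (restrict (fhat ω - f) I)
      rw [← hν, hvJ] at h2
      have h4 : ‖restrict (fhat ω - f) I‖ ≤ η := (norm_restrict_le _ _).trans hω.2.2.2
      have h5 : deviation H ρ I (fun i => Z i ω) n (fun x => v x) * ‖restrict (fhat ω - f) I‖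
          ≤ η * deviation H ρ I (fun i => Z i ω) n (fun x => v x) := by
        rw [mul_comm]; exact mul_le_mul_of_nonneg_right h4 (norm_nonneg _)
      have h6 : a / 2 * ‖v‖ ≤ a / 2 := mul_le_of_le_one_right (by positivity) hv
      rw [abs_le] at h1 h2 ⊢
      constructor <;> linarith [h1.1, h1.2, h2.1, h2.2])
  refine ⟨Y, hY0, hYi, hYint.trans ?_, hY⟩
  refine (mul_le_mul_of_nonneg_left ?_ hK₀0).trans_eq (mul_assoc K₀ _ _).symm
  have h1 : 0 ≤ 1 / √(n : ℝ) := by positivity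
  have h2 : T / √n = T * (1 / √n) := by ring
  rw [h2]
  nlinarith

end Favourable

/-! ### Convergence of the regularization parameters -/

section Markov

variable {Ω : Type*} [MeasurableSpace Ω] {P : Measure Ω} [IsProbabilityMeasure P]

theorem measureReal_le_of_integral_le {Y : Ω → ℝ} (hY0 : ∀ ω, 0 ≤ Y ω) (hYi : Integrable Y P)
    {c ε : ℝ} (hε : 0 < ε) (hY : ∫ ω, Y ω ∂P ≤ c) : P.real {ω | ε ≤ Y ω} ≤ c / ε := by
  rw [le_div_iff₀' hε]
  exact (mul_meas_ge_le_integral_of_nonneg (Eventually.of_forall hY0) hYi ε).trans hY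

/-- On every event of probability more than one half, a nonnegative variable is somewhere below any
positive number that is at least twice its mean. The event need not be measurable. -/
theorem exists_mem_lt_of_integral_le {good : Set Ω} (hgood : P.real goodᶜ < 1 / 2) {Y : Ω → ℝ}
    (hY0 : ∀ ω, 0 ≤ Y ω) (hYi : Integrable Y P) {c ε : ℝ} (hε : 0 < ε) (hY : ∫ ω, Y ω ∂P ≤ c)
    (hcε : 2 * c ≤ ε) : ∃ ω ∈ good, Y ω < ε := by
  by_contra! h
  have h1 : (Set.univ : Set Ω) ⊆ goodᶜ ∪ {ω | ε ≤ Y ω} := fun ω _ => by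
    by_cases hω : ω ∈ good
    · exact Or.inr (h ω hω)
    · exact Or.inl hω
  have h2 := (measureReal_mono (μ := P) h1).trans (measureReal_union_le _ _)
  rw [probReal_univ] at h2
  have h3 := measureReal_le_of_integral_le hY0 hYi hε hY
  have h4 : c / ε ≤ 1 / 2 := by rw [div_le_iff₀ hε]; linarith
  linarith

end Markov

section Parameters

variable {𝒳 : Type*} [MeasurableSpace 𝒳] {M : ℕ} {H : Fin M → Type*}
  [∀ m, NormedAddCommGroup (H m)] [∀ m, InnerProductSpace ℝ (H m)]
  [∀ m, CompleteSpace (H m)] [∀ m, RKHS ℝ (H m) 𝒳 ℝ]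
  {Ω : Type*} [MeasurableSpace Ω] {P : Measure Ω} [IsProbabilityMeasure P]
  {Z : ℕ → Ω → 𝒳 × ℝ} {f : PiLp 2 H} {lam1 lam2 : ℕ → ℝ} {fhat : ℕ → Ω → PiLp 2 H}

/-- Consistency in norm and of the support make the good events asymptotically certain. -/
theorem tendsto_measureReal_compl_goodEvent
    (h_fhat : ∀ n, ∀ᵐ ω ∂P,
      IsMinOn (objective (fun i => Z i ω) n (lam1 n) (lam2 n)) Set.univ (fhat n ω))
    (h_cons : TendstoInMeasure P fhat atTop (fun _ => f))
    (h_supp : Tendsto (fun n => P {ω | activeSet (fhat n ω) ≠ activeSet f}) atTop (𝓝 0))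
    {η : ℝ} (hη : 0 < η) :
    Tendsto (fun n => P.real (goodEvent Z n (lam1 n) (lam2 n) f (fhat n) η)ᶜ) atTop (𝓝 0) := by
  have hnear : ∀ᶠ g in 𝓝 f, (∀ l ∈ activeSet f, |‖g l‖⁻¹ - ‖f l‖⁻¹| ≤ η) ∧ ‖g - f‖ ≤ η := by
    refine Filter.Eventually.and ?_ ?_
    · refine (Filter.eventually_all_finset _).mpr fun l hl => ?_
      have h1 : ContinuousAt (fun g : PiLp 2 H => ‖g l‖⁻¹) f :=
        ((PiLp.continuous_apply 2 H l).norm.continuousAt).inv₀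
          (norm_ne_zero_iff.mpr (mem_activeSet.mp hl))
      have h2 := Metric.continuousAt_iff'.mp h1 η hη
      exact h2.mono fun g hg => hg.le
    · have h2 := Metric.ball_mem_nhds f hη
      filter_upwards [h2] with g hg
      rw [← dist_eq_norm]; exact hg.le
  obtain ⟨δ, hδ, hball⟩ := Metric.eventually_nhds_iff.mp hnear
  have h1 := tendstoInMeasure_iff_norm.mp h_cons δ hδ
  have h2 : Tendsto (fun n => P.real {ω | δ ≤ ‖fhat n ω - f‖}
      + P.real {ω | activeSet (fhat n ω) ≠ activeSet f}) atTop (𝓝 0) := by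
    have := ((ENNReal.tendsto_toReal ENNReal.zero_ne_top).comp h1).add
      ((ENNReal.tendsto_toReal ENNReal.zero_ne_top).comp h_supp)
    simpa [measureReal_def] using this
  refine squeeze_zero (fun n => measureReal_nonneg) (fun n => ?_) h2
  have h3 : P.real {ω | ¬ IsMinOn (objective (fun i => Z i ω) n (lam1 n) (lam2 n)) Set.univ
      (fhat n ω)} = 0 := by
    rw [measureReal_def, ae_iff.mp (h_fhat n), ENNReal.toReal_zero]
  have h4 : (goodEvent Z n (lam1 n) (lam2 n) f (fhat n) η)ᶜ ⊆
      {ω | ¬ IsMinOn (objective (fun i => Z i ω) n (lam1 n) (lam2 n)) Set.univ (fhat n ω)}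
        ∪ ({ω | δ ≤ ‖fhat n ω - f‖} ∪ {ω | activeSet (fhat n ω) ≠ activeSet f}) := fun ω hω => by
    by_contra hc
    simp only [Set.mem_union, Set.mem_ofPred_eq, not_or, not_not, not_le] at hc
    have h5 := hball (y := fhat n ω) (by rw [dist_eq_norm]; exact hc.2.1)
    exact hω ⟨hc.1, hc.2.2, h5⟩
  refine (measureReal_mono h4).trans ((measureReal_union_le _ _).trans ?_)
  rw [h3, zero_add]
  exact measureReal_union_le _ _

theorem abs_partialEval_le (hk : ∀ m, KernelAssumption (H m)) {I : Finset (Fin M)}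
    (h : PiLp 2 (fun l : I => H l)) (x : 𝒳) : |partialEval h x| ≤ √(Fintype.card I) * ‖h‖ := by
  rw [← inner_feature]
  exact (abs_real_inner_le_norm _ _).trans
    (mul_le_mul_of_nonneg_right (norm_feature_le hk I x) (norm_nonneg _))

theorem abs_sampleMean_le {𝒵 : Type*} {w : 𝒵 → ℝ} {B : ℝ} (hB : 0 ≤ B) (hw : ∀ p, |w p| ≤ B)
    (z : ℕ → 𝒵) (n : ℕ) : |sampleMean z n w| ≤ B := by
  rw [sampleMean, smul_eq_mul, abs_mul, abs_of_nonneg (by positivity : (0 : ℝ) ≤ (n : ℝ)⁻¹)]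
  have h1 : |∑ i ∈ Finset.range n, w (z i)| ≤ n * B :=
    (Finset.abs_sum_le_sum_abs _ _).trans
      ((Finset.sum_le_sum fun i _ => hw (z i)).trans (by simp))
  refine (mul_le_mul_of_nonneg_left h1 (by positivity)).trans ?_
  rcases Nat.eq_zero_or_pos n with rfl | hn
  · simpa using hB
  · rw [inv_mul_cancel_left₀ (by positivity)]

/-- On the good event, the stationarity equation in the direction of an active block of `f` bounds
the weight of that block, hence both regularization parameters. -/
theorem weight_mul_norm_sq_le {n : ℕ} {a b η : ℝ} (hk : ∀ m, KernelAssumption (H m))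
    (ha : 0 ≤ a) (hb : 0 < b) (hη0 : 0 ≤ η) {fh : Ω → PiLp 2 H} {ω : Ω}
    (hω : ω ∈ goodEvent Z n a b f fh η) (l : activeSet f) (hl : 2 * η ≤ ‖f l‖) :
    (b + a / 2 * (2 * ‖f l‖)⁻¹) * ‖f l‖ ^ 2 / 2 ≤ Fintype.card (activeSet f) * ‖f‖ * η
      + |sampleMean (fun i => Z i ω) n
          (fun p => noise f p * partialEval (block l (restrict f (activeSet f))) p.1)| := by
  set u := block l (restrict f (activeSet f)) with hu
  have hfl : 0 < ‖f l‖ := norm_pos_iff.mpr (mem_activeSet.mp l.2)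
  have h1 := stationarity_active ha hω.1 hω.2.1 u
  have h2 : |sampleMean (fun i => Z i ω) n
      (fun p => partialEval u p.1 * partialEval (restrict (fh ω - f) (activeSet f)) p.1)|
      ≤ Fintype.card (activeSet f) * ‖f‖ * η := by
    refine abs_sampleMean_le (by positivity) (fun p => ?_) _ _
    rw [abs_mul]
    have e1 := abs_partialEval_le hk u p.1
    have e2 := abs_partialEval_le hk (restrict (fh ω - f) (activeSet f)) p.1
    have e3 : ‖u‖ ≤ ‖f‖ := (norm_block_le _ _).trans (norm_restrict_le _ _)
    have e4 : ‖restrict (fh ω - f) (activeSet f)‖ ≤ η := (norm_restrict_le _ _).trans hω.2.2.2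
    have e5 : √(Fintype.card (activeSet f) : ℝ) * √(Fintype.card (activeSet f) : ℝ)
        = Fintype.card (activeSet f) := Real.mul_self_sqrt (by positivity)
    calc |partialEval u p.1| * |partialEval (restrict (fh ω - f) (activeSet f)) p.1|
        ≤ (√(Fintype.card (activeSet f)) * ‖f‖) * (√(Fintype.card (activeSet f)) * η) := by
          refine mul_le_mul (e1.trans ?_) (e2.trans ?_) (abs_nonneg _) (by positivity) <;> gcongr
      _ = (√(Fintype.card (activeSet f) : ℝ) * √(Fintype.card (activeSet f) : ℝ)) * ‖f‖ * η := by
          ring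
      _ = _ := by rw [e5]
  have hd : ‖fh ω l - f l‖ ≤ η := (PiLp.norm_apply_le (fh ω - f) l).trans hω.2.2.2
  have h3 : ⟪u, diagOp (weight a b (fh ω)) (restrict (fh ω) (activeSet f))⟫_ℝ
      = weight a b (fh ω) l * ⟪f l, fh ω l⟫_ℝ := by
    rw [real_inner_comm, hu, inner_block, diagOp_apply, restrict_apply, restrict_apply,
      inner_smul_left, real_inner_comm]
    simp
  have h4 : ‖f l‖ ^ 2 / 2 ≤ ⟪f l, fh ω l⟫_ℝ := by
    have e1 : ⟪f l, fh ω l⟫_ℝ = ‖f l‖ ^ 2 + ⟪f l, fh ω l - f l⟫_ℝ := by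
      rw [inner_sub_right, real_inner_self_eq_norm_sq]; ring
    have e2 := (abs_le.mp (abs_real_inner_le_norm (f l) (fh ω l - f l))).1
    nlinarith
  have h5 : b + a / 2 * (2 * ‖f l‖)⁻¹ ≤ weight a b (fh ω) l := by
    rw [weight]
    have e1 : ‖fh ω l‖ ≤ 2 * ‖f l‖ := by
      have := norm_le_norm_add_norm_sub' (fh ω l) (f l)
      linarith
    have e2 : 0 < ‖fh ω l‖ := by
      have := norm_sub_norm_le (f l) (fh ω l)
      rw [norm_sub_rev] at this
      linarith
    gcongr
  rw [h3] at h1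
  have h6 : 0 ≤ b + a / 2 * (2 * ‖f l‖)⁻¹ := by positivity
  have h7 := mul_le_mul h5 h4 (by positivity) (h6.trans h5)
  have h8 := neg_abs_le (sampleMean (fun i => Z i ω) n
      (fun p => partialEval u p.1 * partialEval (restrict (fh ω - f) (activeSet f)) p.1))
  have h9 := le_abs_self (sampleMean (fun i => Z i ω) n
      (fun p => noise f p * partialEval u p.1))
  linarith

/-- If some block is active, consistency forces the regularization parameters to vanish. -/
theorem tendsto_parameters {ρ : Measure (𝒳 × ℝ)} [IsProbabilityMeasure ρ]
    (hk : ∀ m, KernelAssumption (H m)) (hlaw : ∀ i, HasLaw (Z i) ρ P) (hind : iIndepFun Z P)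
    (hmod : ModelAssumption ρ f) (h_lam1 : ∀ n, 0 ≤ lam1 n) (h_lam2 : ∀ n, 0 < lam2 n)
    (hgood : ∀ η > 0, Tendsto
      (fun n => P.real (goodEvent Z n (lam1 n) (lam2 n) f (fhat n) η)ᶜ) atTop (𝓝 0))
    (hne : (activeSet f).Nonempty) :
    Tendsto lam1 atTop (𝓝 0) ∧ Tendsto lam2 atTop (𝓝 0) := by
  obtain ⟨m, hm⟩ := hne
  set l : activeSet f := ⟨m, hm⟩ with hl
  have hfl : 0 < ‖f l‖ := norm_pos_iff.mpr (mem_activeSet.mp l.2)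
  obtain ⟨Lb, hL0, hL⟩ := hmod.exists_noise_le
  set u := block l (restrict f (activeSet f)) with hu
  set W : ℝ := √(∫ x, partialEval u x ^ 2 ∂(ρ.map Prod.fst)) with hW
  have key : ∀ ε > 0, ∀ᶠ n in atTop,
      (lam2 n + lam1 n / 2 * (2 * ‖f l‖)⁻¹) * ‖f l‖ ^ 2 / 2 < ε := fun ε hε => by
    obtain ⟨η, hη0, hη1, hη2⟩ : ∃ η : ℝ, 0 < η ∧ 2 * η ≤ ‖f l‖ ∧
        Fintype.card (activeSet f) * ‖f‖ * η ≤ ε / 2 := by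
      have hX : (0 : ℝ) ≤ Fintype.card (activeSet f) * ‖f‖ := by positivity
      refine ⟨min (‖f l‖ / 2) (ε / 2 / (Fintype.card (activeSet f) * ‖f‖ + 1)),
        by positivity, ?_, ?_⟩
      · linarith [min_le_left (‖f l‖ / 2) (ε / 2 / (Fintype.card (activeSet f) * ‖f‖ + 1))]
      · refine (mul_le_mul_of_nonneg_left (min_le_right _ _) hX).trans ?_
        rw [mul_div_assoc', div_le_iff₀ (by positivity)]
        nlinarith
    have h1 : Tendsto (fun n : ℕ => Lb / √(n : ℝ) * W) atTop (𝓝 0) := by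
      have h2 : Tendsto (fun n : ℕ => √(n : ℝ)) atTop atTop :=
        Real.tendsto_sqrt_atTop.comp tendsto_natCast_atTop_atTop
      simpa using (h2.const_div_atTop Lb).mul_const W
    filter_upwards [h1.eventually (gt_mem_nhds (show (0 : ℝ) < ε / 4 by positivity)),
      (hgood η hη0).eventually (gt_mem_nhds (show (0 : ℝ) < 1 / 2 by norm_num)),
      eventually_gt_atTop 0] with n hn1 hn2 hn0
    have h3 := integral_abs_sampleMean_noise_le hk hlaw hind hmod hL0 hL
      (measurable_partialEval hk u).stronglyMeasurable
      (memLp_partialEval hk (ρ.map Prod.fst) u) hn0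
    obtain ⟨ω, hω, hlt⟩ := exists_mem_lt_of_integral_le hn2 (fun ω => abs_nonneg _)
      ((memLp_sampleMean hlaw (memLp_noise_mul hk hL
        (memLp_partialEval hk (ρ.map Prod.fst) u)) n).integrable one_le_two).norm
      (show (0 : ℝ) < ε / 2 by positivity) h3 (by rw [← hW]; linarith)
    have h4 := weight_mul_norm_sq_le hk (h_lam1 n) (h_lam2 n) hη0.le hω l hη1
    linarith
  constructor
  · refine Metric.tendsto_atTop'.mpr fun ε hε => ?_
    obtain ⟨N, hN⟩ := eventually_atTop.mp (key (ε * ‖f l‖ / 8) (by positivity))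
    refine ⟨N, fun n hn => ?_⟩
    have h1 := hN n hn.le
    have h2 : 0 < lam2 n * ‖f l‖ ^ 2 := mul_pos (h_lam2 n) (by positivity)
    have h3 : (lam2 n + lam1 n / 2 * (2 * ‖f l‖)⁻¹) * ‖f l‖ ^ 2 / 2
        = lam2 n * ‖f l‖ ^ 2 / 2 + lam1 n * ‖f l‖ / 8 := by field_simp; ring
    rw [Real.dist_eq, sub_zero, abs_of_nonneg (h_lam1 n)]
    rw [h3] at h1
    have h4 : lam1 n * ‖f l‖ < ε * ‖f l‖ := by linarith
    exact lt_of_mul_lt_mul_right h4 hfl.le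
  · refine Metric.tendsto_atTop'.mpr fun ε hε => ?_
    obtain ⟨N, hN⟩ := eventually_atTop.mp (key (ε * ‖f l‖ ^ 2 / 2) (by positivity))
    refine ⟨N, fun n hn => ?_⟩
    have h1 := hN n hn.le
    have h2 : 0 ≤ lam1 n / 2 * (2 * ‖f l‖)⁻¹ * ‖f l‖ ^ 2 :=
      mul_nonneg (mul_nonneg (by linarith [h_lam1 n]) (by positivity)) (by positivity)
    rw [Real.dist_eq, sub_zero, abs_of_pos (h_lam2 n)]
    have h4 : lam2 n * ‖f l‖ ^ 2 < ε * ‖f l‖ ^ 2 := by nlinarith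
    exact lt_of_mul_lt_mul_right h4 (by positivity)

end Parameters

/-! ### The rate of the first regularization parameter -/

section Rate

variable {𝒳 : Type*} [MeasurableSpace 𝒳] {M : ℕ} {H : Fin M → Type*}
  [∀ m, NormedAddCommGroup (H m)] [∀ m, InnerProductSpace ℝ (H m)]
  [∀ m, CompleteSpace (H m)] [∀ m, RKHS ℝ (H m) 𝒳 ℝ]
  {Ω : Type*} [MeasurableSpace Ω] {P : Measure Ω} [IsProbabilityMeasure P]
  {Z : ℕ → Ω → 𝒳 × ℝ} {f : PiLp 2 H} {lam1 lam2 : ℕ → ℝ} {fhat : ℕ → Ω → PiLp 2 H}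
  {ρ : Measure (𝒳 × ℝ)} [IsProbabilityMeasure ρ]

theorem weight_pos {a b : ℝ} (ha : 0 ≤ a) (hb : 0 < b) (f : PiLp 2 H) {I : Finset (Fin M)}
    (l : I) : 0 < weight a b f l := by
  rw [weight]; positivity

/-- The noise in a fixed direction is of order `1 / √n`, with a constant proportional to the `L²`
norm of the direction. -/
theorem integral_sqrt_mul_abs_sampleMean_noise_le (hk : ∀ m, KernelAssumption (H m))
    (hlaw : ∀ i, HasLaw (Z i) ρ P) (hind : iIndepFun Z P) (hmod : ModelAssumption ρ f) {L : ℝ}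
    (hL0 : 0 ≤ L) (hL : ∀ᵐ z ∂ρ, |noise f z| ≤ L) {g : 𝒳 → ℝ} (hgm : StronglyMeasurable g)
    (hg : MemLp g 2 (ρ.map Prod.fst)) {G : Lp ℝ 2 (ρ.map Prod.fst)} (hG : G =ᵐ[ρ.map Prod.fst] g)
    {n : ℕ} (hn : 0 < n) :
    Integrable (fun ω => √n * |sampleMean (fun i => Z i ω) n (fun p => noise f p * g p.1)|) P ∧
    ∫ ω, √n * |sampleMean (fun i => Z i ω) n (fun p => noise f p * g p.1)| ∂P ≤ L * ‖G‖ := by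
  refine ⟨(((memLp_sampleMean hlaw (memLp_noise_mul hk hL hg) n).integrable
    one_le_two).norm).const_mul _, ?_⟩
  have h1 := integral_abs_sampleMean_noise_le hk hlaw hind hmod hL0 hL hgm hg hn
  rw [sqrt_integral_sq_eq_norm hG] at h1
  rw [integral_const_mul]
  have hn0 : (0 : ℝ) < √n := by positivity
  calc √n * ∫ ω, |sampleMean (fun i => Z i ω) n (fun p => noise f p * g p.1)| ∂P
      ≤ √n * (L / √n * ‖G‖) := mul_le_mul_of_nonneg_left h1 hn0.le
    _ = L * ‖G‖ := by field_simp

/-- The deterministic consequence of `exists_noise_residual_dominating`: the noise is of order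
`1 / √n` at some point of the good event, which bounds the bias `⟪Diag(w) f, s⟫`. -/
theorem exists_sqrt_mul_abs_bias_le {hk : ∀ m, KernelAssumption (H m)} {μ : Fin M → ℕ → ℝ}
    {φ : Fin M → ℕ → 𝒳 → ℝ} (S : ∀ m, SpectralRep (ρ.map Prod.fst) (ker (H m)) (μ m) (φ m))
    (hlaw : ∀ i, HasLaw (Z i) ρ P) (hind : iIndepFun Z P) (hmod : ModelAssumption ρ f)
    {D : ℝ} (hD0 : 0 ≤ D) (hD : DiagBounded (sumL2 hk (ρ.map Prod.fst) (activeSet f)) D)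
    {Cf : ℝ} (hCf : 0 ≤ Cf)
    (hf : ∀ (l : activeSet f) (t : PiLp 2 (fun l : activeSet f => H l)),
      |⟪restrict f (activeSet f) l, t l⟫_ℝ|
        ≤ Cf * ‖sumL2 hk (ρ.map Prod.fst) (activeSet f) t‖) :
    ∃ K η₀ : ℝ, 0 ≤ K ∧ 0 < η₀ ∧ ∀ n : ℕ, 0 < n → ∀ a b : ℝ, 0 ≤ a → 0 < b →
      ∀ fhat : Ω → PiLp 2 H, ∀ η, 0 ≤ η → η ≤ η₀ → P.real (goodEvent Z n a b f fhat η)ᶜ < 1 / 2 →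
      ∀ m ∉ activeSet f, ∀ v : H m, ‖v‖ ≤ 1 →
      √n * |⟪diagOp (weight a b f) (restrict f (activeSet f)),
        ridgeInv (sumL2 hk (ρ.map Prod.fst) (activeSet f)) (weight a b f)
          ((sumL2 hk (ρ.map Prod.fst) (activeSet f)).adjoint
            (toL2 (hk m) (ρ.map Prod.fst) v))⟫_ℝ|
        ≤ a * √n / 2 + K * (1 + η * (a * √n + 1)) := by
  obtain ⟨Lb, hL0, hL⟩ := hmod.exists_noise_le
  obtain ⟨K₀, η₀, hK₀, hη₀, hres⟩ :=
    exists_noise_residual_dominating (hk := hk) S hlaw hind hmod hD0 hD hCf hf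
  refine ⟨4 * Lb + 1 + 2 * K₀, η₀, by positivity, hη₀, fun n hn a b ha hb fhat η hη0 hη hgood m hm
    v hv => ?_⟩
  set ν := ρ.map Prod.fst with hν
  set J := sumL2 hk ν (activeSet f) with hJ
  set s := ridgeInv J (weight a b f) (J.adjoint (toL2 (hk m) ν v)) with hs
  obtain ⟨Y, hY0, hYi, hYint, hY⟩ := hres n hn a b ha hb fhat η hη0 hη m hm v hv s hs
  obtain ⟨hi1, hint1⟩ := integral_sqrt_mul_abs_sampleMean_noise_le hk hlaw hind hmod hL0 hL
    ((hk m).measurable v).stronglyMeasurable ((hk m).memLp ν v) (coeFn_toL2 (hk m) ν v) hn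
  obtain ⟨hi2, hint2⟩ := integral_sqrt_mul_abs_sampleMean_noise_le hk hlaw hind hmod hL0 hL
    (measurable_partialEval hk s).stronglyMeasurable (memLp_partialEval hk ν s)
    (coeFn_sumL2 hk ν s) hn
  have hn0 : (0 : ℝ) < √n := by positivity
  have hi12 : Integrable (fun ω =>
      √n * |sampleMean (fun i => Z i ω) n (fun p => noise f p * v p.1)|
      + √n * |sampleMean (fun i => Z i ω) n (fun p => noise f p * partialEval s p.1)|) P :=
    hi1.add hi2
  have hYi' : Integrable (fun ω => √n * η * Y ω) P := hYi.const_mul _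
  have hy1 : ‖toL2 (hk m) ν v‖ ≤ 1 := (norm_toL2_le (hk m) ν v).trans hv
  have hJs : ‖J s‖ ≤ 1 :=
    (norm_map_ridgeInv_adjoint_le J (fun l => weight_pos ha hb f l) _).trans hy1
  obtain ⟨ω, hω, hlt⟩ := exists_mem_lt_of_integral_le hgood
    (Y := fun ω => (√n * |sampleMean (fun i => Z i ω) n (fun p => noise f p * v p.1)|
      + √n * |sampleMean (fun i => Z i ω) n (fun p => noise f p * partialEval s p.1)|)
      + √n * η * Y ω)
    (fun ω => add_nonneg (by positivity) (mul_nonneg (by positivity) (hY0 ω)))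
    (hi12.add hYi') (c := 2 * Lb + η * (K₀ * (a * √n + 1)))
    (ε := 2 * (2 * Lb + η * (K₀ * (a * √n + 1))) + 1) (by positivity)
    (by
      rw [integral_add hi12 hYi', integral_add hi1 hi2, integral_const_mul (√n * η) Y]
      have e1 : Lb * ‖toL2 (hk m) ν v‖ ≤ Lb := mul_le_of_le_one_right hL0 hy1
      have e2 : Lb * ‖sumL2 hk ν (activeSet f) s‖ ≤ Lb := mul_le_of_le_one_right hL0 hJs
      have e3 := mul_le_mul_of_nonneg_left hYint (show 0 ≤ √n * η by positivity)
      have e4 : √n * η * (K₀ * (a + 1 / √n)) = η * (K₀ * (a * √n + 1)) := by field_simp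
      linarith)
    (by linarith)
  have h1 := mul_le_mul_of_nonneg_left (hY ω hω) hn0.le
  have h2 := abs_sub_abs_le_abs_sub ⟪diagOp (weight a b f) (restrict f (activeSet f)), s⟫_ℝ
    (-(sampleMean (fun i => Z i ω) n (fun p => noise f p * v p.1)
      - sampleMean (fun i => Z i ω) n (fun p => noise f p * partialEval s p.1)))
  rw [sub_neg_eq_add, abs_neg, add_comm ⟪diagOp (weight a b f) _, s⟫_ℝ] at h2
  have h3 := abs_sub (sampleMean (fun i => Z i ω) n (fun p => noise f p * v p.1))
    (sampleMean (fun i => Z i ω) n (fun p => noise f p * partialEval s p.1))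
  have h4 := mul_le_mul_of_nonneg_left (h2.trans' (sub_le_sub_left h3 _)) hn0.le
  have h5 : 0 ≤ η * (a * √n + 1) * (4 * Lb + 1) + 2 * K₀ := by positivity
  nlinarith

set_option maxHeartbeats 1000000 in
/-- If `λ₁ √n` were bounded along a subsequence, the noise in the direction of the
residual of an inactive block would be bounded at the scale `1 / √n`, with probability
arbitrarily close to one. The residuals converge to a nonzero limit, so this contradicts the
central limit theorem. -/
theorem tendsto_lam_mul_sqrt {hk : ∀ m, KernelAssumption (H m)} {μ : Fin M → ℕ → ℝ}
    {φ : Fin M → ℕ → 𝒳 → ℝ} (S : ∀ m, SpectralRep (ρ.map Prod.fst) (ker (H m)) (μ m) (φ m))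
    (hlaw : ∀ i, HasLaw (Z i) ρ P) (hind : iIndepFun Z P) (hmod : ModelAssumption ρ f)
    (h_lam1 : ∀ n, 0 ≤ lam1 n) (h_lam2 : ∀ n, 0 < lam2 n)
    (hpar : (activeSet f).Nonempty → Tendsto lam1 atTop (𝓝 0) ∧ Tendsto lam2 atTop (𝓝 0))
    (hgood : ∀ η > 0, Tendsto
      (fun n => P.real (goodEvent Z n (lam1 n) (lam2 n) f (fhat n) η)ᶜ) atTop (𝓝 0))
    {D : ℝ} (hD0 : 0 ≤ D) (hD : DiagBounded (sumL2 hk (ρ.map Prod.fst) (activeSet f)) D)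
    (hsep : ∀ m ∉ activeSet f, ∀ (v : H m) (t : PiLp 2 (fun l : activeSet f => H l)),
      ‖toL2 (hk m) (ρ.map Prod.fst) v‖
        ≤ D * ‖toL2 (hk m) (ρ.map Prod.fst) v - sumL2 hk (ρ.map Prod.fst) (activeSet f) t‖)
    {Cf : ℝ} (hCf : 0 ≤ Cf)
    (hf : ∀ (l : activeSet f) (t : PiLp 2 (fun l : activeSet f => H l)),
      |⟪restrict f (activeSet f) l, t l⟫_ℝ|
        ≤ Cf * ‖sumL2 hk (ρ.map Prod.fst) (activeSet f) t‖)
    {m : Fin M} (hm : m ∉ activeSet f) [Nontrivial (H m)] :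
    Tendsto (fun n => lam1 n * √(n : ℝ)) atTop atTop := by
  rw [tendsto_atTop]
  by_contra! hcon
  obtain ⟨K, hK⟩ := hcon
  have hK0 : 0 < K := by
    obtain ⟨n, hn⟩ := hK.exists
    exact (mul_nonneg (h_lam1 n) (Real.sqrt_nonneg _)).trans_lt hn
  obtain ⟨Lb, hL0, hL⟩ := hmod.exists_noise_le
  obtain ⟨K₀, η₀, hK₀, hη₀, hres⟩ :=
    exists_noise_residual_dominating (hk := hk) S hlaw hind hmod hD0 hD hCf hf
  obtain ⟨K₁, η₁, hK₁, hη₁, hbias₀⟩ :=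
    exists_sqrt_mul_abs_bias_le (hk := hk) S hlaw hind hmod hD0 hD hCf hf
  set ν := ρ.map Prod.fst with hν
  set J := sumL2 hk ν (activeSet f) with hJ
  obtain ⟨v, hv⟩ : ∃ v : H m, ‖v‖ = 1 := exists_norm_eq (H m) zero_le_one
  set y := toL2 (hk m) ν v with hy
  have hy1 : ‖y‖ ≤ 1 := (norm_toL2_le (hk m) ν v).trans hv.le
  have hvL : MemLp (fun x => v x) 2 ν := (hk m).memLp ν v
  have hvm : StronglyMeasurable (fun x => v x) := ((hk m).measurable v).stronglyMeasurable
  set s := fun n => ridgeInv J (weight (lam1 n) (lam2 n) f) (J.adjoint y) with hs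
  obtain ⟨p, hp, hsp⟩ := tendsto_map_ridgeInv_adjoint J
    (a := fun n => weight (lam1 n) (lam2 n) f) (fun n l => weight_pos (h_lam1 n) (h_lam2 n) f l)
    (fun l => by
      obtain ⟨h1, h2⟩ := hpar ⟨l, l.2⟩
      have := h2.add ((h1.div_const 2).mul_const ‖f l‖⁻¹)
      simpa [weight] using this) y
  -- the limit of the residuals
  have hyp : y - p ≠ 0 := fun h0 => by
    have h1 : Set.range J ⊆ {w | ‖y‖ ≤ D * ‖y - w‖} := by
      rintro _ ⟨t, rfl⟩
      exact hsep m hm v t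
    have h2 : IsClosed {w | ‖y‖ ≤ D * ‖y - w‖} :=
      isClosed_le continuous_const (by fun_prop)
    have h3 : ‖y‖ ≤ D * ‖y - p‖ := closure_minimal h1 h2 hp
    rw [h0, norm_zero, mul_zero] at h3
    have h4 : v = 0 := (S m).toL2_injective (hk m) (by rw [map_zero]; exact norm_le_zero_iff.mp h3)
    rw [h4, norm_zero] at hv
    exact zero_ne_one hv
  set g : 𝒳 → ℝ := ⇑(y - p) with hg
  have hgm : StronglyMeasurable g := Lp.stronglyMeasurable _
  have hgL : MemLp g 2 ν := Lp.memLp _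
  have hg2 : 0 < ∫ x, g x ^ 2 ∂ν := by
    rw [← Real.sqrt_pos, sqrt_integral_sq_eq_norm (F := y - p) EventuallyEq.rfl]
    exact norm_pos_iff.mpr hyp
  -- the deterministic bias is of order `1 / √n` along the subsequence
  set B : ℝ := K₀ * (K + 1) with hB
  set c : ℕ → ℝ := fun n =>
    ⟪diagOp (weight (lam1 n) (lam2 n) f) (restrict f (activeSet f)), s n⟫_ℝ with hc
  have hJs : ∀ n, ‖J (s n)‖ ≤ 1 := fun n =>
    (norm_map_ridgeInv_adjoint_le J (fun l => weight_pos (h_lam1 n) (h_lam2 n) f l) y).trans hy1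
  have hresn : ∀ n : ℕ, 0 < n → lam1 n * √n < K → ∀ η, 0 < η → η ≤ η₀ → ∃ Y : Ω → ℝ,
      (∀ ω, 0 ≤ Y ω) ∧ Integrable Y P ∧ ∫ ω, Y ω ∂P ≤ B ∧
      ∀ ω ∈ goodEvent Z n (lam1 n) (lam2 n) f (fhat n) η,
        |√n * (sampleMean (fun i => Z i ω) n (fun p => noise f p * v p.1)
          - sampleMean (fun i => Z i ω) n (fun p => noise f p * partialEval (s n) p.1))
          + √n * c n| ≤ K / 2 + η * Y ω := fun n hn hlt η hη hηle => by
    obtain ⟨Y, hY0, hYi, hYint, hY⟩ := hres n hn (lam1 n) (lam2 n) (h_lam1 n) (h_lam2 n) (fhat n)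
      η hη.le hηle m hm v hv.le (s n) rfl
    have hn0 : (0 : ℝ) < √n := by positivity
    refine ⟨fun ω => √n * Y ω, fun ω => mul_nonneg hn0.le (hY0 ω), hYi.const_mul _, ?_,
      fun ω hω => ?_⟩
    · rw [integral_const_mul]
      refine (mul_le_mul_of_nonneg_left hYint hn0.le).trans ?_
      have e : √n * (K₀ * (lam1 n + 1 / √n)) = K₀ * (lam1 n * √n + 1) := by field_simp
      rw [e]
      exact mul_le_mul_of_nonneg_left (by linarith) hK₀
    · rw [← mul_add, abs_mul, abs_of_pos hn0]
      refine (mul_le_mul_of_nonneg_left (hY ω hω) hn0.le).trans ?_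
      nlinarith
  have hB0 : 0 ≤ B := by positivity
  set R₁ : ℝ := K / 2 + K₁ * (1 + η₁ * (K + 1)) with hR₁
  have hbias : ∀ᶠ n : ℕ in atTop, lam1 n * √n < K → |√n * c n| ≤ R₁ := by
    filter_upwards [eventually_gt_atTop 0,
      (hgood η₁ hη₁).eventually (gt_mem_nhds (show (0 : ℝ) < 1 / 2 by norm_num))] with n hn hn2 hlt
    have h1 := hbias₀ n hn (lam1 n) (lam2 n) (h_lam1 n) (h_lam2 n) (fhat n) η₁ hη₁.le le_rfl hn2
      m hm v hv.le
    rw [abs_mul, abs_of_nonneg (Real.sqrt_nonneg _)]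
    refine h1.trans ?_
    rw [hR₁]
    gcongr
  -- non-concentration on the resulting interval
  set R : ℝ := R₁ + K / 2 + 2 with hR
  obtain ⟨γ, hγ1, hγ⟩ := exists_measure_abs_sum_le (P := P) (ρ := ρ) (Z := Z)
    (g := fun z => noise f z * g z.1) hlaw hind
    ((measurable_noise hk f).mul (hgm.measurable.comp measurable_fst)).stronglyMeasurable
    (memLp_noise_mul hk hL hgL) (hmod.integral_noise_mul hk hgm hgL)
    (hmod.integral_noise_mul_sq_pos hk hgm hgL hg2) R
  have hγ' : γ.toReal < 1 := by
    rw [← ENNReal.toReal_one]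
    exact (ENNReal.toReal_lt_toReal hγ1.ne_top ENNReal.one_ne_top).mpr hγ1
  set δ : ℝ := (1 - γ.toReal) / 3 with hδ
  have hδ0 : 0 < δ := by rw [hδ]; linarith
  obtain ⟨η, hη0, hηle, hηB⟩ : ∃ η : ℝ, 0 < η ∧ η ≤ η₀ ∧ B * η ≤ δ := by
    refine ⟨min η₀ (δ / (B + 1)), by positivity, min_le_left _ _, ?_⟩
    refine (mul_le_mul_of_nonneg_left (min_le_right _ _) hB0).trans ?_
    rw [mul_div_assoc', div_le_iff₀ (by positivity)]
    nlinarith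
  have hdist : Tendsto (fun n => Lb * ‖J (s n) - p‖) atTop (𝓝 0) := by
    simpa using (tendsto_iff_norm_sub_tendsto_zero.mp hsp).const_mul Lb
  obtain ⟨n, hlt, hn, hbn, hγn, hgn, hdn⟩ := (hK.and_eventually ((eventually_gt_atTop 0).and
    (hbias.and (hγ.and (((hgood η hη0).eventually (gt_mem_nhds hδ0)).and
      (hdist.eventually (gt_mem_nhds hδ0))))))).exists
  obtain ⟨Y, hY0, hYi, hYint, hY⟩ := hresn n hn hlt η hη0 hηle
  set d : 𝒳 → ℝ := fun x => g x - (v x - partialEval (s n) x) with hd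
  have hdm : StronglyMeasurable d :=
    hgm.sub (hvm.sub (measurable_partialEval hk (s n)).stronglyMeasurable)
  have hdL : MemLp d 2 ν := hgL.sub (hvL.sub (memLp_partialEval hk ν (s n)))
  have hdae : (J (s n) - p : Lp ℝ 2 ν) =ᵐ[ν] d := by
    filter_upwards [Lp.coeFn_sub (J (s n)) p, Lp.coeFn_sub y p, coeFn_sumL2 hk ν (s n),
      coeFn_toL2 (hk m) ν v] with x h1 h2 h3 h4
    rw [h1, hd, hg]
    simp only
    rw [h2, Pi.sub_apply, Pi.sub_apply, h3, h4]
    ring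
  obtain ⟨hi3, hint3⟩ := integral_sqrt_mul_abs_sampleMean_noise_le hk hlaw hind hmod hL0 hL hdm
    hdL hdae hn
  have hn0 : (0 : ℝ) < √n := by positivity
  have hP1 : P.real {ω | 1 / η ≤ Y ω} ≤ B * η := by
    have := measureReal_le_of_integral_le hY0 hYi (show 0 < 1 / η by positivity) hYint
    rwa [div_div_eq_mul_div, div_one] at this
  have hP2 := measureReal_le_of_integral_le (fun ω => by positivity) hi3 one_pos hint3
  rw [div_one] at hP2
  have hP3 : P.real {ω | |√n * sampleMean (fun i => Z i ω) n (fun z => noise f z * g z.1)| ≤ R}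
      < γ.toReal :=
    (ENNReal.toReal_lt_toReal (measure_ne_top _ _) hγ1.ne_top).mpr hγn
  have hcover : (Set.univ : Set Ω) ⊆ (goodEvent Z n (lam1 n) (lam2 n) f (fhat n) η)ᶜ ∪
      ({ω | 1 / η ≤ Y ω} ∪
        ({ω | 1 ≤ √n * |sampleMean (fun i => Z i ω) n (fun p => noise f p * d p.1)|} ∪
        {ω | |√n * sampleMean (fun i => Z i ω) n (fun z => noise f z * g z.1)| ≤ R})) := by
    intro ω _
    by_contra hω
    simp only [Set.mem_union, Set.mem_compl_iff, Set.mem_ofPred_eq, not_or, not_not, not_le] at hω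
    obtain ⟨h1, h2, h3, h4⟩ := hω
    have h5 := hY ω h1
    have h6 : η * Y ω < 1 := by
      rw [lt_div_iff₀ hη0] at h2; linarith
    have h7 := hbn hlt
    have h8 : sampleMean (fun i => Z i ω) n (fun z => noise f z * g z.1)
        = (sampleMean (fun i => Z i ω) n (fun p => noise f p * v p.1)
          - sampleMean (fun i => Z i ω) n (fun p => noise f p * partialEval (s n) p.1))
          + sampleMean (fun i => Z i ω) n (fun p => noise f p * d p.1) := by
      rw [← sampleMean_sub, ← sampleMean_add]
      congr 1
      funext z
      simp only [hd]
      ring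
    refine h4.not_ge ?_
    rw [h8, mul_add]
    rw [← abs_of_pos hn0, ← abs_mul] at h3
    rw [abs_le] at h5 h7 ⊢
    rw [abs_lt] at h3
    constructor <;> linarith [h5.1, h5.2, h7.1, h7.2, h3.1, h3.2]
  have h1 := (measureReal_mono (μ := P) hcover).trans (measureReal_union_le _ _)
  have h2 := measureReal_union_le (μ := P) {ω | 1 / η ≤ Y ω}
    ({ω | 1 ≤ √n * |sampleMean (fun i => Z i ω) n (fun p => noise f p * d p.1)|} ∪
        {ω | |√n * sampleMean (fun i => Z i ω) n (fun z => noise f z * g z.1)| ≤ R})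
  have h3 := measureReal_union_le (μ := P)
    {ω | 1 ≤ √n * |sampleMean (fun i => Z i ω) n (fun p => noise f p * d p.1)|}
    {ω | |√n * sampleMean (fun i => Z i ω) n (fun z => noise f z * g z.1)| ≤ R}
  rw [probReal_univ] at h1
  linarith

end Rate

/-! ### The irrepresentable condition -/

section Irrepresentable

variable {ι : Type*} [Fintype ι] {F : ι → Type*}
  [∀ i, NormedAddCommGroup (F i)] [∀ i, InnerProductSpace ℝ (F i)] [∀ i, CompleteSpace (F i)]
  {L : Type*} [NormedAddCommGroup L] [InnerProductSpace ℝ L] [CompleteSpace L]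

theorem inner_ridgeInv_comm (J : PiLp 2 F →L[ℝ] L) {a : ι → ℝ} (ha : ∀ i, 0 < a i)
    (t₁ t₂ : PiLp 2 F) : ⟪t₁, ridgeInv J a t₂⟫_ℝ = ⟪ridgeInv J a t₁, t₂⟫_ℝ := by
  have h1 := inner_ridgeInv J ha (ridgeInv J a t₂) t₁
  have h2 := inner_ridgeInv J ha (ridgeInv J a t₁) t₂
  rw [real_inner_comm (J (ridgeInv J a t₁)), ← inner_diagOp_comm,
    real_inner_comm (ridgeInv J a t₁)] at h1
  rw [← h2, h1, real_inner_comm]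

/-- Changing the weights from `b` to `a` changes the ridge solution by the solution for the data
`Diag(a - b) s'`. -/
theorem ridgeInv_sub_ridgeInv (J : PiLp 2 F →L[ℝ] L) {a b : ι → ℝ} (ha : ∀ i, 0 < a i)
    (hb : ∀ i, 0 < b i) (t : PiLp 2 F) :
    ridgeInv J b t - ridgeInv J a t
      = ridgeInv J a (diagOp (fun i => a i - b i) (ridgeInv J b t)) := by
  have h1 : ridge J a (ridgeInv J b t) = t + diagOp (fun i => a i - b i) (ridgeInv J b t) := by
    refine ext_inner_left ℝ fun h => ?_
    rw [inner_ridge, inner_add_right, ← inner_ridgeInv J hb h t, add_assoc]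
    congr 1
    simp only [inner_diagOp, ← Finset.sum_add_distrib]
    exact Finset.sum_congr rfl fun i _ => by ring
  rw [sub_eq_iff_eq_add', ← map_add, ← h1, ridgeInv_ridge J ha]

variable {𝒳 : Type*} [MeasurableSpace 𝒳] {M : ℕ} {H : Fin M → Type*}
  [∀ m, NormedAddCommGroup (H m)] [∀ m, InnerProductSpace ℝ (H m)]
  [∀ m, CompleteSpace (H m)] [∀ m, RKHS ℝ (H m) 𝒳 ℝ]

/-- By self-adjointness, the vector of the irrepresentable condition is dual to the bias in the
direction of the ridge solution with the constant weight `b`. -/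
theorem inner_irrepVec (hk : ∀ m, KernelAssumption (H m)) (ν : Measure 𝒳) [IsProbabilityMeasure ν]
    (f : PiLp 2 H) {a b : ℝ} (ha : 0 < a) (hb : 0 < b) {m : Fin M} (v : H m) :
    ⟪v, irrepVec ν f a b m⟫_ℝ = 2 / a *
      ⟪diagOp (weight a b f) (restrict f (activeSet f)), ridgeInv (sumL2 hk ν (activeSet f))
        (fun _ => b) ((sumL2 hk ν (activeSet f)).adjoint (toL2 (hk m) ν v))⟫_ℝ := by
  have h1 : diagOp (fun l : activeSet f => ‖f l‖⁻¹) (restrict f (activeSet f))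
      + (2 * (b / a)) • restrict f (activeSet f)
      = (2 / a) • diagOp (weight a b f) (restrict f (activeSet f)) := by
    refine PiLp.ext fun l => ?_
    rw [PiLp.add_apply, PiLp.smul_apply, PiLp.smul_apply, diagOp_apply, diagOp_apply, ← add_smul,
      smul_smul, weight]
    congr 1
    field_simp
    ring
  rw [irrepVec, covII_add_eq_ridge hk, ← ridgeInv, inner_covRow hk, h1, map_smul, map_smul,
    inner_smul_right, ← ContinuousLinearMap.adjoint_inner_left,
    inner_ridgeInv_comm _ (fun _ => hb), real_inner_comm]

set_option maxHeartbeats 1000000 in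
/-- The irrepresentable condition holds in the limit. Once `λ₁ √n → ∞`, the noise is negligible
relative to `λ₁`, so the subgradient inequality on the inactive blocks bounds the bias. Replacing
the weights of the ridge problem by their common part `λ₂` changes the bias by `o(λ₁)` because of
the source condition. -/
theorem eventually_norm_irrepVec_le {Ω : Type*} [MeasurableSpace Ω] {P : Measure Ω}
    [IsProbabilityMeasure P] {Z : ℕ → Ω → 𝒳 × ℝ} {f : PiLp 2 H} {lam1 lam2 : ℕ → ℝ}
    {fhat : ℕ → Ω → PiLp 2 H} {ρ : Measure (𝒳 × ℝ)} [IsProbabilityMeasure ρ]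
    {hk : ∀ m, KernelAssumption (H m)} {μ : Fin M → ℕ → ℝ}
    {φ : Fin M → ℕ → 𝒳 → ℝ} (S : ∀ m, SpectralRep (ρ.map Prod.fst) (ker (H m)) (μ m) (φ m))
    (hlaw : ∀ i, HasLaw (Z i) ρ P) (hind : iIndepFun Z P) (hmod : ModelAssumption ρ f)
    (h_lam1 : ∀ n, 0 ≤ lam1 n) (h_lam2 : ∀ n, 0 < lam2 n)
    (hpar : (activeSet f).Nonempty → Tendsto lam1 atTop (𝓝 0) ∧ Tendsto lam2 atTop (𝓝 0))
    (hgood : ∀ η > 0, Tendsto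
      (fun n => P.real (goodEvent Z n (lam1 n) (lam2 n) f (fhat n) η)ᶜ) atTop (𝓝 0))
    {D : ℝ} (hD0 : 0 ≤ D) (hD : DiagBounded (sumL2 hk (ρ.map Prod.fst) (activeSet f)) D)
    {Cf : ℝ} (hCf : 0 ≤ Cf)
    (hf : ∀ (l : activeSet f) (t : PiLp 2 (fun l : activeSet f => H l)),
      |⟪restrict f (activeSet f) l, t l⟫_ℝ|
        ≤ Cf * ‖sumL2 hk (ρ.map Prod.fst) (activeSet f) t‖)
    (hrate : Tendsto (fun n => lam1 n * √(n : ℝ)) atTop atTop)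
    {m : Fin M} (hm : m ∉ activeSet f) {ε : ℝ} (hε : 0 < ε) :
    ∀ᶠ n in atTop, ‖irrepVec (ρ.map Prod.fst) f (lam1 n) (lam2 n) m‖ ≤ 1 + ε := by
  rcases (activeSet f).eq_empty_or_nonempty with hI | hI
  · refine Eventually.of_forall fun n => ?_
    have hE : IsEmpty (activeSet f) := by rw [hI]; infer_instance
    have : irrepVec (ρ.map Prod.fst) f (lam1 n) (lam2 n) m = 0 :=
      (congrArg (covRow H (ρ.map Prod.fst) m (activeSet f)) (Subsingleton.elim _ 0)).trans
        (map_zero _)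
    rw [this, norm_zero]
    positivity
  obtain ⟨hl1, hl2⟩ := hpar hI
  obtain ⟨K, η₀, hK, hη₀, hbias⟩ :=
    exists_sqrt_mul_abs_bias_le (hk := hk) S hlaw hind hmod hD0 hD hCf hf
  obtain ⟨q, Q, hq, hQ, hw⟩ := exists_weight_bounds f
  set ν := ρ.map Prod.fst with hν
  set J := sumL2 hk ν (activeSet f) with hJ
  set A : ℝ := (∑ m, ‖f m‖⁻¹) * D with hA
  have hA0 : 0 ≤ A := mul_nonneg (Finset.sum_nonneg fun m _ => by positivity) hD0
  obtain ⟨η, hη0, hηle, hηK⟩ : ∃ η : ℝ, 0 < η ∧ η ≤ η₀ ∧ K * η ≤ ε / 8 := by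
    refine ⟨min η₀ (ε / 8 / (K + 1)), by positivity, min_le_left _ _, ?_⟩
    refine (mul_le_mul_of_nonneg_left (min_le_right _ _) hK).trans ?_
    rw [mul_div_assoc', div_le_iff₀ (by positivity)]
    nlinarith
  obtain ⟨δ, hδ0, hδA⟩ : ∃ δ : ℝ, 0 < δ ∧ δ * A ≤ ε / 4 := by
    refine ⟨ε / 4 / (A + 1), by positivity, ?_⟩
    rw [div_mul_eq_mul_div, div_le_iff₀ (by positivity)]
    nlinarith
  obtain ⟨r, hr0, hr⟩ := exists_forall_inner_ridgeInv_le hD0 hD hf hq hQ hδ0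
  have hl12 : Tendsto (fun n => lam1 n + lam2 n) atTop (𝓝 0) := by simpa using hl1.add hl2
  filter_upwards [eventually_gt_atTop 0, hl12.eventually (gt_mem_nhds hr0),
    (hgood η hη0).eventually (gt_mem_nhds (show (0 : ℝ) < 1 / 2 by norm_num)),
    hrate.eventually_ge_atTop (8 * (K + ε / 8) / ε + 1)] with n hn hnr hng hnx
  set a := lam1 n with ha
  set b := lam2 n with hb
  set x := a * √n with hx
  have hx0 : 0 < x := by
    have : 0 ≤ 8 * (K + ε / 8) / ε := by positivity
    linarith
  have hn0 : (0 : ℝ) < √n := by positivity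
  have ha0 : 0 < a := by
    rcases (h_lam1 n).eq_or_lt with h | h
    · rw [hx, ha, ← h, zero_mul] at hx0; exact absurd hx0 (lt_irrefl 0)
    · exact h
  have hb0 : 0 < b := h_lam2 n
  have hx1 : K + ε / 8 ≤ ε / 8 * x := by
    have h1 : 8 * (K + ε / 8) / ε ≤ x := by linarith
    rw [div_le_iff₀ hε] at h1
    linarith
  by_cases hzero : irrepVec ν f a b m = 0
  · rw [hzero, norm_zero]; positivity
  have hirr : 0 < ‖irrepVec ν f a b m‖ := norm_pos_iff.mpr hzero
  set v : H m := ‖irrepVec ν f a b m‖⁻¹ • irrepVec ν f a b m with hv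
  have hv1 : ‖v‖ = 1 := by
    rw [hv, norm_smul, norm_inv, norm_norm, inv_mul_cancel₀ hirr.ne']
  have hvi : ⟪v, irrepVec ν f a b m⟫_ℝ = ‖irrepVec ν f a b m‖ := by
    rw [hv, real_inner_smul_left, real_inner_self_eq_norm_mul_norm, inv_mul_cancel_left₀ hirr.ne']
  rw [inner_irrepVec hk ν f ha0 hb0] at hvi
  have hbn := hbias n hn a b ha0.le hb0 (fhat n) η hη0.le hηle hng m hm v hv1.le
  set w := weight a b f (I := activeSet f) with hwdef
  set z := J.adjoint (toL2 (hk m) ν v) with hz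
  have hw0 : ∀ l, 0 < w l := weight_pos ha0.le hb0 f
  -- the effect of the weights on the bias
  have hdiff : |⟪diagOp w (restrict f (activeSet f)), ridgeInv J (fun _ => b) z⟫_ℝ
      - ⟪diagOp w (restrict f (activeSet f)), ridgeInv J w z⟫_ℝ| ≤ δ * (a / 2 * A) := by
    rw [← inner_sub_right, ridgeInv_sub_ridgeInv J hw0 (fun _ => hb0)]
    refine (hr (a + b) w (by positivity) hnr (hw a b ha0.le hb0) _).trans ?_
    refine mul_le_mul_of_nonneg_left ?_ hδ0.le
    refine (hD _ (a / 2 * ∑ m, ‖f m‖⁻¹) (fun l => ?_) _).trans ?_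
    · have h1 : ‖f l‖⁻¹ ≤ ∑ m, ‖f m‖⁻¹ :=
        Finset.single_le_sum (f := fun m => ‖f m‖⁻¹) (fun m _ => by positivity)
          (Finset.mem_univ (l : Fin M))
      have h2 : w l - b = a / 2 * ‖f l‖⁻¹ := by rw [hwdef, weight]; ring
      rw [h2, abs_of_nonneg (by positivity)]
      gcongr
    · have h1 : ‖J (ridgeInv J (fun _ => b) z)‖ ≤ 1 :=
        (norm_map_ridgeInv_adjoint_le J (fun _ => hb0) _).trans
          ((norm_toL2_le (hk m) ν v).trans hv1.le)
      rw [hA, ← mul_assoc]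
      exact mul_le_of_le_one_right (mul_nonneg (mul_nonneg (by positivity)
        (Finset.sum_nonneg fun m _ => by positivity)) hD0) h1
  have h1 : ⟪diagOp w (restrict f (activeSet f)), ridgeInv J (fun _ => b) z⟫_ℝ
      = a / 2 * ‖irrepVec ν f a b m‖ := by
    have e : a / 2 * (2 / a) = 1 := by field_simp
    refine Eq.trans ?_ (congrArg (a / 2 * ·) hvi)
    rw [← mul_assoc, e, one_mul]
  rw [h1] at hdiff
  have h2 := (le_abs_self _).trans hdiff
  have h3 := le_abs_self ⟪diagOp w (restrict f (activeSet f)), ridgeInv J w z⟫_ℝ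
  have h4 : x / 2 * ‖irrepVec ν f a b m‖
      ≤ √n * |⟪diagOp w (restrict f (activeSet f)), ridgeInv J w z⟫_ℝ| + x / 2 * (δ * A) := by
    have h5 : a / 2 * ‖irrepVec ν f a b m‖
        ≤ |⟪diagOp w (restrict f (activeSet f)), ridgeInv J w z⟫_ℝ| + a / 2 * (δ * A) := by
      linarith
    have h6 := mul_le_mul_of_nonneg_left h5 hn0.le
    rw [hx]
    linarith
  have h5 : x / 2 * ‖irrepVec ν f a b m‖ ≤ x / 2 * (1 + ε) := by
    have e1 : x * (K * η) ≤ x * (ε / 8) := mul_le_mul_of_nonneg_left hηK hx0.le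
    have e2 : x / 2 * (δ * A) ≤ x / 2 * (ε / 4) := mul_le_mul_of_nonneg_left hδA (by positivity)
    have e3 : 0 ≤ x * ε := by positivity
    nlinarith
  exact le_of_mul_le_mul_left h5 (by positivity)

end Irrepresentable

end ElasticMKL

end

open ElasticMKL in
theorem theorem5
    {𝒳 : Type*} [MeasurableSpace 𝒳]
    {M : ℕ} {H : Fin M → Type*}
    [∀ m, NormedAddCommGroup (H m)] [∀ m, InnerProductSpace ℝ (H m)]
    [∀ m, CompleteSpace (H m)] [∀ m, RKHS ℝ (H m) 𝒳 ℝ]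
    -- the law `ρ` of `(X, Y)`, and the i.i.d. sample `Z`
    (ρ : Measure (𝒳 × ℝ)) [IsProbabilityMeasure ρ]
    {Ω : Type*} [MeasurableSpace Ω] (P : Measure Ω) [IsProbabilityMeasure P]
    (Z : ℕ → Ω → 𝒳 × ℝ) (hZ_law : ∀ i, HasLaw (Z i) ρ P) (hZ_indep : iIndepFun Z P)
    -- the truth, the spectral representations of the kernels, and the assumptions
    (fstar : PiLp 2 H)
    (μ : Fin M → ℕ → ℝ) (φ : Fin M → ℕ → 𝒳 → ℝ)
    (h_spec : ∀ m, SpectralRep (ρ.map Prod.fst) (ker (H m)) (μ m) (φ m))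
    (h_model : ModelAssumption ρ fstar)
    (h_ker : ∀ m, KernelAssumption (H m))
    (h_source : ∀ m, SourceCondition (h_spec m) (fstar m))
    (h_corr : CorrelationAssumption H (ρ.map Prod.fst))
    -- the regularization parameters and the estimator
    (lam1 lam2 : ℕ → ℝ) (h_lam1 : ∀ n, 0 ≤ lam1 n) (h_lam2 : ∀ n, 0 < lam2 n)
    (fhat : ℕ → Ω → PiLp 2 H)
    (h_fhat : ∀ n, ∀ᵐ ω ∂P,
      IsMinOn (objective (fun i => Z i ω) n (lam1 n) (lam2 n)) Set.univ (fhat n ω))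
    -- consistency in norm and of the support, in probability
    (h_cons : TendstoInMeasure P fhat atTop (fun _ => fstar))
    (h_supp : Tendsto (fun n => P {ω | activeSet (fhat n ω) ≠ activeSet fstar}) atTop (𝓝 0)) :
    ((activeSet fstar).Nonempty → Tendsto lam1 atTop (𝓝 0) ∧ Tendsto lam2 atTop (𝓝 0)) ∧
    (∀ m ∉ activeSet fstar,
      limsup (fun n => ‖irrepVec (ρ.map Prod.fst) fstar (lam1 n) (lam2 n) m‖ₑ) atTop ≤ 1) ∧
    ((∃ m ∉ activeSet fstar, Nontrivial (H m)) →
      Tendsto (fun n => lam1 n * √(n : ℝ)) atTop atTop) := by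
  have hinj := fun m => (h_spec m).toL2_injective (h_ker m)
  obtain ⟨C, hC, hsum⟩ := h_corr.exists_sum_norm_sq_le h_ker hinj
  obtain ⟨D, hD0, hD, hDl, hsep⟩ := exists_separation hC hsum (activeSet fstar)
  obtain ⟨Cf, hCf, hf⟩ := exists_abs_inner_restrict_le h_source hD0 hDl
  have hgood := fun η (hη : η > 0) =>
    tendsto_measureReal_compl_goodEvent h_fhat h_cons h_supp hη
  have hpar := tendsto_parameters h_ker hZ_law hZ_indep h_model h_lam1 h_lam2 hgood
  have hrate : ∀ m ∉ activeSet fstar, Nontrivial (H m) →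
      Tendsto (fun n => lam1 n * √(n : ℝ)) atTop atTop := fun m hm _ =>
    tendsto_lam_mul_sqrt h_spec hZ_law hZ_indep h_model h_lam1 h_lam2 hpar hgood hD0 hD hsep hCf hf
      hm
  refine ⟨hpar, fun m hm => ?_, fun ⟨m, hm, hH⟩ => hrate m hm hH⟩
  rcases subsingleton_or_nontrivial (H m) with hH | hH
  · have h0 : ∀ n, irrepVec (ρ.map Prod.fst) fstar (lam1 n) (lam2 n) m = 0 :=
      fun n => Subsingleton.elim _ _
    simp [h0]
  · refine ENNReal.le_of_forall_pos_le_add fun ε hε _ => ?_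
    refine limsup_le_of_le (by isBoundedDefault) ?_
    filter_upwards [eventually_norm_irrepVec_le h_spec hZ_law hZ_indep h_model h_lam1 h_lam2 hpar
      hgood hD0 hD hCf hf (hrate m hm hH) hm (show (0 : ℝ) < ε from hε)] with n hn
    rw [← ofReal_norm]
    refine (ENNReal.ofReal_le_ofReal hn).trans ?_
    rw [ENNReal.ofReal_add zero_le_one ε.coe_nonneg, ENNReal.ofReal_one, ENNReal.ofReal_coe_nnreal]
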